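/- **Conventions.** For a language $L$, its alphabet $\Sigma_L$ is the set of letters that occur in some word of $L$; the quotients of $L$ are the languages $w^{-1}L=\{x\mid wx\in L\}$, $w\in\Sigma_L^*$, and the complexity $\kappa(L)$ is the number of distinct quotients of $L$. All alphabets are finite. $L$ is suffix-closed if it contains every suffix of each of its words. The syntactic semigroup of $L$ is $\Sigma_L^+/{\approx}$, where $x\approx y$ iff $wxz\in L\Leftrightarrow wyz\in L$ for all $w,z\in\Sigma_L^*$. The atoms of $L$ are the classes of the congruence on $\Sigma_L^*$ under which $x,y$ are equivalent iff $ux\in L\Leftrightarrow uy\in L$ for all $u\in\Sigma_L^*$; if $K_0=L,K_1,\dots,K_{n-1}$ are the quotients of $L$, each atom has the form $A_S=\bigcap_{i\in S}K_i\cap\bigcap_{i\notin S}\overline{K_i}$ with $S\subseteq Q_n=\{0,\dots,n-1\}$. A DFA is minimal if all its states are reachable and no two are equivalent. For $n\ge 4$ let $\mathcal D_n(a,b,c,d,e)$ be the DFA with state set $Q_n$, initial state $0$, set of final states $\{0\}$, and letters acting by the cycle $a\colon(1,\dots,n-1)$, the transposition $b\colon(1,2)$, the maps $c\colon(n-1\to1)$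 and $d\colon(n-1\to0)$ that fix all other states, and the constant map $e\colon(Q_n\to1)$. Let $L_n=L_n(a,b,c,d,e)$ be its language; it is the complement of the language $M_n$ accepted by the same automaton with final states $\{1,\dots,n-1\}$. For letters or blanks $x_1,\dots,x_5$ (the letters distinct), the dialect $L_n(x_1,\dots,x_5)$ is obtained from $L_n$ by replacing $a,b,c,d,e$ by $x_1,\dots,x_5$ in all words and deleting the words that contain a letter replaced by a blank "$-$". **Theorem.** Let $m,n\ge4$. The DFA $\mathcal D_n(a,b,c,d,e)$ is minimal, and $L_n$ is suffix-closed and has complexity $n$. The dialects below are suffix-closed languages of complexity $n$ (or $m$, when the index is $m$). The stream $(L_n\mid n\ge4)$ with these dialects is most complex in the class of suffix-closed languages: each value below is attained as stated, and it is the maximum of the measure in question over all suffix-closed languages of complexity $n$ (for binary operations: over all pairs of suffix-closed languages of complexities $m$ and $n$; "restricted" means that the two languages have the same alphabet, "unrestricted" that their alphabets are arbitrary). 1. The syntactic semigroup of $L_n(a,b,c,d,e)$ has cardinality $n^{n-1}+n-1$. No suffix-closed language of complexity $n$ whose alphabet has fewer than five letters meets this bound. 2. All quotients of $L_n(a,-,-,d,e)$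 have complexity $n$. 3. The reverse of $L_n(a,-,-,d,e)$ has complexity $2^{n-1}+1$, and $L_n(a,-,-,d,e)$ has $2^{n-1}+1$ atoms. 4. For each atom $A_S$ of $L_n(a,b,c,d,e)$: $\kappa(A_S)=n$ if $S=\emptyset$; $\kappa(A_S)=2^{n-1}$ if $S=Q_n$; and otherwise $0\in S\subsetneq Q_n$ and $$\kappa(A_S)=1+\sum_{x=1}^{|S|}\sum_{y=1}^{n-|S|}\binom{n-1}{y}\binom{n-y-1}{x-1}.$$ (Maximality here: for every atom $A_S$ of a suffix-closed language of complexity $n$, $\kappa(A_S)$ is at most the value given for its $S$, and $S$ falls under one of these three cases.) 5. The star of $L_n(a,-,-,d,e)$ has complexity $n$. 6. Product: restricted, $\kappa(L_m(a,b,-,d,e)\,L_n(a,e,-,d,b))=mn-n+1$; unrestricted, $\kappa(L_m(a,b,c,d,e)\,L_n(a,e,f,d,b))=mn+m+1$. 7. Boolean operations: restricted, $\kappa(L_m(a,b,-,d,e)\circ L_n(a,e,-,d,b))=mn$ for $\circ\in\{\cup,\oplus,\cap,\setminus\}$; unrestricted, $\kappa(L_m(a,b,c,d,e)\circ L_n(a,e,f,d,b))$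 equals $(m+1)(n+1)$ for $\circ\in\{\cup,\oplus\}$, $mn+m$ for $\circ=\setminus$, and $mn$ for $\circ=\cap$. -/

import Mathlib

open scoped Computability symmDiff

universe u v

namespace SuffixClosed

/-! ### Languages, alphabets, quotient complexity -/

/-- The alphabet of a language: the letters that appear in some word of it. -/
def alph {α : Type u} (L : Language α) : Set α := {x | ∃ w ∈ L, x ∈ w}

/-- `w` is a word over the alphabet of `L`. -/
def IsWord {α : Type u} (L : Language α) (w : List α) : Prop := ∀ x ∈ w, x ∈ alph L

/-- The set of (left) quotients `w⁻¹L = {x | wx ∈ L}`, with `w` a word over the alphabet of `L`. -/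
def quotients {α : Type u} (L : Language α) : Set (Language α) :=
  {K | ∃ w : List α, IsWord L w ∧ K = L.leftQuotient w}

/-- The quotient complexity `κ(L)`: the number of distinct quotients of `L`
(`⊤` if there are infinitely many). -/
noncomputable def kappa {α : Type u} (L : Language α) : ℕ∞ := (quotients L).encard

/-- A language is suffix-closed if it contains all suffixes of its words. -/
def IsSuffixClosed {α : Type u} (L : Language α) : Prop :=
  ∀ w x : List α, w ∈ L → x <:+ w → x ∈ L

/-- A DFA is minimal if all its states are reachable and no two states are equivalent. -/
def IsMinimalDFA {α : Type u} {σ : Type v} (D : DFA α σ) : Prop :=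
  (∀ q : σ, ∃ w : List α, D.eval w = q) ∧
    ∀ p q : σ, D.acceptsFrom p = D.acceptsFrom q → p = q

/-! ### Syntactic semigroup -/

/-- A nonempty word over the alphabet of `L`, seen as a list. -/
def toWord {α : Type u} (L : Language α) (x : FreeSemigroup (alph L)) : List α :=
  (x.head :: x.tail).map Subtype.val

theorem toWord_mul {α : Type u} (L : Language α) (x y : FreeSemigroup (alph L)) :
    toWord L (x * y) = toWord L x ++ toWord L y := by
  simp [toWord, FreeSemigroup.head_mul, FreeSemigroup.tail_mul]

theorem toWord_isWord {α : Type u} (L : Language α) (x : FreeSemigroup (alph L)) :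
    IsWord L (toWord L x) := by
  intro a ha
  obtain ⟨b, _, rfl⟩ := List.mem_map.1 ha
  exact b.2

/-- The Myhill (syntactic) congruence of `L` on the semigroup `Σ⁺` of nonempty words over the
alphabet `Σ` of `L`: `x ≈ y` iff `wxz ∈ L ↔ wyz ∈ L` for all `w, z ∈ Σ*`. -/
def syntacticCon {α : Type u} (L : Language α) : Con (FreeSemigroup (alph L)) where
  r x y := ∀ w z : List α, IsWord L w → IsWord L z →
    (w ++ toWord L x ++ z ∈ L ↔ w ++ toWord L y ++ z ∈ L)
  iseqv := ⟨fun _ _ _ _ _ => Iff.rfl, fun h w z hw hz => (h w z hw hz).symm,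
    fun h h' w z hw hz => (h w z hw hz).trans (h' w z hw hz)⟩
  mul' := by
    intro x x' y y' h h' w z hw hz
    have e1 := h w (toWord L y ++ z) hw (by
      intro a ha
      rcases List.mem_append.1 ha with ha | ha
      · exact toWord_isWord L y a ha
      · exact hz a ha)
    have e2 := h' (w ++ toWord L x') z (by
      intro a ha
      rcases List.mem_append.1 ha with ha | ha
      · exact hw a ha
      · exact toWord_isWord L x' a ha) hz
    simp only [toWord_mul, List.append_assoc] at e1 e2 ⊢
    exact e1.trans e2

/-- The syntactic semigroup `T_L = Σ⁺ / ≈_L`. -/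
abbrev SyntacticSemigroup {α : Type u} (L : Language α) := (syntacticCon L).Quotient

/-! ### Atoms -/

/-- The atoms of `L`: the classes of the left congruence on `Σ*` (`Σ` the alphabet of `L`) under
which `x` and `y` are equivalent iff `ux ∈ L ↔ uy ∈ L` for all `u ∈ Σ*`. -/
def atoms {α : Type u} (L : Language α) : Set (Language α) :=
  {A | ∃ x : List α, IsWord L x ∧
    A = {y : List α | IsWord L y ∧ ∀ u : List α, IsWord L u → (u ++ x ∈ L ↔ u ++ y ∈ L)}}

/-- For a set `S` of quotients of `L`, the language
`A_S = ⋂_{K ∈ S} K ∩ ⋂_{K ∉ S} Kᶜ`, with `K` ranging over the quotients of `L` and complements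
taken in `Σ*`, `Σ` being the alphabet of `L`. -/
def atomOf {α : Type u} (L : Language α) (S : Set (Language α)) : Language α :=
  {x : List α | IsWord L x ∧ ∀ K ∈ quotients L, (x ∈ K ↔ K ∈ S)}

/-- `1 + ∑_{x=1}^{s} ∑_{y=1}^{n-s} C(n-1, y) C(n-y-1, x-1)`. -/
def atomValue (n s : ℕ) : ℕ :=
  1 + ∑ x ∈ Finset.Icc 1 s, ∑ y ∈ Finset.Icc 1 (n - s),
    (n - 1).choose y * (n - y - 1).choose (x - 1)

/-! ### The witness stream and its dialects -/

/-- The five-letter alphabet of the witness stream. -/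
inductive Letter5
  | a | b | c | d | e

/-- The six-letter alphabet over which the dialects are taken. -/
inductive Letter6
  | a | b | c | d | e | f

/-- The transformations of `Q_n = {0, …, n-1}` (`n ≥ 4`) induced by the letters:
`a : (1, …, n-1)`, `b : (1, 2)`, `c : (n-1 → 1)`, `d : (n-1 → 0)`, `e : (Q_n → 1)`. -/
def step (n : ℕ) (hn : 4 ≤ n) (q : Fin n) : Letter5 → Fin n
  | .a => if h0 : q.val = 0 then q
          else if h : q.val + 1 < n then ⟨q.val + 1, h⟩ else ⟨1, by omega⟩
  | .b => Equiv.swap (⟨1, by omega⟩ : Fin n) ⟨2, by omega⟩ q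
  | .c => if q.val = n - 1 then ⟨1, by omega⟩ else q
  | .d => if q.val = n - 1 then ⟨0, by omega⟩ else q
  | .e => ⟨1, by omega⟩

/-- The DFA `D_n(a,b,c,d,e)` with initial state `0` and set of final states `{0}`. -/
def D (n : ℕ) (hn : 4 ≤ n) : DFA Letter5 (Fin n) where
  step := step n hn
  start := ⟨0, by omega⟩
  accept := {⟨0, by omega⟩}

/-- The DFA `E_n(a,b,c,d,e)`: as `D_n`, but with set of final states `{1, …, n-1}`. -/
def E (n : ℕ) (hn : 4 ≤ n) : DFA Letter5 (Fin n) where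
  step := step n hn
  start := ⟨0, by omega⟩
  accept := {q | q.val ≠ 0}

/-- The language `L_n = L_n(a,b,c,d,e)` accepted by `D_n`. -/
def L (n : ℕ) (hn : 4 ≤ n) : Language Letter5 := (D n hn).accepts

/-- The left ideal `M_n = M_n(a,b,c,d,e)` accepted by `E_n`. -/
def M (n : ℕ) (hn : 4 ≤ n) : Language Letter5 := (E n hn).accepts

/-- The dialect of a language for a partial map `π` of alphabets: each letter `x` of each word is
replaced by `π x`, and the word is deleted if `π` is undefined (`none`) at one of its letters.
(Used only for maps that are injective where defined.) -/
def dialect {α : Type u} {β : Type v} (π : α → Option β) (K : Language α) : Language β :=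
  {v : List β | ∃ w ∈ K, w.map π = v.map some}

/-- The dialect `L_n(x₁, x₂, x₃, x₄, x₅)`, with `none` for the undefined value `-`. -/
def Ldial (n : ℕ) (hn : 4 ≤ n) (x₁ x₂ x₃ x₄ x₅ : Option Letter6) : Language Letter6 :=
  dialect (fun l : Letter5 => match l with
    | .a => x₁ | .b => x₂ | .c => x₃ | .d => x₄ | .e => x₅) (L n hn)

/-- `L_n(a,-,-,d,e)`. -/
def Lade (n : ℕ) (hn : 4 ≤ n) : Language Letter6 :=
  Ldial n hn (some .a) none none (some .d) (some .e)

/-- `L_n(a,b,-,d,e)`. -/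
def Labde (n : ℕ) (hn : 4 ≤ n) : Language Letter6 :=
  Ldial n hn (some .a) (some .b) none (some .d) (some .e)

/-- `L_n(a,e,-,d,b)`. -/
def Laedb (n : ℕ) (hn : 4 ≤ n) : Language Letter6 :=
  Ldial n hn (some .a) (some .e) none (some .d) (some .b)

/-- `L_n(a,b,c,d,e)` as a language over a part of the six-letter alphabet. -/
def Labcde (n : ℕ) (hn : 4 ≤ n) : Language Letter6 :=
  Ldial n hn (some .a) (some .b) (some .c) (some .d) (some .e)

/-- `L_n(a,e,f,d,b)`. -/
def Laefdb (n : ℕ) (hn : 4 ≤ n) : Language Letter6 :=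
  Ldial n hn (some .a) (some .e) (some .f) (some .d) (some .b)

/-- `K` is a suffix-closed language of complexity `n` (in particular regular). -/
def InClass {α : Type u} (K : Language α) (n : ℕ) : Prop := IsSuffixClosed K ∧ kappa K = n

end SuffixClosed

open SuffixClosed

universe w

namespace SuffixClosed

/-! ### Words, quotients and complexity -/

/-! Everything rests on one fact: each quotient of a suffix-closed language `K` is contained in `K`.
Hence the quotients form a finite poset under inclusion with greatest element `K`, and words act on
it by monotone maps.

Upper bounds. The syntactic semigroup is a set of monotone self-maps of a poset with top `t`. If the
points other than `t` form an antichain, such a map fixes `t` or is constant, which gives n^(n-1) +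
n - 1 maps; a comparable pair below `t` leaves strictly fewer (`ncard_monotone_le`). Equality
therefore makes the semigroup `fixOrConst t`, and this needs five kinds of generators
(`five_le_encard_of_generates`). The set of quotients that contain a given word is empty or contains
`K`, so there are at most 2^(n-1) + 1 such sets; they determine both the atoms and the quotients of
the reverse. For star and product, the inclusion of quotients in `K` lets the set of pending
factorisations collapse to `K` as soon as a factor may end, so one quotient, or one pair of
quotients, describes the state. A quotient of an atom is an intersection of some quotients minus a
union of others; as all of them lie below w⁻¹`K`, that one element can be left out of the
description, up to a small exception, and pairs of disjoint subsets remain to be counted. Boolean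
operations are governed by pairs of quotients; in the unrestricted case foreign letters add the
empty quotient.

Lower bounds. In `D n hn` the words without `e` induce exactly the maps that fix 0
(`gen_of_apply_zero`): `a` and `b` generate the permutations fixing 0, and conjugates of `c` and `d`
merge one state into another. The letter `e` adds the constants. This settles the semigroup and the
atoms, because any required word exists. The dialects need explicit words: a^(n-1-i) d takes only
`i` and 0 to 0. In the binary operations one letter is a permutation in the first automaton and a
constant map in the second, and another letter does the converse (`IsPair`), so one component can be
steered or tested while the other is held in a known position. A letter acting as `c` in one dialect
and missing from the other reaches the sink of the latter. -/

theorem IsWord.nil {α : Type u} {L : Language α} : IsWord L [] := by simp [IsWord]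

theorem IsWord.append {α : Type u} {L : Language α} {w z : List α}
    (hw : IsWord L w) (hz : IsWord L z) : IsWord L (w ++ z) := by
  intro x hx
  rcases List.mem_append.1 hx with h | h
  exacts [hw x h, hz x h]

theorem isWord_append {α : Type u} {L : Language α} {w z : List α} :
    IsWord L (w ++ z) ↔ IsWord L w ∧ IsWord L z :=
  ⟨fun h => ⟨fun x hx => h x (by simp [hx]), fun x hx => h x (by simp [hx])⟩,
    fun h => h.1.append h.2⟩

theorem isWord_of_mem {α : Type u} {L : Language α} {w : List α} (h : w ∈ L) : IsWord L w :=
  fun _ hx => ⟨w, h, hx⟩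

theorem IsWord.mono {α : Type u} {L K : Language α} (h : alph L ⊆ alph K) {w : List α}
    (hw : IsWord L w) : IsWord K w := fun x hx => h (hw x hx)

theorem alph_mono {α : Type u} {L K : Language α} (h : ∀ w, w ∈ L → w ∈ K) :
    alph L ⊆ alph K := fun _ ⟨w, hw, hx⟩ => ⟨w, h w hw, hx⟩

theorem leftQuotient_mem_quotients {α : Type u} {L : Language α} {w : List α} (h : IsWord L w) :
    L.leftQuotient w ∈ quotients L := ⟨w, h, rfl⟩

theorem self_mem_quotients {α : Type u} (L : Language α) : L ∈ quotients L :=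
  ⟨[], IsWord.nil, rfl⟩

theorem leftQuotient_mem_of_mem {α : Type u} {L P : Language α} {w : List α}
    (hP : P ∈ quotients L) (h : IsWord L w) : P.leftQuotient w ∈ quotients L := by
  obtain ⟨v, hv, rfl⟩ := hP
  rw [← Language.leftQuotient_append]
  exact leftQuotient_mem_quotients (hv.append h)

theorem leftQuotient_eq_bot {α : Type u} {L : Language α} {w : List α} (h : ¬ IsWord L w) :
    L.leftQuotient w = (0 : Language α) := by
  ext z
  simp only [Language.mem_leftQuotient, Language.notMem_zero, iff_false]
  exact fun hz => h (isWord_append.1 (isWord_of_mem hz)).1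

/-- A word with a letter foreign to `L` has empty quotient. This one additional value accounts for
the factors `m + 1` and `n + 1` in the unrestricted bounds. -/
theorem leftQuotient_mem_or {α : Type u} (L : Language α) (w : List α) :
    L.leftQuotient w ∈ insert (0 : Language α) (quotients L) := by
  by_cases h : IsWord L w
  · exact Or.inr (leftQuotient_mem_quotients h)
  · exact Or.inl (leftQuotient_eq_bot h)

theorem kappa_le_encard {α : Type u} {ι : Type v} {L : Language α} (S : Set ι)
    (g : ι → Language α) (h : ∀ w, IsWord L w → ∃ i ∈ S, L.leftQuotient w = g i) :
    kappa L ≤ S.encard := by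
  refine (Set.encard_le_encard ?_).trans (Set.encard_image_le g S)
  rintro _ ⟨w, hw, rfl⟩
  obtain ⟨i, hi, e⟩ := h w hw
  exact ⟨i, hi, e.symm⟩

theorem encard_le_kappa {α : Type u} {ι : Type v} {L : Language α} (S : Set ι)
    (f : ι → List α) (hw : ∀ i ∈ S, IsWord L (f i))
    (inj : ∀ i ∈ S, ∀ j ∈ S, (∀ z, f i ++ z ∈ L ↔ f j ++ z ∈ L) → i = j) :
    S.encard ≤ kappa L := by
  refine Set.encard_le_encard_of_injOn (f := fun i => L.leftQuotient (f i)) ?_ ?_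
  · intro i hi
    exact leftQuotient_mem_quotients (hw i hi)
  · intro i hi j hj e
    refine inj i hi j hj fun z => ?_
    have : z ∈ L.leftQuotient (f i) ↔ z ∈ L.leftQuotient (f j) := by
      simp only at e; rw [e]
    exact this

theorem encard_le_kappa_of_dfa {α : Type u} {σ : Type v} (D : DFA α σ) (S : Set σ)
    (reach : ∀ s ∈ S, ∃ w, IsWord D.accepts w ∧ D.eval w = s)
    (dist : ∀ s ∈ S, ∀ t ∈ S, s ≠ t →
      ∃ z, ¬ (D.evalFrom s z ∈ D.accept ↔ D.evalFrom t z ∈ D.accept)) :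
    S.encard ≤ kappa D.accepts := by
  classical
  have key : ∀ s : σ, ∃ w, s ∈ S → IsWord D.accepts w ∧ D.eval w = s := fun s => by
    by_cases h : s ∈ S
    · obtain ⟨w, hw⟩ := reach s h
      exact ⟨w, fun _ => hw⟩
    · exact ⟨[], fun h' => absurd h' h⟩
  choose f hf using key
  refine encard_le_kappa S f (fun i hi => (hf i hi).1) fun i hi j hj h => ?_
  by_contra hne
  obtain ⟨z, hz⟩ := dist i hi j hj hne
  apply hz
  have := h z
  simp only [DFA.mem_accepts, DFA.eval, DFA.evalFrom_of_append] at this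
  have e1 := (hf i hi).2
  have e2 := (hf j hj).2
  simp only [DFA.eval] at e1 e2
  rwa [e1, e2] at this

/-! ### Suffix-closed languages -/

theorem IsSuffixClosed.leftQuotient_subset {α : Type u} {K : Language α} (h : IsSuffixClosed K)
    {w z : List α} (hz : z ∈ K.leftQuotient w) : z ∈ K :=
  h (w ++ z) z hz (List.suffix_append w z)

theorem IsSuffixClosed.quotient_subset {α : Type u} {K P : Language α} (h : IsSuffixClosed K)
    (hP : P ∈ quotients K) {z : List α} (hz : z ∈ P) : z ∈ K := by
  obtain ⟨w, _, rfl⟩ := hP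
  exact h.leftQuotient_subset hz

theorem InClass.finite {α : Type u} {K : Language α} {n : ℕ} (h : InClass K n) :
    (quotients K).Finite := Set.finite_of_encard_eq_coe h.2

/-- The empty word is a suffix of every word, so a suffix-closed language without it is empty and
has a single quotient. -/
theorem InClass.nil_mem {α : Type u} {K : Language α} {n : ℕ} (h : InClass K n) (hn : 4 ≤ n) :
    [] ∈ K := by
  by_contra h0
  have hK : ∀ z, z ∉ K := fun z hz => h0 (h.1 z [] hz List.nil_suffix)
  have : kappa K ≤ 1 := by
    refine (Set.encard_le_one_iff).2 ?_
    rintro _ _ ⟨w, _, rfl⟩ ⟨v, _, rfl⟩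
    ext z
    exact ⟨fun h => absurd h (hK _), fun h => absurd h (hK _)⟩
  rw [h.2] at this
  have : n ≤ 1 := by exact_mod_cast this
  omega

theorem quotients_subset_of_mem {α : Type u} {K Q : Language α} (hQ : Q ∈ quotients K) :
    quotients Q ⊆ quotients K := by
  obtain ⟨v, hv, rfl⟩ := hQ
  rintro _ ⟨w, hw, rfl⟩
  refine leftQuotient_mem_of_mem (leftQuotient_mem_quotients hv) (hw.mono ?_)
  rintro x ⟨u, hu, hx⟩
  exact ⟨v ++ u, hu, by simp [hx]⟩

theorem kappa_quotient_le {α : Type u} {K Q : Language α} (hQ : Q ∈ quotients K) :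
    kappa Q ≤ kappa K := Set.encard_le_encard (quotients_subset_of_mem hQ)


/-! ### Counting monotone self-maps of a finite poset with a greatest element -/

open Finset in
-- Chains are extremal. Deleting a maximal element leaves the lower sets of the others unchanged,
-- and its own lower set has at most `#s` elements; induct on `#s`.
theorem sum_card_lower_le {P : Type v} [PartialOrder P] [DecidableEq P] [DecidableLE P] (g : ℕ → ℕ)
    (hg : Monotone g) (s : Finset P) :
    ∑ p ∈ s, g (#{q ∈ s | q ≤ p}) ≤ ∑ j ∈ Icc 1 (#s), g j := by
  induction h : #s generalizing s with
  | zero => simp [card_eq_zero.1 h]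
  | succ k ih =>
    obtain ⟨m, hm⟩ := s.exists_maximal (card_pos.1 (by omega))
    have hms : m ∈ s := hm.1
    have hk : #(s.erase m) = k := by rw [card_erase_of_mem hms]; omega
    rw [← add_sum_erase s _ hms, sum_Icc_succ_top (by omega), add_comm]
    refine add_le_add ?_ (hg ?_)
    · refine le_trans (le_of_eq ?_) (ih _ hk)
      refine sum_congr rfl fun p hp => ?_
      congr 2
      ext q
      simp only [mem_filter, mem_erase]
      refine ⟨fun hq => ⟨⟨?_, hq.1⟩, hq.2⟩, fun hq => ⟨hq.1.2, hq.2⟩⟩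
      rintro rfl
      have hp' := mem_erase.1 hp
      exact hp'.1 (le_antisymm (hm.2 hp'.2 hq.2) hq.2)
    · rw [← h]
      exact card_le_card (filter_subset _ _)

open Finset in
-- The relations ≤ and ≥ have equally many pairs in `s ×ˢ s`, and by antisymmetry they meet only on
-- the diagonal.
theorem two_mul_card_le_pairs {P : Type v} [PartialOrder P] [DecidableEq P] [DecidableLE P]
    (s : Finset P) :
    2 * #{x ∈ s ×ˢ s | x.1 ≤ x.2} ≤ #s * (#s + 1) := by
  have e : #{x ∈ s ×ˢ s | x.2 ≤ x.1} = #{x ∈ s ×ˢ s | x.1 ≤ x.2} := by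
    refine card_bij' (fun x _ => x.swap) (fun x _ => x.swap) ?_ ?_ ?_ ?_ <;> simp +contextual
  have := card_union_add_card_inter {x ∈ s ×ˢ s | x.1 ≤ x.2} {x ∈ s ×ˢ s | x.2 ≤ x.1}
  have h1 : #({x ∈ s ×ˢ s | x.1 ≤ x.2} ∪ {x ∈ s ×ˢ s | x.2 ≤ x.1}) ≤ #s * #s := by
    rw [← card_product]
    exact card_le_card (union_subset (filter_subset _ _) (filter_subset _ _))
  have h2 : #({x ∈ s ×ˢ s | x.1 ≤ x.2} ∩ {x ∈ s ×ˢ s | x.2 ≤ x.1}) ≤ #s := by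
    refine card_le_card_of_injOn Prod.fst ?_ ?_
    · intro x hx
      simp at hx ⊢
      tauto
    · rintro ⟨x, y⟩ hx ⟨x', y'⟩ hx' h
      simp at hx hx' h
      have a := le_antisymm hx.1.2 hx.2.2
      have b := le_antisymm hx'.1.2 hx'.2.2
      simp [← a, ← b, h]
  rw [e] at this
  nlinarith

/-- With n = N + 1, the left side is twice the bound for monotone maps in the worst case of lower
sets of sizes 1, …, n, and the right side is twice n^(n-1) + n - 1. The terms up to M = N - 1 are
summed by Bernoulli's inequality, and the last two are then absorbed one after the other. -/
theorem sum_pow_mul_lt (N : ℕ) (hN : 3 ≤ N) :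
    ∑ j ∈ Finset.Icc 1 (N + 1), j ^ (N - 1) * (j + 1) < 2 * ((N + 1) ^ N + N) := by
  obtain ⟨M, rfl⟩ : ∃ M, N = M + 1 := ⟨N - 1, by omega⟩
  -- Bernoulli's inequality (1 + 1/k)^r ≥ 1 + r/k, cleared of denominators.
  have bern : ∀ k r : ℕ, k ^ r * (k + r) ≤ k * (k + 1) ^ r := by
    intro k r
    induction r with
    | zero => simp
    | succ r ih =>
      have : k ^ (r + 1) * (k + (r + 1)) ≤ k ^ r * (k + r) * (k + 1) := by
        rw [pow_succ, mul_assoc, mul_assoc]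
        refine Nat.mul_le_mul_left _ ?_
        nlinarith
      calc _ ≤ _ := this
        _ ≤ k * (k + 1) ^ r * (k + 1) := Nat.mul_le_mul_right _ ih
        _ = _ := by ring
  have tele : ∀ k, k ≤ M → ∑ j ∈ Finset.Icc 1 k, j ^ M * (j + 1) ≤ k * (k + 1) ^ M := by
    intro k
    induction k with
    | zero => simp
    | succ k ih =>
      intro hk
      rw [Finset.sum_Icc_succ_top (by omega)]
      have h1 := ih (by omega)
      have h2 := bern (k + 1) M
      have h3 : (k + 1) ^ M * (k + 1 + (k + 1)) ≤ (k + 1) ^ M * (k + 1 + M) :=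
        Nat.mul_le_mul_left _ (by omega)
      calc _ ≤ k * (k + 1) ^ M + (k + 1) ^ M * (k + 1 + 1) := by gcongr
        _ = (k + 1) ^ M * (k + 1 + (k + 1)) := by ring
        _ ≤ _ := h3.trans h2
  rw [Finset.sum_Icc_succ_top (by omega), Finset.sum_Icc_succ_top (by omega)]
  simp only [Nat.add_sub_cancel]
  -- The estimate `h2` below says (1 + 1/(M+1))^M ≥ 2, which is false for M = 2 and M = 3; these two
  -- cases are computed.
  rcases (by omega : M = 2 ∨ M = 3 ∨ 4 ≤ M) with rfl | rfl | hM
  · decide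
  · decide
  · have h1 := tele M le_rfl
    have h2 : 2 * (M + 1) ^ (M + 1) ≤ (M + 1) * (M + 2) ^ M := by
      -- The binomial expansion of (1 + 1/(M+1))^r truncated after the quadratic term, multiplied by
      -- 2(M+1)^(r+2). The linear term alone would not reach 2.
      have second : ∀ r : ℕ, (M + 1) ^ r * (2 * (M + 1) ^ 2 + 2 * r * (M + 1) + r * (r - 1))
          ≤ 2 * (M + 1) ^ 2 * (M + 2) ^ r := by
        intro r
        induction r with
        | zero => simp
        | succ r ih =>
          have : (M + 1) ^ (r + 1) * (2 * (M + 1) ^ 2 + 2 * (r + 1) * (M + 1) + (r + 1) * (r + 1 - 1))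
            ≤ (M + 1) ^ r * (2 * (M + 1) ^ 2 + 2 * r * (M + 1) + r * (r - 1)) * (M + 2) := by
            rw [pow_succ, mul_assoc, mul_assoc ((M + 1) ^ r)]
            refine Nat.mul_le_mul_left _ ?_
            cases r with
            | zero => simp; nlinarith
            | succ r =>
              simp only [Nat.add_sub_cancel]
              nlinarith [Nat.zero_le (r * r), Nat.zero_le (r * M)]
          calc _ ≤ _ := this
            _ ≤ 2 * (M + 1) ^ 2 * (M + 2) ^ r * (M + 2) := Nat.mul_le_mul_right _ ih
            _ = _ := by ring
      have h3 := second M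
      have h4 : (M + 1) ^ M * (4 * (M + 1) ^ 2) ≤
          (M + 1) ^ M * (2 * (M + 1) ^ 2 + 2 * M * (M + 1) + M * (M - 1)) := by
        refine Nat.mul_le_mul_left _ ?_
        obtain ⟨r, rfl⟩ : ∃ r, M = r + 4 := ⟨M - 4, by omega⟩
        simp only [show r + 4 - 1 = r + 3 by omega]
        nlinarith
      have h5 : (M + 1) * (2 * (M + 1)) * (2 * (M + 1) ^ M) ≤
          (M + 1) * (2 * (M + 1)) * (M + 2) ^ M := by
        calc _ = (M + 1) ^ M * (4 * (M + 1) ^ 2) := by ring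
          _ ≤ _ := h4.trans h3
          _ = _ := by ring
      have h6 := Nat.le_of_mul_le_mul_left h5 (by positivity)
      calc 2 * (M + 1) ^ (M + 1) = (M + 1) * (2 * (M + 1) ^ M) := by ring
        _ ≤ _ := Nat.mul_le_mul_left _ h6
    have e1 : M * (M + 1) ^ M + (M + 1) ^ M * (M + 1 + 1) = 2 * (M + 1) ^ (M + 1) := by ring
    have e2 : (M + 1) * (M + 2) ^ M + (M + 1 + 1) ^ M * (M + 1 + 1 + 1) =
      2 * (M + 1 + 1) ^ (M + 1) := by ring
    omega

open Finset in
/-- Monotone maps into the points below `p` fixing the value `p` at the top, when two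
further points `x < y` are comparable. -/
theorem two_mul_card_monotone_le {P : Type v} [Fintype P] [PartialOrder P] [DecidableEq P]
    [DecidableLE P] {t x y : P} (ht : ∀ p, p ≤ t) (hx : x ≠ t) (hy : y ≠ t) (hxy : x < y) (p : P)
    (S : Finset (P → P)) (hS : ∀ f ∈ S, Monotone f ∧ f t = p) :
    2 * #S ≤ #{q | q ≤ p} ^ (Fintype.card P - 2) * (#{q | q ≤ p} + 1) := by
  set U : Finset P := {q | q ≤ p} with hU
  have mem : ∀ f ∈ S, ∀ q, f q ∈ U := fun f hf q => by
    simp [hU, ← (hS f hf).2, (hS f hf).1 (ht q)]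
  set R : Finset P := ((univ.erase t).erase x).erase y
  have hR : #R = Fintype.card P - 3 := by
    have h1 : y ∈ (univ.erase t).erase x := by simp [hy, hxy.ne']
    have h2 : x ∈ univ.erase t := by simp [hx]
    rw [card_erase_of_mem h1, card_erase_of_mem h2, card_erase_of_mem (mem_univ t), card_univ]
    omega
  have h3 : 3 ≤ Fintype.card P := by
    have : #({t, x, y} : Finset P) = 3 := by
      rw [card_eq_three]; exact ⟨t, x, y, hx.symm, hy.symm, hxy.ne, rfl⟩
    rw [← this]; exact card_le_univ _
  -- All values lie below `p = f t`. A map is determined by its values at `x` and `y`, which form a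
  -- comparable pair, and by its unrestricted values on the remaining points `R`.
  have hcard : #S ≤ #({z ∈ U ×ˢ U | z.1 ≤ z.2} ×ˢ Fintype.piFinset (fun _ : R => U)) := by
    refine card_le_card_of_injOn (fun f => ((f x, f y), fun r => f r)) ?_ ?_
    · intro f hf
      simp only [coe_product, Set.mem_prod, mem_coe, mem_filter, mem_product, Fintype.mem_piFinset]
      exact ⟨⟨⟨mem f hf x, mem f hf y⟩, (hS f hf).1 hxy.le⟩, fun r => mem f hf r⟩
    · intro f hf g hg h
      simp only [Prod.mk.injEq] at h
      funext q
      by_cases h1 : q = t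
      · rw [h1, (hS f hf).2, (hS g hg).2]
      by_cases h2 : q = x
      · rw [h2, h.1.1]
      by_cases h3 : q = y
      · rw [h3, h.1.2]
      have hq : q ∈ R := by simp [R, h1, h2, h3]
      exact congrFun h.2 ⟨q, hq⟩
  rw [card_product, Fintype.card_piFinset] at hcard
  simp only [prod_const, card_univ, Fintype.card_coe, hR] at hcard
  have hp := two_mul_card_le_pairs U
  obtain ⟨k, hk⟩ : ∃ k, Fintype.card P = k + 3 := ⟨_, (Nat.sub_add_cancel h3).symm⟩
  simp only [hk, show k + 3 - 3 = k by omega, show k + 3 - 2 = k + 1 by omega] at hcard ⊢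
  calc 2 * #S ≤ 2 * (#{z ∈ U ×ˢ U | z.1 ≤ z.2} * #U ^ k) := Nat.mul_le_mul_left _ hcard
    _ = 2 * #{z ∈ U ×ˢ U | z.1 ≤ z.2} * #U ^ k := by ring
    _ ≤ #U * (#U + 1) * #U ^ k := Nat.mul_le_mul_right _ hp
    _ = _ := by ring

open Finset in
-- Sort the maps by their value at the top. Each fibre is bounded through the size of a lower set,
-- the sum of these bounds is largest for a chain, and `sum_pow_mul_lt` finishes.
theorem card_monotone_lt {P : Type v} [Fintype P] [PartialOrder P] [DecidableEq P]
    {t x y : P} (ht : ∀ p, p ≤ t) (hx : x ≠ t) (hy : y ≠ t) (hxy : x < y)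
    (h4 : 4 ≤ Fintype.card P) (S : Finset (P → P)) (hS : ∀ f ∈ S, Monotone f) :
    #S < Fintype.card P ^ (Fintype.card P - 1) + Fintype.card P - 1 := by
  classical
  set n := Fintype.card P with hn
  have e : #S = ∑ p : P, #{f ∈ S | f t = p} :=
    card_eq_sum_card_fiberwise (fun _ _ => by simp)
  have h1 : 2 * #S ≤ ∑ p : P, (#{q | q ≤ p}) ^ (n - 2) * (#{q | q ≤ p} + 1) := by
    rw [e, mul_sum]
    refine sum_le_sum fun p _ => two_mul_card_monotone_le ht hx hy hxy p _ ?_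
    intro f hf
    rw [mem_filter] at hf
    exact ⟨hS f hf.1, hf.2⟩
  have h2 := sum_card_lower_le (P := P) (fun j => j ^ (n - 2) * (j + 1))
    (fun a b h => by simp only; gcongr) univ
  have h3 := sum_pow_mul_lt (n - 1) (by omega)
  have e1 : n - 1 + 1 = n := by omega
  have e2 : n - 1 - 1 = n - 2 := by omega
  rw [e1, e2] at h3
  rw [card_univ, ← hn] at h2
  have := (h1.trans h2).trans_lt h3
  omega

open Finset in
theorem card_filter_apply_eq {P : Type v} [Fintype P] [DecidableEq P] (t : P) :
    #{f : P → P | f t = t} = Fintype.card P ^ (Fintype.card P - 1) := by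
  have : ({f : P → P | f t = t} : Finset _) =
      Fintype.piFinset (fun q => if q = t then {t} else univ) := by
    ext f
    simp only [mem_filter, mem_univ, true_and, Fintype.mem_piFinset]
    refine ⟨fun h q => ?_, fun h => by simpa using h t⟩
    by_cases hq : q = t
    · simp [hq, h]
    · simp [hq]
  rw [this, Fintype.card_piFinset, ← mul_prod_erase _ _ (mem_univ t),
    prod_congr rfl (g := fun _ => Fintype.card P) (fun q hq => by simp [ne_of_mem_erase hq])]
  simp [card_erase_of_mem, card_univ]

/-- The maps that fix `t`, together with the constant maps. -/
def fixOrConst {P : Type v} (t : P) : Set (P → P) :=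
  {f | f t = t ∨ ∃ p, p ≠ t ∧ f = fun _ => p}

open Finset in
theorem ncard_fixOrConst {P : Type v} [Fintype P] (t : P) :
    (fixOrConst t).ncard = Fintype.card P ^ (Fintype.card P - 1) + Fintype.card P - 1 := by
  classical
  have hd : Disjoint ({f : P → P | f t = t} : Finset _)
      ((univ.erase t).image (fun p => (fun _ : P => p))) := by
    rw [disjoint_left]
    intro f hf hf'
    obtain ⟨p, hp, rfl⟩ := mem_image.1 hf'
    exact (mem_erase.1 hp).1 (mem_filter.1 hf).2
  have e : fixOrConst t = (({f : P → P | f t = t} : Finset _) ∪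
      ((univ.erase t).image (fun p => (fun _ : P => p))) : Finset (P → P)) := by
    ext f
    simp [fixOrConst, eq_comm]
  have h1 : 1 ≤ Fintype.card P := Fintype.card_pos_iff.2 ⟨t⟩
  rw [e, Set.ncard_coe_finset, card_union_of_disjoint hd, card_filter_apply_eq,
    card_image_of_injective _ (fun p q h => congrFun h t), card_erase_of_mem (mem_univ t), card_univ]
  omega

/-- Monotonicity gives `f q ≤ f t`. If `f t ≠ t`, both values lie in the antichain below `t`, so
they coincide and `f` is constant. -/
theorem monotone_subset_fixOrConst {P : Type v} [PartialOrder P] {t : P}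
    (ht : ∀ p, p ≤ t) (hanti : ∀ x y : P, x ≠ t → y ≠ t → ¬ x < y) {f : P → P}
    (hf : Monotone f) : f ∈ fixOrConst t := by
  by_cases h : f t = t
  · exact Or.inl h
  · refine Or.inr ⟨f t, h, funext fun q => ?_⟩
    have hq := hf (ht q)
    by_contra hne
    refine hanti (f q) (f t) (fun e => ?_) h (lt_of_le_of_ne hq hne)
    exact h (le_antisymm (ht _) (e ▸ hq))

/-- A set of monotone self-maps of a poset with `n ≥ 4` elements and a greatest element has at
most `n ^ (n - 1) + n - 1` elements, with equality only for `fixOrConst`. -/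
theorem ncard_monotone_le {P : Type v} [Fintype P] [PartialOrder P] {t : P}
    (ht : ∀ p, p ≤ t) (h4 : 4 ≤ Fintype.card P) (S : Set (P → P)) (hS : ∀ f ∈ S, Monotone f) :
    S.ncard ≤ Fintype.card P ^ (Fintype.card P - 1) + Fintype.card P - 1 ∧
    (S.ncard = Fintype.card P ^ (Fintype.card P - 1) + Fintype.card P - 1 →
      S = fixOrConst t) := by
  classical
  by_cases hanti : ∀ x y : P, x ≠ t → y ≠ t → ¬ x < y
  · have hsub : S ⊆ fixOrConst t := fun f hf => monotone_subset_fixOrConst ht hanti (hS f hf)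
    rw [← ncard_fixOrConst t]
    exact ⟨Set.ncard_le_ncard hsub (Set.toFinite _),
      fun h => Set.eq_of_subset_of_ncard_le hsub h.ge (Set.toFinite _)⟩
  · push Not at hanti
    obtain ⟨x, y, hx, hy, hxy⟩ := hanti
    have := card_monotone_lt ht hx hy hxy h4 (Set.toFinite S).toFinset (by simpa using hS)
    rw [← Set.ncard_eq_toFinset_card S] at this
    exact ⟨this.le, fun h => absurd h this.ne⟩


/-! ### Upper bounds: reversal and number of atoms -/

/-- The empty set of quotients, and the sets of quotients containing the language itself. -/
def topSets {α : Type u} (K : Language α) : Set (Set (Language α)) :=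
  insert ∅ {T | K ∈ T ∧ T ⊆ quotients K}

theorem encard_powerset_quotients {α : Type u} {K : Language α} {n : ℕ} (h : InClass K n) :
    (𝒫 (quotients K \ {K})).encard = ((2 ^ (n - 1) : ℕ) : ℕ∞) := by
  have hfin : (quotients K \ {K}).Finite := h.finite.sdiff
  have h1 : (quotients K \ {K}).ncard = n - 1 := by
    rw [Set.ncard_sdiff_singleton_of_mem (self_mem_quotients K), Set.ncard,
      show (quotients K).encard = n from h.2, ENat.toNat_natCast]
  rw [hfin.powerset.encard_eq_coe]
  have := Set.ncard_powerset _ hfin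
  rw [h1] at this
  rw [← this]; rfl

theorem encard_topSets_le {α : Type u} {K : Language α} {n : ℕ} (h : InClass K n) :
    (topSets K).encard ≤ ((2 ^ (n - 1) + 1 : ℕ) : ℕ∞) := by
  have hsub : {T | K ∈ T ∧ T ⊆ quotients K} ⊆ (insert K) '' 𝒫 (quotients K \ {K}) := by
    rintro T ⟨hK, hT⟩
    refine ⟨T \ {K}, fun P hP => ⟨hT hP.1, hP.2⟩, ?_⟩
    simp [Set.insert_eq_of_mem hK]
  calc (topSets K).encard ≤ _ := Set.encard_insert_le _ _
    _ ≤ (𝒫 (quotients K \ {K})).encard + 1 :=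
      add_le_add_left ((Set.encard_le_encard hsub).trans (Set.encard_image_le _ _)) 1
    _ = _ := by rw [encard_powerset_quotients h]; norm_cast

/-- The quotients of `K` that contain the word `w`. -/
def containing {α : Type u} (K : Language α) (w : List α) : Set (Language α) :=
  {P | P ∈ quotients K ∧ w ∈ P}

/-- A word in any quotient is already in `K`, so a nonempty set of this kind has `K` as a member. -/
theorem containing_mem_topSets {α : Type u} {K : Language α} (h : IsSuffixClosed K) (w : List α) :
    containing K w ∈ topSets K := by
  by_cases hw : w ∈ K
  · exact Or.inr ⟨⟨self_mem_quotients K, hw⟩, fun P hP => hP.1⟩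
  · refine Or.inl (Set.eq_empty_of_forall_notMem ?_)
    rintro P ⟨hP, hwP⟩
    exact hw (h.quotient_subset hP hwP)

/-- The word `x` is in the quotient of the reverse by `w` iff `w.reverse` is in the quotient of `K`
by `x.reverse`. Hence this quotient depends only on `containing K w.reverse`. -/
theorem kappa_reverse_le {α : Type u} {K : Language α} {n : ℕ} (h : InClass K n) :
    kappa K.reverse ≤ ((2 ^ (n - 1) + 1 : ℕ) : ℕ∞) := by
  refine (kappa_le_encard (topSets K) (fun T => {x | K.leftQuotient x.reverse ∈ T}) ?_).trans
    (encard_topSets_le h)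
  intro w _
  refine ⟨containing K w.reverse, containing_mem_topSets h.1 _, ?_⟩
  ext x
  change (w ++ x).reverse ∈ K ↔
    K.leftQuotient x.reverse ∈ quotients K ∧ x.reverse ++ w.reverse ∈ K
  rw [List.reverse_append]
  refine ⟨fun hx => ⟨?_, hx⟩, fun hx => hx.2⟩
  exact leftQuotient_mem_quotients (isWord_append.1 (isWord_of_mem hx)).1

/-- Testing all left contexts `u` amounts to testing membership in all quotients. This links atoms
as congruence classes with atoms as intersections. -/
theorem atom_eq_atomOf {α : Type u} (K : Language α) (x : List α) :
    ({y | IsWord K y ∧ ∀ u, IsWord K u → (u ++ x ∈ K ↔ u ++ y ∈ K)} : Set (List α)) =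
      atomOf K (containing K x) := by
  ext y
  refine and_congr_right fun _ => ⟨?_, ?_⟩
  · rintro h _ ⟨u, hu, rfl⟩
    exact ⟨fun hy => ⟨leftQuotient_mem_quotients hu, (h u hu).2 hy⟩, fun hx => (h u hu).1 hx.2⟩
  · intro h u hu
    have := h _ (leftQuotient_mem_quotients hu)
    exact ⟨fun hx => this.2 ⟨leftQuotient_mem_quotients hu, hx⟩, fun hy => (this.1 hy).2⟩

theorem encard_atoms_le {α : Type u} {K : Language α} {n : ℕ} (h : InClass K n) :
    (atoms K).encard ≤ ((2 ^ (n - 1) + 1 : ℕ) : ℕ∞) := by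
  refine le_trans ?_ (encard_topSets_le h)
  refine (Set.encard_le_encard ?_).trans (Set.encard_image_le (atomOf K) (topSets K))
  rintro _ ⟨x, _, rfl⟩
  exact ⟨_, containing_mem_topSets h.1 x, (atom_eq_atomOf K x).symm⟩

/-! ### Upper bounds: star and product -/

theorem cons_mem_mul {α : Type u} {P R : Language α} {x : α} {z : List α} :
    x :: z ∈ P * R ↔ z ∈ P.leftQuotient [x] * R ∨ ([] ∈ P ∧ x :: z ∈ R) := by
  simp only [Language.mem_mul, Language.mem_leftQuotient]
  constructor
  · rintro ⟨a, ha, b, hb, e⟩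
    cases a with
    | nil => right; simp only [List.nil_append] at e; exact ⟨ha, e ▸ hb⟩
    | cons y a =>
      simp only [List.cons_append, List.cons.injEq] at e
      obtain ⟨rfl, rfl⟩ := e
      exact Or.inl ⟨a, ha, b, hb, rfl⟩
  · rintro (⟨a, ha, b, hb, rfl⟩ | ⟨h0, h⟩)
    · exact ⟨x :: a, ha, b, hb, rfl⟩
    · exact ⟨[], h0, _, h, rfl⟩

theorem cons_mem_kstar {α : Type u} {K : Language α} {x : α} {z : List α} :
    x :: z ∈ K∗ ↔ z ∈ K.leftQuotient [x] * K∗ := by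
  constructor
  · intro h
    obtain ⟨S, hS, hne⟩ := Language.mem_kstar_iff_exists_nonempty.1 h
    cases S with
    | nil => simp at hS
    | cons y S =>
      obtain ⟨hy, hy0⟩ := hne y (by simp)
      cases y with
      | nil => exact absurd rfl hy0
      | cons x' y =>
        simp only [List.flatten_cons, List.cons_append, List.cons.injEq] at hS
        obtain ⟨rfl, rfl⟩ := hS
        exact Language.append_mem_mul hy (Language.join_mem_kstar fun v hv => (hne v (by simp [hv])).1)
  · intro h
    have : x :: z ∈ K * K∗ := cons_mem_mul.2 (Or.inl h)
    rw [← Language.one_add_self_mul_kstar_eq_kstar]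
    exact Or.inr this

theorem alph_kstar {α : Type u} (K : Language α) : alph K∗ = alph K := by
  ext x
  constructor
  · rintro ⟨w, ⟨S, rfl, hS⟩, hx⟩
    obtain ⟨y, hy, hxy⟩ := List.mem_flatten.1 hx
    exact ⟨y, hS y hy, hxy⟩
  · rintro ⟨w, hw, hx⟩
    exact ⟨w, ⟨[w], by simp, by simpa using hw⟩, hx⟩

theorem mul_mem_mono {α : Type u} {P P' R : Language α} (h : ∀ z, z ∈ P → z ∈ P') {z : List α}
    (hz : z ∈ P * R) : z ∈ P' * R := by
  obtain ⟨a, ha, b, hb, rfl⟩ := hz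
  exact Language.append_mem_mul (h a ha) hb

/-- When the current quotient `Q` contains the empty word, the next letter either continues the
current factor or starts a new one. Since `Q` is contained in `K`, the second choice includes the
first, so `Q` can be replaced by `K`. -/
theorem exists_leftQuotient_kstar {α : Type u} {K : Language α} (h : IsSuffixClosed K)
    (h0 : [] ∈ K) (w : List α) (hw : IsWord K w) :
    ∃ Q ∈ quotients K, K∗.leftQuotient w = Q * K∗ := by
  induction w using List.reverseRecOn with
  | nil =>
    refine ⟨K, self_mem_quotients K, ?_⟩
    ext z
    constructor
    · intro hz
      exact ⟨[], h0, z, hz, rfl⟩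
    · intro hz
      rw [Language.leftQuotient_nil, ← Language.one_add_self_mul_kstar_eq_kstar]
      exact Or.inr hz
  | append_singleton w x ih =>
    obtain ⟨Q, hQ, e⟩ := ih (isWord_append.1 hw).1
    have hx := (isWord_append.1 hw).2
    rw [Language.leftQuotient_append, e]
    by_cases hQ0 : [] ∈ Q
    · refine ⟨K.leftQuotient [x], leftQuotient_mem_quotients hx, ?_⟩
      ext z
      refine Iff.trans (cons_mem_mul (P := Q)) ?_
      rw [cons_mem_kstar]
      refine ⟨?_, fun hz => Or.inr ⟨hQ0, hz⟩⟩
      rintro (hz | hz)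
      · exact mul_mem_mono (P := Q.leftQuotient [x]) (P' := K.leftQuotient [x])
          (fun y hy => h.quotient_subset hQ hy) hz
      · exact hz.2
    · refine ⟨Q.leftQuotient [x], leftQuotient_mem_of_mem hQ hx, ?_⟩
      ext z
      refine Iff.trans (cons_mem_mul (P := Q)) ?_
      simp [hQ0]

theorem kappa_kstar_le {α : Type u} {K : Language α} (h : IsSuffixClosed K) (h0 : [] ∈ K) :
    kappa K∗ ≤ kappa K := by
  refine kappa_le_encard (quotients K) (fun Q => Q * K∗) fun w hw => ?_
  exact exists_leftQuotient_kstar h h0 w (hw.mono (alph_kstar K).subset)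

theorem alph_mul {α : Type u} {K' K : Language α} (h' : [] ∈ K') (h : [] ∈ K) :
    alph (K' * K) = alph K' ∪ alph K := by
  ext x
  constructor
  · rintro ⟨_, ⟨a, ha, b, hb, rfl⟩, hx⟩
    rcases List.mem_append.1 hx with hx | hx
    exacts [Or.inl ⟨a, ha, hx⟩, Or.inr ⟨b, hb, hx⟩]
  · rintro (⟨w, hw, hx⟩ | ⟨w, hw, hx⟩)
    · exact ⟨w, ⟨w, hw, [], h, by simp⟩, hx⟩
    · exact ⟨w, ⟨[], h', w, hw, by simp⟩, hx⟩

/-- `R` accounts for factorisations whose first factor has already ended. As soon as the first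
factor may end at `w`, the product term contains all of `K`; since `R` is contained in `K`, it may
be reset to `K` without changing the union. -/
theorem exists_leftQuotient_mul {α : Type u} {K' K : Language α} (h : IsSuffixClosed K)
    (h' : [] ∈ K') (w : List α) :
    ∃ R ∈ insert (0 : Language α) (quotients K), (IsWord K w → R ∈ quotients K) ∧
      ([] ∈ K'.leftQuotient w → R = K) ∧
      (K' * K).leftQuotient w = K'.leftQuotient w * K + R := by
  induction w using List.reverseRecOn with
  | nil =>
    refine ⟨K, Or.inr (self_mem_quotients K), fun _ => self_mem_quotients K, fun _ => rfl, ?_⟩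
    ext z
    refine ⟨fun hz => Or.inl hz, ?_⟩
    rintro (hz | hz)
    · exact hz
    · exact ⟨[], h', z, hz, rfl⟩
  | append_singleton w x ih =>
    obtain ⟨R, hR, hR', hR0, e⟩ := ih
    have hsub : ∀ z, z ∈ R.leftQuotient [x] → z ∈ K := by
      intro z hz
      rcases hR with rfl | hR
      · exact absurd hz (Language.notMem_zero _)
      · exact h _ _ (h.quotient_subset hR hz) (List.suffix_append _ _)
    have main : (K' * K).leftQuotient (w ++ [x]) =
        K'.leftQuotient (w ++ [x]) * K + R.leftQuotient [x] := by
      rw [Language.leftQuotient_append, Language.leftQuotient_append, e]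
      ext z
      change (x :: z ∈ K'.leftQuotient w * K ∨ x :: z ∈ R) ↔ _
      rw [cons_mem_mul, Language.mem_add]
      constructor
      · rintro ((hz | hz) | hz)
        · exact Or.inl hz
        · rw [hR0 hz.1]; exact Or.inr hz.2
        · exact Or.inr hz
      · rintro (hz | hz)
        · exact Or.inl (Or.inl hz)
        · exact Or.inr hz
    by_cases h0 : [] ∈ K'.leftQuotient (w ++ [x])
    · refine ⟨K, Or.inr (self_mem_quotients K), fun _ => self_mem_quotients K, fun _ => rfl, ?_⟩
      rw [main]
      ext z
      rw [Language.mem_add, Language.mem_add]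
      refine or_congr_right' fun hz => ⟨hsub z, fun hz' => absurd ⟨[], h0, z, hz', rfl⟩ hz⟩
    · refine ⟨R.leftQuotient [x], ?_, ?_, fun h1 => absurd h1 h0, main⟩
      · rcases hR with rfl | hR
        · left; ext z; exact Iff.rfl
        · obtain ⟨v, _, rfl⟩ := hR
          rw [← Language.leftQuotient_append]
          exact leftQuotient_mem_or K _
      · intro hw
        exact leftQuotient_mem_of_mem (hR' (isWord_append.1 hw).1) (isWord_append.1 hw).2

/-- Because `K'` contains the empty word, the first component `K'` occurs only in the pair `(K',
K)`. The other pairs number at most `a * b`. -/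
theorem encard_pairs_le {α : Type u} {K' K : Language α} (h' : [] ∈ K')
    {A B : Set (Language α)} {a b : ℕ} (hA : A.encard ≤ ((a + 1 : ℕ) : ℕ∞)) (hB : B.encard ≤ b)
    (hK' : K' ∈ A) :
    {p : Language α × Language α | p.1 ∈ A ∧ p.2 ∈ B ∧ ([] ∈ p.1 → p.2 = K)}.encard ≤
      ((a * b + 1 : ℕ) : ℕ∞) := by
  have hsub : {p : Language α × Language α | p.1 ∈ A ∧ p.2 ∈ B ∧ ([] ∈ p.1 → p.2 = K)} ⊆
      insert (K', K) ((A \ {K'}) ×ˢ B) := by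
    rintro ⟨P, R⟩ ⟨hP, hR, h⟩
    by_cases hPK : P = K'
    · subst hPK
      exact Or.inl (by rw [show R = K from h h'])
    · exact Or.inr ⟨⟨hP, hPK⟩, hR⟩
  have h1 : (A \ {K'}).encard ≤ a := by
    rw [Set.encard_sdiff_singleton_of_mem hK']
    refine (tsub_le_tsub_right hA 1).trans ?_
    norm_cast
  calc _ ≤ _ := Set.encard_le_encard hsub
    _ ≤ _ := Set.encard_insert_le _ _
    _ ≤ (a : ℕ∞) * b + 1 := by rw [Set.encard_prod]; gcongr
    _ = _ := by norm_cast

theorem kappa_mul_le_of_alph_eq {α : Type u} {K' K : Language α} {m n : ℕ} (hm : 4 ≤ m)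
    (hn : 4 ≤ n) (hK' : InClass K' m) (hK : InClass K n) (hal : alph K' = alph K) :
    kappa (K' * K) ≤ ((m * n - n + 1 : ℕ) : ℕ∞) := by
  obtain ⟨k, rfl⟩ : ∃ k, m = k + 1 := ⟨m - 1, by omega⟩
  have h0 := hK'.nil_mem hm
  rw [show (k + 1) * n - n + 1 = k * n + 1 by rw [add_mul]; omega]
  refine (kappa_le_encard _ (fun p => p.1 * K + p.2) ?_).trans
    (encard_pairs_le (K := K) (A := quotients K') (B := quotients K) h0 hK'.2.le hK.2.le
      (self_mem_quotients _))
  intro w hw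
  rw [IsWord, alph_mul h0 (hK.nil_mem hn), hal, Set.union_self] at hw
  obtain ⟨R, _, hR, hR0, e⟩ := exists_leftQuotient_mul hK.1 h0 w
  refine ⟨(K'.leftQuotient w, R), ⟨leftQuotient_mem_quotients ?_, hR hw, hR0⟩, e⟩
  rw [IsWord, hal]; exact hw

theorem encard_insert_zero_quotients_le {α : Type u} {K : Language α} {n : ℕ} (hK : InClass K n) :
    (insert (0 : Language α) (quotients K)).encard ≤ ((n + 1 : ℕ) : ℕ∞) := by
  refine (Set.encard_insert_le _ _).trans ?_
  rw [show (quotients K).encard = n from hK.2]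
  norm_cast

theorem kappa_mul_le {α : Type u} {K' K : Language α} {m n : ℕ} (hm : 4 ≤ m)
    (hK' : InClass K' m) (hK : InClass K n) :
    kappa (K' * K) ≤ ((m * n + m + 1 : ℕ) : ℕ∞) := by
  have h0 := hK'.nil_mem hm
  rw [show m * n + m + 1 = m * (n + 1) + 1 by ring]
  refine (kappa_le_encard _ (fun p => p.1 * K + p.2) ?_).trans
    (encard_pairs_le (K := K) (A := insert 0 (quotients K')) (B := insert 0 (quotients K)) h0
      (encard_insert_zero_quotients_le hK') (encard_insert_zero_quotients_le hK)
      (Or.inr (self_mem_quotients _)))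
  intro w _
  obtain ⟨R, hR, _, hR0, e⟩ := exists_leftQuotient_mul hK.1 h0 w
  exact ⟨(K'.leftQuotient w, R), ⟨leftQuotient_mem_or _ _, hR, hR0⟩, e⟩

/-! ### Upper bounds: boolean operations -/

theorem kappa_bool_le {α : Type u} {J K' K : Language α} (op : Prop → Prop → Prop)
    (hJ : ∀ z, z ∈ J ↔ op (z ∈ K') (z ∈ K)) {A B : Set (Language α)} {a b : ℕ}
    (hA : A.encard ≤ a) (hB : B.encard ≤ b)
    (hA' : ∀ w, IsWord J w → K'.leftQuotient w ∈ A) (hB' : ∀ w, IsWord J w → K.leftQuotient w ∈ B) :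
    kappa J ≤ ((a * b : ℕ) : ℕ∞) := by
  refine (kappa_le_encard (A ×ˢ B) (fun p => {z | op (z ∈ p.1) (z ∈ p.2)}) ?_).trans ?_
  · intro w hw
    refine ⟨(K'.leftQuotient w, K.leftQuotient w), ⟨hA' w hw, hB' w hw⟩, ?_⟩
    ext z
    exact hJ _
  · rw [Set.encard_prod, Nat.cast_mul]
    gcongr

theorem alph_bool_subset {α : Type u} {J K' K : Language α} (op : Prop → Prop → Prop)
    (hop : ¬ op False False) (hJ : ∀ z, z ∈ J ↔ op (z ∈ K') (z ∈ K)) :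
    alph J ⊆ alph K' ∪ alph K := by
  rintro x ⟨w, hw, hx⟩
  rw [hJ] at hw
  by_cases h : w ∈ K'
  · exact Or.inl ⟨w, h, hx⟩
  by_cases h' : w ∈ K
  · exact Or.inr ⟨w, h', hx⟩
  simp only [h, h'] at hw
  exact absurd hw hop

theorem kappa_bool_le_of_alph_eq {α : Type u} {J K' K : Language α} {m n : ℕ}
    (op : Prop → Prop → Prop) (hop : ¬ op False False) (hJ : ∀ z, z ∈ J ↔ op (z ∈ K') (z ∈ K))
    (hK' : InClass K' m) (hK : InClass K n) (hal : alph K' = alph K) :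
    kappa J ≤ ((m * n : ℕ) : ℕ∞) := by
  have hsub := alph_bool_subset op hop hJ
  refine kappa_bool_le op hJ hK'.2.le hK.2.le
    (fun w hw => leftQuotient_mem_quotients (hw.mono ?_))
    (fun w hw => leftQuotient_mem_quotients (hw.mono ?_))
  · rwa [← hal, Set.union_self] at hsub
  · rwa [hal, Set.union_self] at hsub

theorem kappa_bool_le_unrestricted {α : Type u} {J K' K : Language α} {m n : ℕ}
    (op : Prop → Prop → Prop) (hJ : ∀ z, z ∈ J ↔ op (z ∈ K') (z ∈ K))
    (hK' : InClass K' m) (hK : InClass K n) :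
    kappa J ≤ (((m + 1) * (n + 1) : ℕ) : ℕ∞) :=
  kappa_bool_le op hJ (encard_insert_zero_quotients_le hK') (encard_insert_zero_quotients_le hK)
    (fun _ _ => leftQuotient_mem_or _ _) (fun _ _ => leftQuotient_mem_or _ _)

/-- Every letter of the difference occurs in `K'`, so only the second operand can contribute the
empty quotient from foreign letters. -/
theorem kappa_sdiff_le {α : Type u} {K' K : Language α} {m n : ℕ}
    (hK' : InClass K' m) (hK : InClass K n) :
    kappa (K' \ K) ≤ ((m * n + m : ℕ) : ℕ∞) := by
  rw [show m * n + m = m * (n + 1) by ring]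
  refine kappa_bool_le (K' := K') (K := K) (fun p q => p ∧ ¬ q) (fun _ => Iff.rfl)
    hK'.2.le (encard_insert_zero_quotients_le hK)
    (fun w hw => leftQuotient_mem_quotients (hw.mono (alph_mono fun _ h => h.1)))
    (fun _ _ => leftQuotient_mem_or _ _)

theorem kappa_inf_le {α : Type u} {K' K : Language α} {m n : ℕ}
    (hK' : InClass K' m) (hK : InClass K n) :
    kappa (K' ⊓ K) ≤ ((m * n : ℕ) : ℕ∞) :=
  kappa_bool_le (K' := K') (K := K) (fun p q => p ∧ q) (fun _ => Iff.rfl)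
    hK'.2.le hK.2.le
    (fun _ hw => leftQuotient_mem_quotients (hw.mono (alph_mono fun _ h => h.1)))
    (fun _ hw => leftQuotient_mem_quotients (hw.mono (alph_mono fun _ h => h.2)))


/-! ### Complexity of atoms: counting -/

open Finset in
/-- The pairs of disjoint subsets `X`, `Y` of `A` with `|X| < s` and `1 ≤ |Y| ≤ t`. -/
def disjointPairs {β : Type v} [DecidableEq β] (A : Finset β) (s t : ℕ) :
    Finset (Finset β × Finset β) :=
  {p ∈ A.powerset ×ˢ A.powerset | Disjoint p.1 p.2 ∧ p.2.Nonempty ∧ #p.1 + 1 ≤ s ∧ #p.2 ≤ t}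

open Finset in
theorem mem_disjointPairs {β : Type v} [DecidableEq β] {A : Finset β} {s t : ℕ}
    {p : Finset β × Finset β} : p ∈ disjointPairs A s t ↔ p.1 ⊆ A ∧ p.2 ⊆ A ∧ Disjoint p.1 p.2 ∧
      p.2.Nonempty ∧ #p.1 + 1 ≤ s ∧ #p.2 ≤ t := by
  simp [disjointPairs, and_assoc]

open Finset in
-- Here y = |Y| and x = |X| + 1: choose `Y` in `A` first, then `X` in `A \ Y`. The shift in x
-- matches the sum in `atomValue`.
theorem card_disjointPairs {β : Type v} [DecidableEq β] (A : Finset β) (s t : ℕ) :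
    #(disjointPairs A s t) =
      ∑ x ∈ Icc 1 s, ∑ y ∈ Icc 1 t, (#A).choose y * (#A - y).choose (x - 1) := by
  have e : disjointPairs A s t = (Icc 1 s).biUnion fun x => (Icc 1 t).biUnion fun y =>
      (A.powersetCard y).biUnion fun Y => ((A \ Y).powersetCard (x - 1)).image (fun X => (X, Y)) := by
    ext ⟨X, Y⟩
    simp only [mem_disjointPairs, mem_biUnion, mem_Icc, mem_powersetCard, mem_image, Prod.mk.injEq]
    constructor
    · rintro ⟨hX, hY, hd, hne, hs, ht⟩
      exact ⟨#X + 1, ⟨by omega, hs⟩, #Y, ⟨card_pos.2 hne, ht⟩, Y, ⟨hY, rfl⟩, X,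
        ⟨subset_sdiff.2 ⟨hX, hd⟩, by simp⟩, rfl, rfl⟩
    · rintro ⟨x, hx, y, hy, _, ⟨hY, hYc⟩, _, ⟨hX, hXc⟩, rfl, rfl⟩
      obtain ⟨hX, hd⟩ := subset_sdiff.1 hX
      exact ⟨hX, hY, hd, card_pos.1 (by omega), by omega, by omega⟩
  rw [e, card_biUnion]
  · refine sum_congr rfl fun x hx => ?_
    rw [card_biUnion]
    · refine sum_congr rfl fun y hy => ?_
      rw [card_biUnion]
      · rw [sum_congr rfl (g := fun _ => (#A - y).choose (x - 1))]
        · simp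
        · intro Y hY
          rw [mem_powersetCard] at hY
          rw [card_image_of_injective _ (fun _ _ h => (Prod.mk.inj h).1), card_powersetCard,
            card_sdiff_of_subset hY.1, hY.2]
      · intro Y _ Y' _ hne
        rw [Function.onFun, disjoint_left]
        intro p hp hp'
        simp only [mem_image] at hp hp'
        obtain ⟨_, _, rfl⟩ := hp
        obtain ⟨_, _, h⟩ := hp'
        exact hne (Prod.mk.inj h).2.symm
    · intro y _ y' _ hne
      rw [Function.onFun, disjoint_left]
      intro p hp hp'
      simp only [mem_biUnion, mem_image, mem_powersetCard] at hp hp'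
      obtain ⟨Y, hY, _, _, rfl⟩ := hp
      obtain ⟨Y', hY', _, _, h⟩ := hp'
      obtain ⟨_, rfl⟩ := Prod.mk.inj h
      exact hne (hY.2.symm.trans hY'.2)
  · intro x hx x' hx' hne
    rw [Function.onFun, disjoint_left]
    intro p hp hp'
    simp only [mem_biUnion, mem_image, mem_powersetCard] at hp hp'
    obtain ⟨_, _, Y, hY, X, hX, rfl⟩ := hp
    obtain ⟨_, _, Y', hY', X', hX', h⟩ := hp'
    obtain ⟨rfl, _⟩ := Prod.mk.inj h
    have h1 := hX.2
    have h2 := hX'.2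
    simp only [coe_Icc, Set.mem_Icc] at hx hx'
    omega

open Finset in
theorem atomValue_eq {β : Type v} [DecidableEq β] {A : Finset β} {n : ℕ} (hA : #A = n - 1)
    (s : ℕ) : atomValue n s = #(disjointPairs A s (n - s)) + 1 := by
  rw [card_disjointPairs, atomValue, hA, add_comm]
  congr 1
  refine sum_congr rfl fun x _ => sum_congr rfl fun y _ => ?_
  rw [show n - y - 1 = n - 1 - y by omega]

/-! ### Complexity of atoms: upper bounds -/

theorem isWord_of_isWord_atomOf {α : Type u} {K : Language α} {S : Set (Language α)}
    {w : List α} (hw : IsWord (atomOf K S) w) : IsWord K w := by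
  intro x hx
  obtain ⟨v, hv, hxv⟩ := hw x hx
  exact hv.1 x hxv

theorem mem_leftQuotient_atomOf {α : Type u} {K : Language α} {S : Set (Language α)}
    {w : List α} (hw : IsWord K w) {z : List α} :
    z ∈ (atomOf K S).leftQuotient w ↔
      IsWord K z ∧ ∀ P ∈ quotients K, (z ∈ P.leftQuotient w ↔ P ∈ S) := by
  change (IsWord K (w ++ z) ∧ ∀ P ∈ quotients K, (w ++ z ∈ P ↔ P ∈ S)) ↔ _
  rw [isWord_append]
  simp only [hw, true_and]
  exact Iff.rfl

/-- The union of all quotients P, each quotiented by w, is w⁻¹`K`, by monotonicity. So the quotient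
of this atom is the complement of w⁻¹`K`. -/
theorem kappa_atomOf_empty_le {α : Type u} {K : Language α} (hK : IsSuffixClosed K) :
    kappa (atomOf K ∅) ≤ kappa K := by
  refine kappa_le_encard (quotients K) (fun P => {z | IsWord K z ∧ z ∉ P}) fun w hw => ?_
  have hw' := isWord_of_isWord_atomOf hw
  refine ⟨K.leftQuotient w, leftQuotient_mem_quotients hw', ?_⟩
  ext z
  rw [mem_leftQuotient_atomOf hw']
  refine and_congr_right fun _ => ⟨fun h hz => ?_, fun h P hP => ?_⟩
  · exact (h K (self_mem_quotients K)).1 hz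
  · simp only [Set.mem_empty_iff_false, iff_false]
    exact fun hz => h (hK.quotient_subset hP hz)

/-- A quotient of this atom is an intersection of quotients of `K`. The factor `K` can be dropped
since the others are contained in it, which leaves subsets of the other n - 1 quotients. -/
theorem kappa_atomOf_quotients_le {α : Type u} {K : Language α} {n : ℕ} (hK : InClass K n) :
    kappa (atomOf K (quotients K)) ≤ ((2 ^ (n - 1) : ℕ) : ℕ∞) := by
  rw [← encard_powerset_quotients hK]
  refine kappa_le_encard _ (fun T => {z | z ∈ K ∧ ∀ P ∈ T, z ∈ P}) fun w hw => ?_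
  have hw' := isWord_of_isWord_atomOf hw
  refine ⟨(fun P => P.leftQuotient w) '' quotients K \ {K}, ?_, ?_⟩
  · rintro _ ⟨⟨P, hP, rfl⟩, hne⟩
    exact ⟨leftQuotient_mem_of_mem hP hw', hne⟩
  · ext z
    rw [mem_leftQuotient_atomOf hw']
    constructor
    · rintro ⟨_, h⟩
      refine ⟨?_, ?_⟩
      · exact hK.1.leftQuotient_subset ((h K (self_mem_quotients K)).2 (self_mem_quotients K))
      · rintro _ ⟨⟨P, hP, rfl⟩, _⟩
        exact (h P hP).2 hP
    · rintro ⟨hz, h⟩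
      refine ⟨isWord_of_mem hz, fun P hP => ⟨fun _ => hP, fun _ => ?_⟩⟩
      by_cases hPK : P.leftQuotient w = K
      · rw [hPK]; exact hz
      · exact h _ ⟨⟨P, hP, rfl⟩, hPK⟩

theorem self_mem_of_atomOf_mem {α : Type u} {K : Language α} (hK : IsSuffixClosed K)
    {S : Set (Language α)} (hS : S ⊆ quotients K) (hne : S ≠ ∅) (ha : atomOf K S ∈ atoms K) :
    K ∈ S := by
  obtain ⟨x, hx, e⟩ := ha
  have hxa : x ∈ atomOf K S := by rw [e]; exact ⟨hx, fun u _ => Iff.rfl⟩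
  obtain ⟨P, hP⟩ := Set.nonempty_iff_ne_empty.2 hne
  have h1 := (hxa.2 P (hS hP)).2 hP
  exact (hxa.2 K (self_mem_quotients K)).1 (hK.quotient_subset (hS hP) h1)

/-- The words of `K` that are in all languages of `X` and in none of `Y`. -/
def between {α : Type u} (K : Language α) (p : Finset (Language α) × Finset (Language α)) :
    Language α := {z | z ∈ K ∧ (∀ P ∈ p.1, z ∈ P) ∧ ∀ P ∈ p.2, z ∉ P}

open Finset Classical in
-- The quotient is the intersection of the images `X₀` of `S` minus the union of the images `Y₀` of
-- the complement. All images lie below `p = w⁻¹K`, itself in `X₀`, so any other member of `X₀`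
-- makes `p` redundant. Erasing `p` lowers the size of the first set below `s`, as `disjointPairs`
-- requires.
theorem leftQuotient_atomOf_eq {α : Type u} {K : Language α} {n s : ℕ} (hK : InClass K n)
    {S : Finset (Language α)} (hS : S ⊆ hK.finite.toFinset) (hKS : K ∈ S)
    (hSn : S ≠ hK.finite.toFinset) (hs : #S = s) (h2 : 2 ≤ s) {w : List α} (hw : IsWord K w) :
    (atomOf K S).leftQuotient w ∈ insert (0 : Language α)
      (between K '' (disjointPairs (hK.finite.toFinset.erase K) s (n - s) : Set _)) := by
  set Q := hK.finite.toFinset with hQ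
  have memQ : ∀ P, P ∈ Q ↔ P ∈ quotients K := fun P => by simp [hQ]
  have hQc : #Q = n := by
    have := hK.2
    rw [kappa, hK.finite.encard_eq_coe_toFinset_card] at this
    exact_mod_cast this
  set X₀ := S.image (fun P => P.leftQuotient w)
  set Y₀ := (Q \ S).image (fun P => P.leftQuotient w)
  set p := K.leftQuotient w with hp
  have hpX : p ∈ X₀ := mem_image_of_mem _ hKS
  have sub : ∀ P ∈ Q.image (fun P => P.leftQuotient w), P ∈ Q ∧ ∀ z, z ∈ P → z ∈ p := by
    intro P hP
    obtain ⟨R, hR, rfl⟩ := mem_image.1 hP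
    rw [memQ] at hR
    exact ⟨(memQ _).2 (leftQuotient_mem_of_mem hR hw), fun z hz => hK.1.quotient_subset hR hz⟩
  have subX : ∀ P ∈ X₀, P ∈ Q ∧ ∀ z, z ∈ P → z ∈ p := fun P hP =>
    sub P (image_subset_image hS hP)
  have subY : ∀ P ∈ Y₀, P ∈ Q ∧ ∀ z, z ∈ P → z ∈ p := fun P hP =>
    sub P (image_subset_image sdiff_subset hP)
  have pK : ∀ z, z ∈ p → z ∈ K := fun z hz => hK.1.leftQuotient_subset hz
  have mem : ∀ z, z ∈ (atomOf K S).leftQuotient w ↔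
      (∀ P ∈ X₀, z ∈ P) ∧ ∀ P ∈ Y₀, z ∉ P := by
    intro z
    rw [mem_leftQuotient_atomOf hw]
    constructor
    · rintro ⟨_, h⟩
      refine ⟨fun P hP => ?_, fun P hP => ?_⟩
      · obtain ⟨R, hR, rfl⟩ := mem_image.1 hP
        exact (h R ((memQ R).1 (hS hR))).2 hR
      · obtain ⟨R, hR, rfl⟩ := mem_image.1 hP
        obtain ⟨hR, hR'⟩ := mem_sdiff.1 hR
        exact fun hz => hR' ((h R ((memQ R).1 hR)).1 hz)
    · rintro ⟨h1, h2⟩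
      refine ⟨isWord_of_mem (pK z (h1 p hpX)), fun P hP => ⟨fun hz => ?_, fun hP => ?_⟩⟩
      · by_contra hPS
        exact h2 _ (mem_image_of_mem _ (mem_sdiff.2 ⟨(memQ P).2 hP, hPS⟩)) hz
      · exact h1 _ (mem_image_of_mem _ hP)
  by_cases hd : Disjoint X₀ Y₀
  swap
  · left
    obtain ⟨P, hPX, hPY⟩ := not_disjoint_iff.1 hd
    ext z
    rw [mem]
    exact ⟨fun h => absurd (h.1 P hPX) (h.2 P hPY), fun h => absurd h (Language.notMem_zero z)⟩
  right
  -- If `K` were in `Y₀`, it would lie below `p`, forcing `p = K` and contradicting disjointness.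
  have hKY : K ∉ Y₀ := by
    intro h
    have : p = K := by
      ext z
      exact ⟨pK z, (subY K h).2 z⟩
    exact disjoint_left.1 hd hpX (this ▸ h)
  have hXs : #X₀ ≤ s := hs ▸ card_image_le
  have hYs : #Y₀ ≤ n - s := by
    refine card_image_le.trans ?_
    rw [card_sdiff_of_subset hS, hQc, hs]
  have hYne : Y₀.Nonempty := by
    refine Nonempty.image ?_ _
    rw [sdiff_nonempty]
    exact fun h => hSn (subset_antisymm hS h)
  have hYA : Y₀ ⊆ Q.erase K := fun P hP =>
    mem_erase.2 ⟨fun h => hKY (h ▸ hP), (subY P hP).1⟩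
  have hpX1 : 1 ≤ #X₀ := card_pos.2 ⟨p, hpX⟩
  -- The exception: with `X₀ = {p}` and `p ≠ K`, erasing `p` would lose information, so `{p}` is
  -- kept. Its size 1 is admissible because `2 ≤ s`.
  by_cases hc : p ≠ K ∧ X₀ = {p}
  · refine ⟨({p}, Y₀), ?_, ?_⟩
    · rw [mem_coe, mem_disjointPairs]
      refine ⟨?_, hYA, hc.2 ▸ hd, hYne, by simpa using h2, hYs⟩
      simp [hc.1, (subX p hpX).1]
    · ext z
      rw [mem]
      constructor
      · rintro ⟨h0, h1, h2⟩
        exact ⟨hc.2 ▸ h1, h2⟩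
      · rintro ⟨h1, h2⟩
        exact ⟨pK z (h1 p hpX), hc.2 ▸ h1, h2⟩
  · refine ⟨(X₀.erase p, Y₀), ?_, ?_⟩
    · rw [mem_coe, mem_disjointPairs]
      refine ⟨?_, hYA, hd.mono_left (erase_subset _ _), hYne, ?_, hYs⟩
      · intro P hP
        obtain ⟨hPp, hP⟩ := mem_erase.1 hP
        refine mem_erase.2 ⟨?_, (subX P hP).1⟩
        intro hPK
        exact hPp (Language.ext fun z => ⟨(subX P hP).2 z, fun hz => hPK ▸ pK z hz⟩)
      · simp only [card_erase_of_mem hpX]; omega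
    · ext z
      rw [mem]
      constructor
      · rintro ⟨h0, h1, h2⟩
        refine ⟨fun P hP => ?_, h2⟩
        by_cases hPp : P = p
        · by_cases hPK : P = K
          · rw [hPK]; exact h0
          · have : X₀ ≠ {p} := fun h => hc ⟨hPp ▸ hPK, h⟩
            obtain ⟨R, hR, hRP⟩ : ∃ R ∈ X₀, R ≠ p := by
              by_contra! hcon
              exact this (eq_singleton_iff_unique_mem.2 ⟨hpX, hcon⟩)
            rw [hPp]
            exact (subX R hR).2 z (h1 R (mem_erase.2 ⟨hRP, hR⟩))
        · exact h1 P (mem_erase.2 ⟨hPp, hP⟩)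
      · rintro ⟨h1, h2⟩
        exact ⟨pK z (h1 p hpX), fun P hP => h1 P (mem_erase.1 hP).2, h2⟩

open Finset Classical in
/-- Pairs of a language `p` and a nonempty antichain of languages below `p` inject into pairs of
subsets, the first of which is empty. -/
theorem encard_antichain_pairs_le {β : Type v} [PartialOrder β] {Q : Finset β} {t : β}
    (htQ : t ∈ Q) (ht : ∀ p ∈ Q, p ≤ t) :
    {q : β × Finset β | q.1 ∈ Q ∧ q.2 ⊆ Q ∧ q.2.Nonempty ∧ (∀ P ∈ q.2, P < q.1) ∧
      ∀ P ∈ q.2, ∀ R ∈ q.2, ¬ P < R}.encard ≤ (#(disjointPairs (Q.erase t) 1 (#Q - 1)) : ℕ∞) := by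
  rw [← Set.encard_coe_eq_coe_finsetCard]
  refine Set.encard_le_encard_of_injOn
    -- In `insert p Y` the element `p` is the greatest, so both `p` and `Y` can be recovered. For `p
    -- = t` only `Y` is stored; being an antichain, it cannot be confused with a set having an
    -- element strictly below its maximum.
    (f := fun q => (∅, if q.1 = t then q.2 else insert q.1 q.2)) ?_ ?_
  · rintro ⟨p, Y⟩ ⟨hp, hY, hne, hlt, _⟩
    rw [mem_coe, mem_disjointPairs]
    simp only at hp hY hne hlt ⊢
    have hYt : Y ⊆ Q.erase t := fun P hP =>
      mem_erase.2 ⟨fun h => lt_irrefl t ((h ▸ hlt P hP).trans_le (ht p hp)), hY hP⟩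
    have key : (if p = t then Y else insert p Y) ⊆ Q.erase t := by
      split_ifs with h
      · exact hYt
      · exact insert_subset (mem_erase.2 ⟨h, hp⟩) hYt
    refine ⟨by simp, key, by simp, ?_, by simp, ?_⟩
    · split_ifs
      · exact hne
      · simp
    · exact (card_le_card key).trans (card_erase_of_mem htQ).le
  · rintro ⟨p, Y⟩ ⟨hp, hY, hne, hlt, hanti⟩ ⟨p', Y'⟩ ⟨hp', hY', hne', hlt', hanti'⟩ h
    simp only [Prod.mk.injEq, true_and] at h hp hY hne hlt hanti hp' hY' hne' hlt' hanti' ⊢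
    split_ifs at h with h1 h2 h2
    · exact ⟨h1.trans h2.symm, h⟩
    · obtain ⟨P, hP⟩ := hne'
      exact absurd (hlt' P hP) (hanti P (h ▸ mem_insert_of_mem hP) p' (h ▸ mem_insert_self _ _))
    · obtain ⟨P, hP⟩ := hne
      exact absurd (hlt P hP) (hanti' P (h ▸ mem_insert_of_mem hP) p (h ▸ mem_insert_self _ _))
    · have hpp : p = p' := by
        by_contra hpp
        have a : p ∈ insert p' Y' := h ▸ mem_insert_self _ _
        have b : p' ∈ insert p Y := h ▸ mem_insert_self _ _
        have a' := hlt' p ((mem_insert.1 a).resolve_left hpp)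
        have b' := hlt p' ((mem_insert.1 b).resolve_left (Ne.symm hpp))
        exact lt_asymm a' b'
      subst hpp
      refine ⟨rfl, ?_⟩
      have hn : p ∉ Y := fun hm => lt_irrefl p (hlt p hm)
      have hn' : p ∉ Y' := fun hm => lt_irrefl p (hlt' p hm)
      rw [← erase_insert hn, h, erase_insert hn']

open Finset Classical in
-- For `S = {K}` the count leaves no room for a first set, while the quotient `p` minus the union of
-- `Y` still depends on `p`. Replacing `Y` by its maximal members makes it an antichain, and the
-- antichain encoding stores `p` together with it in a single subset.
theorem kappa_atomOf_singleton_le {α : Type u} {K : Language α} {n : ℕ} (hn : 4 ≤ n)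
    (hK : InClass K n) : kappa (atomOf K {K}) ≤ (atomValue n 1 : ℕ∞) := by
  set Q := hK.finite.toFinset with hQ
  have memQ : ∀ P, P ∈ Q ↔ P ∈ quotients K := fun P => by simp [hQ]
  have hQc : #Q = n := by
    have := hK.2
    rw [kappa, hK.finite.encard_eq_coe_toFinset_card] at this
    exact_mod_cast this
  have hKQ : K ∈ Q := (memQ K).2 (self_mem_quotients K)
  have le_iff : ∀ P R : Language α, P ≤ R ↔ ∀ z, z ∈ P → z ∈ R := fun _ _ => Iff.rfl
  have key := encard_antichain_pairs_le (Q := Q) (t := K) hKQ (fun P hP =>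
    (le_iff _ _).2 fun z hz => hK.1.quotient_subset ((memQ P).1 hP) hz)
  rw [hQc] at key
  set H := {q : Language α × Finset (Language α) | q.1 ∈ Q ∧ q.2 ⊆ Q ∧ q.2.Nonempty ∧
    (∀ P ∈ q.2, P < q.1) ∧ ∀ P ∈ q.2, ∀ R ∈ q.2, ¬ P < R} with hH
  rw [atomValue_eq (A := Q.erase K) (by rw [card_erase_of_mem hKQ, hQc])]
  have main : quotients (atomOf K {K}) ⊆
      insert 0 ((fun q => {z | z ∈ q.1 ∧ ∀ P ∈ q.2, z ∉ P}) '' H) := by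
    rintro _ ⟨w, hw, rfl⟩
    have hw' := isWord_of_isWord_atomOf hw
    set p := K.leftQuotient w
    set Y := (Q.erase K).image (fun P => P.leftQuotient w) with hY
    have mem : ∀ z, z ∈ (atomOf K {K}).leftQuotient w ↔ z ∈ p ∧ ∀ P ∈ Y, z ∉ P := by
      intro z
      rw [mem_leftQuotient_atomOf hw']
      constructor
      · rintro ⟨_, h⟩
        refine ⟨(h K (self_mem_quotients K)).2 rfl, fun P hP hz => ?_⟩
        obtain ⟨R, hR, rfl⟩ := mem_image.1 hP
        obtain ⟨hRK, hR⟩ := mem_erase.1 hR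
        exact hRK ((h R ((memQ R).1 hR)).1 hz)
      · rintro ⟨h1, h2⟩
        refine ⟨isWord_of_mem (hK.1.leftQuotient_subset h1), fun P hP => ⟨fun hz => ?_, ?_⟩⟩
        · by_contra hPK
          exact h2 _ (mem_image_of_mem _ (mem_erase.2 ⟨hPK, (memQ P).2 hP⟩)) hz
        · rintro rfl
          exact h1
    have hYQ : ∀ P ∈ Y, P ∈ Q ∧ P ≤ p := by
      intro P hP
      obtain ⟨R, hR, rfl⟩ := mem_image.1 hP
      have hR := (memQ R).1 (mem_erase.1 hR).2
      exact ⟨(memQ _).2 (leftQuotient_mem_of_mem hR hw'),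
        fun z hz => hK.1.quotient_subset hR hz⟩
    by_cases hpY : p ∈ Y
    · left
      ext z
      rw [mem]
      exact ⟨fun h => absurd h.1 (h.2 p hpY), fun h => absurd h (Language.notMem_zero z)⟩
    right
    have hYne : Y.Nonempty := by
      refine Nonempty.image (card_pos.1 ?_) _
      rw [card_erase_of_mem hKQ]; omega
    -- Every member of the finite set `Y` lies below a maximal one, so the maximal members have the
    -- same union.
    refine ⟨(p, {P ∈ Y | Maximal (· ∈ Y) P}), ⟨?_, ?_, ?_, ?_, ?_⟩, ?_⟩
    · exact (memQ p).2 (leftQuotient_mem_quotients hw')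
    · exact fun P hP => (hYQ P (mem_filter.1 hP).1).1
    · obtain ⟨P, hP⟩ := Y.exists_maximal hYne
      exact ⟨P, mem_filter.2 ⟨hP.1, hP⟩⟩
    · intro P hP
      have hP := (mem_filter.1 hP).1
      exact lt_of_le_of_ne (hYQ P hP).2 (fun h : P = p => hpY (h ▸ hP))
    · intro P hP R hR hlt
      exact absurd hlt ((mem_filter.1 hP).2.not_gt (mem_filter.1 hR).1)
    · ext z
      rw [mem]
      refine and_congr_right fun _ => ⟨fun h P hP => ?_, fun h P hP => ?_⟩
      · obtain ⟨R, hPR, hR⟩ := Y.exists_le_maximal hP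
        exact fun hz => h R (mem_filter.2 ⟨hR.1, hR⟩) (hPR hz)
      · exact h P (mem_filter.1 hP).1
  calc kappa (atomOf K {K}) ≤ _ := Set.encard_le_encard main
    _ ≤ _ := Set.encard_insert_le _ _
    _ ≤ H.encard + 1 := by gcongr; exact Set.encard_image_le _ _
    _ ≤ _ := by push_cast; gcongr

open Finset Classical in
theorem kappa_atomOf_le {α : Type u} {K : Language α} {n : ℕ} (hn : 4 ≤ n) (hK : InClass K n)
    {S : Set (Language α)} (hS : S ⊆ quotients K) (hKS : K ∈ S) (hne : S ≠ quotients K) :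
    kappa (atomOf K S) ≤ (atomValue n S.ncard : ℕ∞) := by
  have hfin : S.Finite := hK.finite.subset hS
  lift S to Finset (Language α) using hfin
  rw [Set.ncard_coe_finset]
  have hKS : K ∈ S := hKS
  rcases (by have := card_pos.2 ⟨K, hKS⟩; omega : #S = 1 ∨ 2 ≤ #S) with h1 | h2
  · obtain ⟨P, rfl⟩ := card_eq_one.1 h1
    obtain rfl := mem_singleton.1 hKS
    simpa using kappa_atomOf_singleton_le hn hK
  · have hQc : #hK.finite.toFinset = n := by
      have := hK.2
      rw [kappa, hK.finite.encard_eq_coe_toFinset_card] at this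
      exact_mod_cast this
    have hKQ : K ∈ hK.finite.toFinset := by simpa using self_mem_quotients K
    rw [atomValue_eq (A := hK.finite.toFinset.erase K) (by rw [card_erase_of_mem hKQ, hQc])]
    have main : quotients (atomOf K S) ⊆ insert (0 : Language α)
      (between K '' (disjointPairs (hK.finite.toFinset.erase K) (#S) (n - #S) : Set _)) := by
      rintro _ ⟨w, hw, rfl⟩
      refine leftQuotient_atomOf_eq hK ?_ hKS ?_ rfl h2 (isWord_of_isWord_atomOf hw)
      · intro P hP; simpa using hS hP
      · intro h; apply hne; rw [h]; simp
    calc kappa (atomOf K S) ≤ _ := Set.encard_le_encard main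
      _ ≤ _ := Set.encard_insert_le _ _
      _ ≤ _ := by
        push_cast
        gcongr
        exact (Set.encard_image_le _ _).trans (Set.encard_coe_eq_coe_finsetCard _).le


/-! ### Syntactic semigroup: upper bound, and the number of letters -/

/-- `F` is a complete invariant of the congruence. It is used with the action on quotients for
general languages and with the action on states for the witness. -/
theorem card_syntacticSemigroup {α : Type u} {β : Type v} {K : Language α} (F : List α → β)
    (hF : ∀ x y, IsWord K x → IsWord K y →
      ((∀ w z, IsWord K w → IsWord K z → (w ++ x ++ z ∈ K ↔ w ++ y ++ z ∈ K)) ↔ F x = F y)) :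
    ENat.card (SyntacticSemigroup K) = (F '' {x | x ≠ [] ∧ IsWord K x}).encard := by
  let G : SyntacticSemigroup K → β := Quotient.lift (fun x => F (toWord K x)) fun x y h =>
    (hF _ _ (toWord_isWord K x) (toWord_isWord K y)).1 h
  have hG : Function.Injective G := by
    intro p q
    refine Quotient.inductionOn₂ p q fun x y h => ?_
    exact Quotient.sound ((hF _ _ (toWord_isWord K x) (toWord_isWord K y)).2 h)
  have hr : Set.range G = F '' {x | x ≠ [] ∧ IsWord K x} := by
    ext b
    constructor
    · rintro ⟨p, rfl⟩
      refine Quotient.inductionOn p fun x => ?_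
      exact ⟨toWord K x, ⟨by simp [toWord], toWord_isWord K x⟩, rfl⟩
    · rintro ⟨x, ⟨hx, hw⟩, rfl⟩
      cases x with
      | nil => exact absurd rfl hx
      | cons y x =>
        let X : FreeSemigroup (alph K) := ⟨⟨y, hw y (by simp)⟩,
          x.attach.map fun z => ⟨z.1, hw z.1 (by simp [z.2])⟩⟩
        have hX : toWord K X = y :: x := by
          simp only [X, toWord, List.map_cons, List.map_map]
          congr 1
          simp [Function.comp_def]
        refine ⟨Quotient.mk _ X, ?_⟩
        change F (toWord K X) = _
        rw [hX]
  rw [← hr, ← Set.image_univ, hG.injOn.encard_image, Set.encard_univ]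

theorem bijective_of_mem_word {α : Type u} {P : Type v} [Finite P] {a : P → α → P} {w : List α}
    (h : Function.Bijective fun q => w.foldl a q) {x : α} (hx : x ∈ w) :
    Function.Bijective fun q => a q x := by
  induction w with
  | nil => simp at hx
  | cons y w ih =>
    have hy : Function.Bijective fun q => a q y := by
      refine Finite.injective_iff_bijective.1 fun p q e => h.1 ?_
      have e : a p y = a q y := e
      simp only [List.foldl_cons, e]
    rcases List.mem_cons.1 hx with rfl | hx
    · exact hy
    · refine ih ?_ hx
      refine (Function.Bijective.of_comp_iff (fun q => w.foldl a q) hy).1 ?_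
      exact h

/-- Take the first non-bijective letter. The letters before it permute the points and fix `t`, so
they can be stripped; the letters after it fix `t`, so if it sent another point to `t`, the whole
word would do the same. -/
theorem exists_mem_word_collapsing {α : Type u} {P : Type v} [Finite P] {a : P → α → P} {t : P}
    {w : List α} (hfix : ∀ x ∈ w, a t x = t) (hinj : ¬ Function.Injective fun q => w.foldl a q)
    (ht : ∀ q, q ≠ t → w.foldl a q ≠ t) :
    ∃ x ∈ w, ¬ (Function.Bijective fun q => a q x) ∧ ∀ q, q ≠ t → a q x ≠ t := by
  have foldfix : ∀ w : List α, (∀ x ∈ w, a t x = t) → w.foldl a t = t := by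
    intro w
    induction w with
    | nil => simp
    | cons y w ih =>
      intro h
      rw [List.foldl_cons, h y (by simp)]
      exact ih fun x hx => h x (by simp [hx])
  induction w with
  | nil => exact absurd (fun _ _ h => h) hinj
  | cons y w ih =>
    by_cases hy : Function.Bijective fun q => a q y
    · have h1 : ¬ Function.Injective fun q => w.foldl a q := fun h => hinj (h.comp hy.1)
      have h2 : ∀ q, q ≠ t → w.foldl a q ≠ t := fun q hq => by
        obtain ⟨r, rfl⟩ := hy.2 q
        refine ht r ?_
        rintro rfl
        exact hq (hfix y (by simp))
      obtain ⟨x, hx, h⟩ := ih (fun x hx => hfix x (by simp [hx])) h1 h2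
      exact ⟨x, by simp [hx], h⟩
    · refine ⟨y, by simp, hy, fun q hq h => ht q hq ?_⟩
      rw [List.foldl_cons, h]
      exact foldfix w fun x hx => hfix x (by simp [hx])

/-- Five letters are forced: two permutations, a non-bijective letter that fixes `t` and keeps the
other points off `t`, a letter that fixes `t` and sends another point there, and a letter that moves
`t`. Bijectivity and the behaviour at `t` show that they are distinct. -/
theorem five_le_encard_of_generates {α : Type u} {P : Type v} [Fintype P]
    (h4 : 4 ≤ Fintype.card P) {t : P} {A : Set α} {a : P → α → P}
    (ha : ∀ x ∈ A, (fun q => a q x) ∈ fixOrConst t)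
    (hgen : ∀ f ∈ fixOrConst t, ∃ w : List α, (∀ x ∈ w, x ∈ A) ∧ (fun q => w.foldl a q) = f) :
    5 ≤ A.encard := by
  classical
  obtain ⟨p, r, s, hp, hr, hs, hpr, hps, hrs⟩ : ∃ p r s : P, p ≠ t ∧ r ≠ t ∧ s ≠ t ∧ p ≠ r ∧
      p ≠ s ∧ r ≠ s := by
    have : 2 < (Finset.univ.erase t).card := by
      rw [Finset.card_erase_of_mem (Finset.mem_univ t), Finset.card_univ]; omega
    obtain ⟨p, r, s, hp, hr, hs, h⟩ := Finset.two_lt_card_iff.1 this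
    exact ⟨p, r, s, (Finset.mem_erase.1 hp).1, (Finset.mem_erase.1 hr).1,
      (Finset.mem_erase.1 hs).1, h⟩
  -- A letter of `A` that moves `t` is constant, and a word containing a constant letter is
  -- constant.
  have allfix : ∀ w : List α, (∀ x ∈ w, x ∈ A) → w.foldl a t = t → w.foldl a p ≠ w.foldl a t ∨
      w.foldl a r ≠ w.foldl a t → ∀ x ∈ w, a t x = t := by
    intro w hw _ hne x hx
    rcases ha x (hw x hx) with h | ⟨q, _, h⟩
    · exact h
    · exfalso
      obtain ⟨u, v, rfl⟩ := List.append_of_mem hx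
      have h' : ∀ y, a y x = q := fun y => congrFun h y
      simp [List.foldl_append, h'] at hne
  obtain ⟨x₁, h₁, x₂, h₂, h12, b₁, b₂⟩ : ∃ x₁ ∈ A, ∃ x₂ ∈ A, x₁ ≠ x₂ ∧
      (Function.Bijective fun q => a q x₁) ∧ Function.Bijective fun q => a q x₂ := by
    obtain ⟨w, hwA, hw⟩ := hgen (Equiv.swap p r) (Or.inl (Equiv.swap_apply_of_ne_of_ne hp.symm hr.symm))
    obtain ⟨v, hvA, hv⟩ := hgen (Equiv.swap r s) (Or.inl (Equiv.swap_apply_of_ne_of_ne hr.symm hs.symm))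
    -- With a single bijective letter, `w` and `v` would be powers of it and commute, whereas the
    -- transpositions (p r) and (r s) do not.
    by_contra! hcon
    have hw' : ∀ q, w.foldl a q = Equiv.swap p r q := congrFun hw
    have hv' : ∀ q, v.foldl a q = Equiv.swap r s q := congrFun hv
    have bw : ∀ x ∈ w, Function.Bijective fun q => a q x := fun x hx =>
      bijective_of_mem_word (hw ▸ (Equiv.swap p r).bijective) hx
    have bv : ∀ x ∈ v, Function.Bijective fun q => a q x := fun x hx =>
      bijective_of_mem_word (hv ▸ (Equiv.swap r s).bijective) hx
    have eq : ∀ x ∈ w ++ v, ∀ y ∈ w ++ v, x = y := by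
      intro x hx y hy
      by_contra hne
      have both : ∀ z ∈ w ++ v, z ∈ A ∧ Function.Bijective fun q => a q z := fun z hz => by
        rcases List.mem_append.1 hz with h | h
        exacts [⟨hwA z h, bw z h⟩, ⟨hvA z h, bv z h⟩]
      exact hcon x (both x hx).1 y (both y hy).1 hne (both x hx).2 (both y hy).2
    have hcomm : w ++ v = v ++ w := by
      cases h : w ++ v with
      | nil => simp_all
      | cons x l =>
        have hx : x ∈ w ++ v := by simp [h]
        have e1 : w = List.replicate w.length x :=
          List.eq_replicate_iff.2 ⟨rfl, fun b hb => eq b (by simp [hb]) x hx⟩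
        have e2 : v = List.replicate v.length x :=
          List.eq_replicate_iff.2 ⟨rfl, fun b hb => eq b (by simp [hb]) x hx⟩
        rw [← h, e1, e2, List.replicate_append_replicate, List.replicate_append_replicate,
          add_comm]
    have h1 : (w ++ v).foldl a p = s := by
      rw [List.foldl_append, hw', hv', Equiv.swap_apply_left, Equiv.swap_apply_left]
    have h2 : (v ++ w).foldl a p = r := by
      rw [List.foldl_append, hv', hw', Equiv.swap_apply_of_ne_of_ne hpr hps,
        Equiv.swap_apply_left]
    rw [hcomm, h2] at h1
    exact hrs h1
  obtain ⟨x₃, h₃, b₃, f₃, n₃⟩ : ∃ x ∈ A, ¬ (Function.Bijective fun q => a q x) ∧ a t x = t ∧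
      ∀ q, q ≠ t → a q x ≠ t := by
    obtain ⟨w, hwA, hw⟩ := hgen (fun q => if q = p then r else q) (Or.inl (by simp [hp.symm]))
    have hw' : ∀ q, w.foldl a q = if q = p then r else q := congrFun hw
    have hfix := allfix w hwA (by simp [hw', hp.symm]) (Or.inl (by simp [hw', hp.symm, hr]))
    obtain ⟨x, hx, h⟩ := exists_mem_word_collapsing hfix
      (fun h => hpr (h (by simp [hw']))) (fun q hq => by rw [hw']; split_ifs; exacts [hr, hq])
    exact ⟨x, hwA x hx, h.1, hfix x hx, h.2⟩
  obtain ⟨x₄, h₄, f₄, q, hq, n₄⟩ : ∃ x ∈ A, a t x = t ∧ ∃ q, q ≠ t ∧ a q x = t := by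
    obtain ⟨w, hwA, hw⟩ := hgen (fun q => if q = p then t else q) (Or.inl (by simp))
    have hw' : ∀ q, w.foldl a q = if q = p then t else q := congrFun hw
    have hfix := allfix w hwA (by simp [hw']) (Or.inr (by simp [hw', hpr.symm, hr]))
    by_contra! hcon
    have : ∀ v : List α, (∀ x ∈ v, x ∈ A ∧ a t x = t) → ∀ q, q ≠ t → v.foldl a q ≠ t := by
      intro v
      induction v with
      | nil => intro _ q hq; exact hq
      | cons y v ih =>
        intro h q hq
        exact ih (fun x hx => h x (by simp [hx])) _
          (hcon y (h y (by simp)).1 (h y (by simp)).2 q hq)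
    exact this w (fun x hx => ⟨hwA x hx, hfix x hx⟩) p hp (by simp [hw'])
  obtain ⟨x₅, h₅, f₅⟩ : ∃ x ∈ A, a t x ≠ t := by
    obtain ⟨w, hwA, hw⟩ := hgen (fun _ => p) (Or.inr ⟨p, hp, rfl⟩)
    by_contra! hcon
    have : ∀ v : List α, (∀ x ∈ v, x ∈ A) → v.foldl a t = t := by
      intro v
      induction v with
      | nil => simp
      | cons y v ih =>
        intro h
        rw [List.foldl_cons, hcon y (h y (by simp))]
        exact ih fun x hx => h x (by simp [hx])
    exact hp ((congrFun hw t).symm.trans (this w hwA))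
  have b₄ : ¬ Function.Bijective fun q => a q x₄ := fun h => hq (h.1 (by simp [f₄, n₄]))
  have b₅ : ¬ Function.Bijective fun q => a q x₅ := fun h => by
    rcases ha x₅ h₅ with h' | ⟨q, _, h'⟩
    · exact f₅ h'
    · exact hp (h.1 ((congrFun h' p).trans (congrFun h' t).symm))
  have n12 : x₁ ∉ ({x₂, x₃, x₄, x₅} : Set α) := by
    rintro (h | h | h | h)
    exacts [h12 h, b₃ (h ▸ b₁), b₄ (h ▸ b₁), b₅ (h ▸ b₁)]
  have n2 : x₂ ∉ ({x₃, x₄, x₅} : Set α) := by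
    rintro (h | h | h)
    exacts [b₃ (h ▸ b₂), b₄ (h ▸ b₂), b₅ (h ▸ b₂)]
  have n3 : x₃ ∉ ({x₄, x₅} : Set α) := by
    rintro (h | h)
    exacts [n₃ q hq (h ▸ n₄), f₅ (h ▸ f₃)]
  have n4 : x₄ ∉ ({x₅} : Set α) := fun h => f₅ (Set.mem_singleton_iff.1 h ▸ f₄)
  have card : ({x₁, x₂, x₃, x₄, x₅} : Set α).encard = 5 := by
    rw [Set.encard_insert_of_notMem n12, Set.encard_insert_of_notMem n2,
      Set.encard_insert_of_notMem n3, Set.encard_insert_of_notMem n4, Set.encard_singleton]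
    norm_num
  rw [← card]
  refine Set.encard_le_encard ?_
  rintro x (rfl | rfl | rfl | rfl | rfl) <;> assumption

open Classical in
/-- The action of a word over the alphabet of `K` on the quotients of `K`. -/
noncomputable def quotientAct {α : Type u} (K : Language α) (w : List α) (P : quotients K) :
    quotients K :=
  if h : IsWord K w then ⟨P.1.leftQuotient w, leftQuotient_mem_of_mem P.2 h⟩ else P

theorem coe_quotientAct {α : Type u} {K : Language α} {w : List α} (h : IsWord K w)
    (P : quotients K) : (quotientAct K w P).1 = P.1.leftQuotient w := by
  simp [quotientAct, h]

theorem card_syntacticSemigroup_eq_quotientAct {α : Type u} (K : Language α) :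
    ENat.card (SyntacticSemigroup K) = (quotientAct K '' {x | x ≠ [] ∧ IsWord K x}).encard := by
  refine card_syntacticSemigroup _ fun x y hx hy => ⟨fun h => ?_, fun h w z hw hz => ?_⟩
  · funext P
    apply Subtype.ext
    obtain ⟨_, w, hw, rfl⟩ := P
    rw [coe_quotientAct hx, coe_quotientAct hy]
    ext z
    change w ++ (x ++ z) ∈ K ↔ w ++ (y ++ z) ∈ K
    rw [← List.append_assoc, ← List.append_assoc]
    by_cases hz : IsWord K z
    · exact h w z hw hz
    · exact ⟨fun h => absurd (isWord_append.1 (isWord_of_mem h)).2 hz,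
        fun h => absurd (isWord_append.1 (isWord_of_mem h)).2 hz⟩
  · have := congrFun h ⟨_, leftQuotient_mem_quotients hw⟩
    have := congrArg Subtype.val this
    rw [coe_quotientAct hx, coe_quotientAct hy] at this
    have h' : z ∈ (K.leftQuotient w).leftQuotient x ↔ z ∈ (K.leftQuotient w).leftQuotient y := by
      rw [this]
    simpa using h'

/-- Taking quotients preserves inclusion, so words act monotonically on the poset of quotients. In
the case of equality the action semigroup is all of `fixOrConst t`, and the letters of `K` generate
it. -/
theorem syntacticSemigroup_bound {α : Type u} {K : Language α} {n : ℕ} (hn : 4 ≤ n)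
    (hK : InClass K n) :
    ENat.card (SyntacticSemigroup K) ≤ ((n ^ (n - 1) + n - 1 : ℕ) : ℕ∞) ∧
      ((alph K).encard < 5 →
        ENat.card (SyntacticSemigroup K) ≠ ((n ^ (n - 1) + n - 1 : ℕ) : ℕ∞)) := by
  classical
  have : Fintype (quotients K) := hK.finite.fintype
  have hcard : Fintype.card (quotients K) = n := by
    have := hK.2
    rw [kappa, Set.encard_eq_coe_toFinset_card, Set.toFinset_card] at this
    exact_mod_cast this
  set t : quotients K := ⟨K, self_mem_quotients K⟩
  have ht : ∀ P : quotients K, P ≤ t := fun P z hz => hK.1.quotient_subset P.2 hz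
  obtain ⟨hle, heq⟩ := ncard_monotone_le ht (hcard ▸ hn)
    (quotientAct K '' {x | x ≠ [] ∧ IsWord K x}) (by
      rintro _ ⟨x, ⟨_, hx⟩, rfl⟩ P R hPR z hz
      rw [coe_quotientAct hx] at hz ⊢
      exact hPR hz)
  rw [hcard] at hle heq
  rw [card_syntacticSemigroup_eq_quotientAct, (Set.toFinite _).encard_eq_coe]
  refine ⟨by exact_mod_cast hle, fun hlt he => ?_⟩
  have hT := heq (by exact_mod_cast he)
  refine absurd hlt (not_lt.2 ?_)
  have fold : ∀ w : List α, IsWord K w → ∀ P : quotients K,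
      w.foldl (fun P x => quotientAct K [x] P) P = quotientAct K w P := by
    intro w
    induction w with
    | nil => intro h P; exact Subtype.ext (by rw [coe_quotientAct h]; rfl)
    | cons x w ih =>
      intro h P
      obtain ⟨hx, hw⟩ := isWord_append.1 (show IsWord K ([x] ++ w) from h)
      rw [List.foldl_cons, ih hw]
      apply Subtype.ext
      rw [coe_quotientAct hw, coe_quotientAct hx, coe_quotientAct h,
        ← Language.leftQuotient_append]
      rfl
  refine five_le_encard_of_generates (P := quotients K) (t := t)
    (a := fun P x => quotientAct K [x] P) (hcard ▸ hn) ?_ ?_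
  · intro x hx
    rw [← hT]
    exact ⟨[x], ⟨by simp, by simpa [IsWord] using hx⟩, rfl⟩
  · intro f hf
    rw [← hT] at hf
    obtain ⟨w, ⟨_, hw⟩, rfl⟩ := hf
    exact ⟨w, hw, funext (fold w hw)⟩


/-! ### The witness DFA: letters -/

/-- The state `i` of the witness DFA. -/
abbrev st (n : ℕ) (_hn : 4 ≤ n) (i : ℕ) (hi : i < n := by omega) : Fin n := ⟨i, hi⟩

section Steps

variable {n : ℕ} (hn : 4 ≤ n)

theorem step_zero {l : Letter5} (h : l ≠ .e) : step n hn (st n hn 0) l = st n hn 0 := by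
  have h01 : (⟨0, by omega⟩ : Fin n) ≠ ⟨1, by omega⟩ := by simp
  have h02 : (⟨0, by omega⟩ : Fin n) ≠ ⟨2, by omega⟩ := by simp
  cases l with
  | a => simp [step]
  | b => simp only [step]; exact Equiv.swap_apply_of_ne_of_ne h01 h02
  | c => simp only [step]; rw [if_neg (by omega)]
  | d => simp [step]
  | e => exact absurd rfl h

theorem step_e (q : Fin n) : step n hn q .e = st n hn 1 := rfl

theorem step_a_ne_zero {q : Fin n} (hq : q ≠ st n hn 0) : step n hn q .a ≠ st n hn 0 := by
  have hq' : q.val ≠ 0 := fun h => hq (Fin.ext h)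
  simp only [step, hq', dite_false]
  split_ifs <;> simp

theorem step_a_of_lt {i : ℕ} (h0 : 1 ≤ i) (h1 : i + 1 < n) :
    step n hn (st n hn i) .a = st n hn (i + 1) := by
  simp only [step]
  rw [dif_neg (by omega), dif_pos h1]

theorem step_a_last : step n hn (st n hn (n - 1)) .a = st n hn 1 := by
  simp only [step]
  rw [dif_neg (by omega), dif_neg (by omega)]

theorem step_b_ne_zero {q : Fin n} (hq : q ≠ st n hn 0) : step n hn q .b ≠ st n hn 0 := by
  intro h
  apply hq
  have := step_zero hn (l := .b) (by simp)
  exact (Equiv.swap (⟨1, by omega⟩ : Fin n) ⟨2, by omega⟩).injective (h.trans this.symm)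

theorem step_c_ne_zero {q : Fin n} (hq : q ≠ st n hn 0) : step n hn q .c ≠ st n hn 0 := by
  simp only [step]
  split_ifs
  · simp
  · exact hq

theorem step_c_ne_last (q : Fin n) : step n hn q .c ≠ st n hn (n - 1) := by
  simp only [step]
  split_ifs with h
  · intro h; have := congrArg Fin.val h; simp at this; omega
  · intro h'; exact h (congrArg Fin.val h')

theorem step_d_of_ne {q : Fin n} (hq : q ≠ st n hn (n - 1)) : step n hn q .d = q := by
  simp only [step]
  rw [if_neg]
  exact fun h => hq (Fin.ext h)

theorem step_d_last : step n hn (st n hn (n - 1)) .d = st n hn 0 := by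
  simp [step]

theorem step_a_injective : Function.Injective fun q => step n hn q .a := by
  intro p q h
  simp only [step] at h
  apply Fin.ext
  split_ifs at h <;> simp [Fin.ext_iff] at h <;> omega

end Steps

/-! ### The witness DFA: generation of transformations -/

/-- The action of a word on the states of the witness DFA. -/
abbrev run (n : ℕ) (hn : 4 ≤ n) (q : Fin n) (w : List Letter5) : Fin n := (D n hn).evalFrom q w

/-- The transformations induced by nonempty words without the letter `e`. -/
def Gen (n : ℕ) (hn : 4 ≤ n) (f : Fin n → Fin n) : Prop :=
  ∃ w : List Letter5, w ≠ [] ∧ .e ∉ w ∧ ∀ q, run n hn q w = f q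

section Generation

variable {n : ℕ} {hn : 4 ≤ n}

theorem Gen.comp {f g : Fin n → Fin n} (hg : Gen n hn g) (hf : Gen n hn f) :
    Gen n hn (fun q => g (f q)) := by
  obtain ⟨w, hw, hw', hwf⟩ := hf
  obtain ⟨v, _, hv', hvg⟩ := hg
  exact ⟨w ++ v, by simp [hw], by simp [hw', hv'], fun q => by
    rw [run, DFA.evalFrom_of_append]
    change run n hn (run n hn q w) v = _
    rw [hwf, hvg]⟩

theorem Gen.letter (l : Letter5) (hl : l ≠ .e) : Gen n hn (fun q => step n hn q l) :=
  ⟨[l], by simp, by simpa using hl.symm, fun _ => rfl⟩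

theorem gen_swap_one_two : Gen n hn (Equiv.swap (st n hn 1) (st n hn 2)) := Gen.letter .b (by simp)

theorem gen_id : Gen n hn (fun q => q) := by
  -- `Gen` asks for a nonempty word; the word bb induces the identity.
  simpa using (gen_swap_one_two (n := n) (hn := hn)).comp gen_swap_one_two

variable (n hn) in
/-- The permutations induced by words without the letter `e`. -/
def genPerm : Subgroup (Equiv.Perm (Fin n)) where
  carrier := {σ | Gen n hn σ}
  one_mem' := gen_id
  mul_mem' := fun ha hb => ha.comp hb
  inv_mem' := by
    intro σ hσ
    -- In a finite group the inverse is a power, so closure under composition is enough.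
    have hpow : ∀ k : ℕ, Gen n hn ⇑(σ ^ k) := by
      intro k
      induction k with
      | zero => exact gen_id
      | succ k ih => rw [pow_succ]; exact ih.comp hσ
    obtain ⟨k, hk⟩ : σ⁻¹ ∈ Submonoid.powers σ :=
      mem_powers_iff_mem_zpowers.2 (Subgroup.inv_mem _ (Subgroup.mem_zpowers σ))
    simp only at hk
    change Gen n hn ⇑(σ⁻¹)
    rw [← hk]
    exact hpow k

/-- Conjugating by the cycle `a` shifts a transposition of neighbours one step along. -/
theorem swap_succ_mem (i : ℕ) (h : i + 2 < n) :
    Equiv.swap (st n hn (i + 1)) (st n hn (i + 2)) ∈ genPerm n hn := by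
  set α : Equiv.Perm (Fin n) := Equiv.ofBijective _
    (Finite.injective_iff_bijective.1 (step_a_injective hn))
  have hα : α ∈ genPerm n hn := Gen.letter .a (by simp)
  induction i with
  | zero => exact gen_swap_one_two
  | succ i ih =>
    have h1 : α (st n hn (i + 1)) = st n hn (i + 1 + 1) := step_a_of_lt hn (i := i + 1) (by omega) (by omega)
    have h2 : α (st n hn (i + 2)) = st n hn (i + 1 + 2) := step_a_of_lt hn (i := i + 2) (by omega) (by omega)
    rw [← h1, ← h2, Equiv.swap_apply_apply]
    exact mul_mem (mul_mem hα (ih (by omega))) (inv_mem hα)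

theorem swap_one_mem (i : ℕ) (h : i + 2 < n) :
    Equiv.swap (st n hn 1) (st n hn (i + 2)) ∈ genPerm n hn := by
  induction i with
  | zero => exact gen_swap_one_two
  | succ i ih =>
    have hs : Equiv.swap (st n hn (i + 2)) (st n hn (i + 3)) ∈ genPerm n hn :=
      swap_succ_mem (i + 1) (by omega)
    have h1 : Equiv.swap (st n hn (i + 2)) (st n hn (i + 3)) (st n hn 1) = st n hn 1 :=
      Equiv.swap_apply_of_ne_of_ne (by simp) (by simp)
    have h2 : Equiv.swap (st n hn (i + 2)) (st n hn (i + 3)) (st n hn (i + 2)) = st n hn (i + 3) :=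
      Equiv.swap_apply_left _ _
    have := Equiv.swap_apply_apply (Equiv.swap (st n hn (i + 2)) (st n hn (i + 3)))
      (st n hn 1) (st n hn (i + 2))
    rw [h1, h2] at this
    have key := mul_mem (mul_mem hs (ih (by omega))) (inv_mem hs)
    rwa [← this] at key

theorem swap_one_mem' {q : Fin n} (hq : q ≠ st n hn 0) :
    Equiv.swap (st n hn 1) q ∈ genPerm n hn := by
  have hq0 : q.val ≠ 0 := fun h => hq (Fin.ext h)
  by_cases h1 : q.val = 1
  · have : q = st n hn 1 := Fin.ext h1
    rw [this, Equiv.swap_self]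
    exact one_mem _
  · have : q = st n hn (q.val - 2 + 2) (by omega) := Fin.ext (by simp; omega)
    rw [this]
    exact swap_one_mem _ _

theorem swap_mem {p q : Fin n} (hp : p ≠ st n hn 0) (hq : q ≠ st n hn 0) :
    Equiv.swap p q ∈ genPerm n hn := by
  by_cases hpq : p = q
  · rw [hpq, Equiv.swap_self]; exact one_mem _
  by_cases hq1 : q = st n hn 1
  · rw [hq1, Equiv.swap_comm]; exact swap_one_mem' hp
  have := Equiv.swap_apply_apply (Equiv.swap (st n hn 1) p) (st n hn 1) q
  rw [Equiv.swap_apply_left, Equiv.swap_apply_of_ne_of_ne hq1 (Ne.symm hpq)] at this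
  rw [this]
  exact mul_mem (mul_mem (swap_one_mem' hp) (swap_one_mem' hq)) (inv_mem (swap_one_mem' hp))

theorem perm_mem {σ : Equiv.Perm (Fin n)} (hσ : σ (st n hn 0) = st n hn 0) :
    σ ∈ genPerm n hn := by
  have key : ∀ τ : Equiv.Perm {x : Fin n // x ≠ st n hn 0},
      Equiv.Perm.ofSubtype τ ∈ genPerm n hn := by
    intro τ
    induction τ using Equiv.Perm.swap_induction_on with
    | one => rw [map_one]; exact one_mem _
    | swap_mul f x y _ ih =>
      rw [map_mul, Equiv.Perm.ofSubtype_swap_eq]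
      exact mul_mem (swap_mem x.2 y.2) ih
  have h1 : ∀ x, x ≠ st n hn 0 ↔ σ x ≠ st n hn 0 := fun x => by
    rw [not_iff_not]
    exact ⟨fun h => h ▸ hσ, fun h => σ.injective (h.trans hσ.symm)⟩
  have h2 : Equiv.Perm.ofSubtype (σ.subtypePerm (p := fun x => x ≠ st n hn 0) (fun x => (h1 x).symm)) = σ :=
    Equiv.Perm.ofSubtype_subtypePerm (p := fun x => x ≠ st n hn 0) _
      (fun x hx h0 => hx (by rw [h0, hσ]))
  rw [← h2]
  exact key _

theorem gen_conj {f : Fin n → Fin n} (hf : Gen n hn f) {σ : Equiv.Perm (Fin n)}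
    (hσ : σ ∈ genPerm n hn) : Gen n hn (fun q => σ (f (σ⁻¹ q))) :=
  Gen.comp hσ (hf.comp (inv_mem hσ))

/-- Conjugate `d` (target 0) or `c` (target 1) by a permutation fixing 0 that carries n - 1 to `x`
and, for `c`, also 1 to `y`. -/
theorem gen_collapse {x y : Fin n} (hx : x ≠ st n hn 0) (hxy : x ≠ y) :
    Gen n hn (fun q => if q = x then y else q) := by
  have hl : st n hn (n - 1) ≠ st n hn 0 := by simp; omega
  set σ := Equiv.swap (st n hn (n - 1)) x with hσ
  have hσm : σ ∈ genPerm n hn := swap_mem hl hx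
  have hσ0 : σ (st n hn 0) = st n hn 0 := Equiv.swap_apply_of_ne_of_ne hl.symm hx.symm
  by_cases hy : y = st n hn 0
  · subst hy
    convert gen_conj (Gen.letter .d (by simp)) hσm using 2 with q
    by_cases hq : q = x
    · subst hq
      rw [if_pos rfl, hσ, Equiv.swap_inv, Equiv.swap_apply_right, step_d_last, ← hσ, hσ0]
    · rw [if_neg hq, step_d_of_ne]
      · simp
      · intro h
        rw [Equiv.Perm.inv_eq_iff_eq] at h
        rw [hσ, Equiv.swap_apply_left] at h
        exact hq h
  · set y' := σ⁻¹ y with hy'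
    have hyy : σ y' = y := by simp [hy']
    have hy'0 : y' ≠ st n hn 0 := fun h => hy (by rw [← hyy, h, hσ0])
    have hy'l : y' ≠ st n hn (n - 1) := fun h => hxy (by
      rw [← hyy, h, hσ, Equiv.swap_apply_left])
    have h1 : st n hn 1 ≠ st n hn 0 := by simp
    have h1l : st n hn (n - 1) ≠ st n hn 1 := by simp; omega
    set τ := σ * Equiv.swap (st n hn 1) y' with hτ
    have hτm : τ ∈ genPerm n hn := mul_mem hσm (swap_mem h1 hy'0)
    have hτl : τ (st n hn (n - 1)) = x := by
      rw [hτ, Equiv.Perm.mul_apply, Equiv.swap_apply_of_ne_of_ne h1l hy'l.symm, hσ,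
        Equiv.swap_apply_left]
    have hτ1 : τ (st n hn 1) = y := by
      rw [hτ, Equiv.Perm.mul_apply, Equiv.swap_apply_left, hyy]
    convert gen_conj (Gen.letter .c (by simp)) hτm using 2 with q
    by_cases hq : q = x
    · have hq' : τ⁻¹ q = st n hn (n - 1) := by rw [Equiv.Perm.inv_eq_iff_eq, hτl, hq]
      rw [if_pos hq, hq', ← hτ1]
      simp [step]
    · rw [if_neg hq]
      have : (τ⁻¹ q).val ≠ n - 1 := by
        intro h
        apply hq
        rw [← hτl, ← Equiv.Perm.inv_eq_iff_eq]
        exact Fin.ext h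
      simp only [step, this, if_false]
      simp

/-- Induct on the number of states missed by `f`. If `f x = f x'` with `x ≠ 0` and `z` is missed,
then `f` first merges `x` into `x'` and then applies `f` altered to send `x` to `z`; the altered map
misses fewer states. -/
theorem gen_of_apply_zero (f : Fin n → Fin n) (hf : f (st n hn 0) = st n hn 0) : Gen n hn f := by
  induction h : (Finset.univ \ Finset.univ.image f).card using Nat.strong_induction_on
    generalizing f with
  | _ k ih =>
    by_cases hinj : Function.Injective f
    · exact perm_mem (σ := Equiv.ofBijective f (Finite.injective_iff_bijective.1 hinj)) hf
    · obtain ⟨z, hz⟩ : ∃ z, ∀ q, f q ≠ z := by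
        by_contra! hcon
        exact hinj (Finite.injective_iff_surjective.2 hcon)
      obtain ⟨x, x', hxx, hx0, hne⟩ : ∃ x x', f x = f x' ∧ x ≠ st n hn 0 ∧ x ≠ x' := by
        simp only [Function.Injective, not_forall] at hinj
        obtain ⟨x, x', hxx, hne⟩ := hinj
        by_cases hx : x = st n hn 0
        · exact ⟨x', x, hxx.symm, fun h => hne (hx.trans h.symm), Ne.symm hne⟩
        · exact ⟨x, x', hxx, hx, hne⟩
      have hcomp : f = fun q => Function.update f x z (if q = x then x' else q) := by
        funext q
        by_cases hq : q = x
        · rw [if_pos hq, Function.update_of_ne hne.symm, hq, hxx]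
        · rw [if_neg hq, Function.update_of_ne hq]
      rw [hcomp]
      refine Gen.comp (ih _ ?_ (Function.update f x z) ?_ rfl) (gen_collapse hx0 hne)
      · rw [← h]
        refine Finset.card_lt_card ⟨?_, ?_⟩
        · intro y hy
          simp only [Finset.mem_sdiff, Finset.mem_univ, Finset.mem_image, true_and, not_exists]
            at hy ⊢
          intro q hq
          by_cases hqx : q = x
          · exact hy x' (by rw [Function.update_of_ne hne.symm, ← hxx, ← hqx, hq])
          · exact hy q (by rw [Function.update_of_ne hqx, hq])
        · intro hsub
          have hz' : z ∈ Finset.univ \ Finset.univ.image f := by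
            simpa using hz
          have := hsub hz'
          simp only [Finset.mem_sdiff, Finset.mem_univ, Finset.mem_image, true_and, not_exists]
            at this
          exact this x (by simp)
      · rw [Function.update_of_ne hx0.symm, hf]

theorem exists_word_const (p : Fin n) :
    ∃ w : List Letter5, w ≠ [] ∧ ∀ q, run n hn q w = p := by
  obtain ⟨w, _, _, h⟩ := gen_of_apply_zero (hn := hn)
    (fun q => if q = st n hn 1 then p else q) (by simp)
  refine ⟨.e :: w, by simp, fun q => ?_⟩
  change run n hn (st n hn 1) w = p
  exact (h _).trans (if_pos rfl)

/-- State 0 stays put until the first `e`, which merges all states. -/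
theorem run_zero_or (q : Fin n) (w : List Letter5) :
    run n hn (st n hn 0) w = st n hn 0 ∨ run n hn (st n hn 0) w = run n hn q w := by
  induction w generalizing q with
  | nil => exact Or.inl rfl
  | cons l w ih =>
    by_cases hl : l = .e
    · subst hl; exact Or.inr rfl
    · have : run n hn (st n hn 0) (l :: w) = run n hn (st n hn 0) w := by
        rw [run, DFA.evalFrom_cons]
        change run n hn (step n hn (st n hn 0) l) w = _
        rw [step_zero hn hl]
      rw [this]
      exact ih _

theorem run_zero_of_run {q : Fin n} {w : List Letter5} (h : run n hn q w = st n hn 0) :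
    run n hn (st n hn 0) w = st n hn 0 := by
  rcases run_zero_or (hn := hn) q w with h' | h'
  exacts [h', h'.trans h]

theorem run_mem_fixOrConst (w : List Letter5) :
    (fun q => run n hn q w) ∈ fixOrConst (st n hn 0) := by
  by_cases h : run n hn (st n hn 0) w = st n hn 0
  · exact Or.inl h
  · exact Or.inr ⟨_, h, funext fun q => ((run_zero_or q w).resolve_left h).symm⟩

/-! ### The witness DFA: minimality, complexity and the syntactic semigroup -/

theorem mem_L {w : List Letter5} : w ∈ L n hn ↔ run n hn (st n hn 0) w = st n hn 0 := Iff.rfl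

theorem exists_distinguishing {p q : Fin n} (hpq : p ≠ q) :
    ∃ z : List Letter5, ¬ (run n hn p z = st n hn 0 ↔ run n hn q z = st n hn 0) := by
  wlog hq : q ≠ st n hn 0 generalizing p q
  · obtain ⟨z, hz⟩ := this hpq.symm (fun h => hpq (h.trans (not_not.1 hq).symm))
    exact ⟨z, fun h => hz h.symm⟩
  obtain ⟨w, _, _, h⟩ := gen_of_apply_zero (hn := hn)
    (fun x => if x = q then q else st n hn 0) (if_neg hq.symm)
  refine ⟨w, ?_⟩
  rw [h, h]
  simp only [hpq, if_true, if_false, true_iff]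
  exact hq

theorem exists_word_of_state (q : Fin n) :
    ∃ w : List Letter5, run n hn (st n hn 0) w = q := by
  obtain ⟨w, _, h⟩ := exists_word_const (hn := hn) q
  exact ⟨w, h _⟩

variable (n hn) in
theorem isMinimalDFA_D : IsMinimalDFA (D n hn) := by
  refine ⟨fun q => exists_word_of_state q, fun p q h => ?_⟩
  by_contra hpq
  obtain ⟨z, hz⟩ := exists_distinguishing (hn := hn) hpq
  apply hz
  change z ∈ (D n hn).acceptsFrom p ↔ z ∈ (D n hn).acceptsFrom q
  rw [h]

variable (n hn) in
theorem L_eq_compl : L n hn = (M n hn)ᶜ := by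
  ext w
  change run n hn (st n hn 0) w = st n hn 0 ↔ ¬ (E n hn).eval w ∈ (E n hn).accept
  have : (E n hn).eval w = run n hn (st n hn 0) w := rfl
  rw [this]
  change _ ↔ ¬ (_ ≠ 0)
  rw [not_not, Fin.ext_iff]

variable (n hn) in
theorem alph_L : alph (L n hn) = Set.univ := by
  refine Set.eq_univ_of_forall fun l => ?_
  obtain ⟨w, _, _, h⟩ := gen_of_apply_zero (hn := hn) (fun _ => st n hn 0) rfl
  exact ⟨l :: w, h _, by simp⟩

theorem isWord_L (w : List Letter5) : IsWord (L n hn) w := fun x _ => by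
  rw [alph_L]; trivial

variable (n hn) in
theorem isSuffixClosed_L : IsSuffixClosed (L n hn) := by
  rintro _ x hw ⟨u, rfl⟩
  have : run n hn (st n hn 0) (u ++ x) = st n hn 0 := hw
  rw [run, DFA.evalFrom_of_append] at this
  exact run_zero_of_run this

variable (n hn) in
theorem kappa_L : kappa (L n hn) = n := by
  have hc : (Set.univ : Set (Fin n)).encard = n := by simp
  apply le_antisymm
  · rw [← hc]
    refine kappa_le_encard Set.univ (D n hn).acceptsFrom fun w _ => ?_
    exact ⟨_, trivial, Language.leftQuotient_accepts_apply _ _⟩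
  · rw [← hc]
    refine encard_le_kappa_of_dfa (D n hn) Set.univ (fun q _ => ?_) fun p _ q _ h => ?_
    · obtain ⟨w, hw⟩ := exists_word_of_state (hn := hn) q
      exact ⟨w, isWord_L w, hw⟩
    · exact exists_distinguishing h

variable (n hn) in
theorem inClass_L : InClass (L n hn) n := ⟨isSuffixClosed_L n hn, kappa_L n hn⟩

variable (n hn) in
theorem card_syntacticSemigroup_L :
    ENat.card (SyntacticSemigroup (L n hn)) = ((n ^ (n - 1) + n - 1 : ℕ) : ℕ∞) := by
  have h1 : (fun w q => run n hn q w) '' {x | x ≠ [] ∧ IsWord (L n hn) x} =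
      fixOrConst (st n hn 0) := by
    ext f
    constructor
    · rintro ⟨w, _, rfl⟩
      exact run_mem_fixOrConst w
    · rintro (h | ⟨p, _, rfl⟩)
      · obtain ⟨w, hw, _, h'⟩ := gen_of_apply_zero (hn := hn) f h
        exact ⟨w, ⟨hw, isWord_L w⟩, funext h'⟩
      · obtain ⟨w, hw, h'⟩ := exists_word_const (hn := hn) p
        exact ⟨w, ⟨hw, isWord_L w⟩, funext h'⟩
  rw [card_syntacticSemigroup (fun w q => run n hn q w), h1, (Set.toFinite _).encard_eq_coe]
  · have := ncard_fixOrConst (st n hn 0)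
    rw [Fintype.card_fin] at this
    rw [← this]
    rfl
  · intro x y _ _
    simp only [mem_L, run, DFA.evalFrom_of_append]
    constructor
    · intro h
      funext q
      by_contra hne
      obtain ⟨z, hz⟩ := exists_distinguishing (hn := hn) hne
      obtain ⟨w, hw⟩ := exists_word_of_state (hn := hn) q
      apply hz
      have := h w z (isWord_L w) (isWord_L z)
      rw [run] at hw
      rwa [hw] at this
    · intro h w z _ _
      rw [show (D n hn).evalFrom _ x = _ from congrFun h _]

end Generation


/-! ### The witness DFA: complexity of atoms -/

open Finset in
-- A surjection exists by cardinality; precomposing it with a transposition of `s` gives it the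
-- prescribed value at `a`.
theorem exists_image_eq {β : Type v} [DecidableEq β] {s t : Finset β} {a b : β} (ha : a ∈ s)
    (hb : b ∈ t) (h : #t ≤ #s) : ∃ g : β → β, g a = b ∧ s.image g = t := by
  obtain ⟨s', hs', hc⟩ := exists_subset_card_eq h
  have e : s' ≃ t := Fintype.equivOfCardEq (by simpa using hc)
  let f : β → β := fun x => if hx : x ∈ s' then e ⟨x, hx⟩ else b
  have hf : s.image f = t := by
    ext y
    rw [mem_image]
    constructor
    · rintro ⟨x, _, rfl⟩
      by_cases hx : x ∈ s'
      · simp only [f, hx, dite_true]; exact (e ⟨x, hx⟩).2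
      · simpa only [f, hx, dite_false] using hb
    · intro hy
      refine ⟨(e.symm ⟨y, hy⟩).1, hs' (e.symm ⟨y, hy⟩).2, ?_⟩
      simp [f]
  obtain ⟨c, hc, hcb⟩ := mem_image.1 (hf.symm ▸ hb : b ∈ s.image f)
  refine ⟨fun x => f (Equiv.swap a c x), by simp [hcb], ?_⟩
  have hsw : s.image (Equiv.swap a c) = s := by
    apply eq_of_subset_of_card_le
    · intro y hy
      obtain ⟨x, hx, rfl⟩ := mem_image.1 hy
      rw [Equiv.swap_apply_def]
      split_ifs
      exacts [hc, ha, hx]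
    · rw [card_image_of_injective _ (Equiv.injective _)]
  conv_rhs => rw [← hf, ← hsw, image_image]
  rfl

section WitnessAtoms

variable {n : ℕ} {hn : 4 ≤ n}

/-- The states whose languages belong to `S`. -/
noncomputable def statesOf (n : ℕ) (hn : 4 ≤ n) (S : Set (Language Letter5)) : Finset (Fin n) := by
  classical exact {q | (D n hn).acceptsFrom q ∈ S}

theorem mem_statesOf {S : Set (Language Letter5)} {q : Fin n} :
    q ∈ statesOf n hn S ↔ (D n hn).acceptsFrom q ∈ S := by simp [statesOf]

theorem acceptsFrom_mem_quotients (q : Fin n) : (D n hn).acceptsFrom q ∈ quotients (L n hn) := by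
  obtain ⟨w, hw⟩ := exists_word_of_state (hn := hn) q
  refine ⟨w, isWord_L w, ?_⟩
  rw [L, Language.leftQuotient_accepts_apply, ← hw]
  rfl

theorem quotients_L : quotients (L n hn) = Set.range (D n hn).acceptsFrom := by
  ext P
  constructor
  · rintro ⟨w, _, rfl⟩
    exact ⟨_, (Language.leftQuotient_accepts_apply _ _).symm⟩
  · rintro ⟨q, rfl⟩
    exact acceptsFrom_mem_quotients q

theorem mem_atomOf_L {S : Set (Language Letter5)} {x : List Letter5} :
    x ∈ atomOf (L n hn) S ↔ ∀ q, (run n hn q x = st n hn 0 ↔ q ∈ statesOf n hn S) := by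
  constructor
  · rintro ⟨_, h⟩ q
    rw [mem_statesOf]
    exact h _ (acceptsFrom_mem_quotients q)
  · refine fun h => ⟨isWord_L x, ?_⟩
    rw [quotients_L]
    rintro _ ⟨q, rfl⟩
    rw [← mem_statesOf]
    exact h q

theorem card_statesOf {S : Set (Language Letter5)} (hS : S ⊆ quotients (L n hn)) :
    (statesOf n hn S).card = S.ncard := by
  have hinj : Function.Injective (D n hn).acceptsFrom := fun p q h =>
    (isMinimalDFA_D n hn).2 p q h
  have : S = (D n hn).acceptsFrom '' (statesOf n hn S) := by
    ext P
    constructor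
    · intro hP
      obtain ⟨q, rfl⟩ := quotients_L (hn := hn) ▸ hS hP
      exact ⟨q, mem_statesOf.2 hP, rfl⟩
    · rintro ⟨q, hq, rfl⟩
      exact mem_statesOf.1 hq
  conv_rhs => rw [this, Set.ncard_image_of_injective _ hinj, Set.ncard_coe_finset]

theorem run_append (q : Fin n) (w z : List Letter5) :
    run n hn q (w ++ z) = run n hn (run n hn q w) z := DFA.evalFrom_of_append _ _ _ _

theorem le_kappa_atomOf_empty : (n : ℕ∞) ≤ kappa (atomOf (L n hn) ∅) := by
  have mem : ∀ x, x ∈ atomOf (L n hn) ∅ ↔ run n hn (st n hn 0) x ≠ st n hn 0 := by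
    intro x
    rw [mem_atomOf_L]
    simp only [mem_statesOf, Set.mem_empty_iff_false, iff_false]
    exact ⟨fun h => h _, fun h q hq => h (run_zero_of_run hq)⟩
  have hword : ∀ w, IsWord (atomOf (L n hn) ∅) w := by
    intro w l _
    refine ⟨[l, .e], ?_, by simp⟩
    rw [mem]
    intro h
    have : st n hn 1 = st n hn 0 := h
    simp at this
  choose f hf using exists_word_of_state (n := n) (hn := hn)
  have := encard_le_kappa (L := atomOf (L n hn) ∅) (Set.univ : Set (Fin n)) f
    (fun _ _ => hword _) (fun p _ q _ h => by
      by_contra hpq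
      obtain ⟨z, hz⟩ := exists_distinguishing (hn := hn) hpq
      have := h z
      rw [mem, mem, run_append, run_append, hf, hf] at this
      exact hz (not_iff_not.1 this))
  simpa using this

/-- For each set of nonzero states there is a word fixing exactly these and sending the rest to 0.
Two such words are told apart by a continuation that fixes one chosen state and sends all others to
0. -/
theorem le_kappa_atomOf_quotients :
    ((2 ^ (n - 1) : ℕ) : ℕ∞) ≤ kappa (atomOf (L n hn) (quotients (L n hn))) := by
  have mem : ∀ x, x ∈ atomOf (L n hn) (quotients (L n hn)) ↔ ∀ q, run n hn q x = st n hn 0 := by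
    intro x
    rw [mem_atomOf_L]
    simp [mem_statesOf, acceptsFrom_mem_quotients]
  have hword : ∀ w, IsWord (atomOf (L n hn) (quotients (L n hn))) w := by
    intro w l _
    obtain ⟨v, _, _, h⟩ := gen_of_apply_zero (hn := hn) (fun _ => st n hn 0) rfl
    exact ⟨l :: v, (mem _).2 fun q => h _, by simp⟩
  have key : ∀ X : Finset (Fin n), ∃ w, ∀ q, run n hn q w = if q ∈ X then q else st n hn 0 := by
    intro X
    obtain ⟨w, _, _, h⟩ := gen_of_apply_zero (hn := hn)
      (fun q => if q ∈ X then q else st n hn 0) (by simp)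
    exact ⟨w, h⟩
  choose f hf using key
  have card : (((Finset.univ.erase (st n hn 0)).powerset : Finset (Finset (Fin n))) :
      Set (Finset (Fin n))).encard = ((2 ^ (n - 1) : ℕ) : ℕ∞) := by
    rw [Set.encard_coe_eq_coe_finsetCard, Finset.card_powerset,
      Finset.card_erase_of_mem (Finset.mem_univ _), Finset.card_univ, Fintype.card_fin]
  rw [← card]
  refine encard_le_kappa _ f (fun _ _ => hword _) ?_
  have half : ∀ X ∈ (Finset.univ.erase (st n hn 0)).powerset, ∀ Y : Finset (Fin n),
      (∀ z, f X ++ z ∈ atomOf (L n hn) (quotients (L n hn)) ↔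
        f Y ++ z ∈ atomOf (L n hn) (quotients (L n hn))) → X ⊆ Y := by
    intro X hX Y h q hq
    by_contra hqY
    have hq0 : q ≠ st n hn 0 := fun h => by
      have := Finset.mem_powerset.1 hX hq
      simp [h] at this
    obtain ⟨w, _, _, hw⟩ := gen_of_apply_zero (hn := hn)
      (fun r => if r = q then q else st n hn 0) (if_neg hq0.symm)
    have := (h w).2 (by
      rw [mem]
      intro r
      rw [run_append, hf, hw]
      dsimp only
      rw [if_neg]
      split_ifs with hr
      · rintro rfl; exact hqY hr
      · exact hq0.symm)
    rw [mem] at this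
    have := this q
    rw [run_append, hf, if_pos hq, hw] at this
    exact hq0 (by simpa using this)
  exact fun X hX Y hY h => Finset.Subset.antisymm (half X hX Y h) (half Y hY X fun z => (h z).symm)

/-- Starting from a word `x₀` of the atom: `a` and `b` can be put in front and undone by a word
inducing the inverse permutation. The word cd can be appended, because `c` vacates n - 1, so `d`
then moves nothing, and neither letter changes whether a state is 0. -/
theorem isWord_atomOf_L {S : Set (Language Letter5)} (hne : ∃ x, x ∈ atomOf (L n hn) S)
    {w : List Letter5} (hw : .e ∉ w) : IsWord (atomOf (L n hn) S) w := by
  obtain ⟨x₀, hx₀⟩ := hne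
  have pre : ∀ l, (Function.Injective fun q => step n hn q l) → l ≠ .e → l ∈ alph (atomOf (L n hn) S) := by
    intro l hinj hl
    set σ : Equiv.Perm (Fin n) := Equiv.ofBijective _ (Finite.injective_iff_bijective.1 hinj)
    have hσ : σ (st n hn 0) = st n hn 0 := step_zero hn hl
    obtain ⟨v, _, _, hv⟩ := gen_of_apply_zero (hn := hn) (σ⁻¹ : Equiv.Perm _)
      (by rw [Equiv.Perm.inv_eq_iff_eq, hσ])
    refine ⟨l :: (v ++ x₀), ?_, by simp⟩
    rw [mem_atomOf_L] at hx₀ ⊢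
    intro q
    have : run n hn q (l :: (v ++ x₀)) = run n hn (run n hn (σ q) v) x₀ := run_append _ _ _
    rw [this, hv, ← Equiv.Perm.mul_apply, inv_mul_cancel]
    exact hx₀ q
  have post : x₀ ++ [.c, .d] ∈ atomOf (L n hn) S := by
    rw [mem_atomOf_L] at hx₀ ⊢
    intro q
    rw [run_append, ← hx₀]
    change step n hn (step n hn (run n hn q x₀) .c) .d = _ ↔ _
    rw [step_d_of_ne hn (step_c_ne_last hn _)]
    by_cases h : run n hn q x₀ = st n hn 0
    · rw [h, step_zero hn (by simp)]
    · simp [h, step_c_ne_zero hn h]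
  intro l hl
  cases l with
  | a => exact pre _ (step_a_injective hn) (by simp)
  | b => exact pre _ (Equiv.injective _) (by simp)
  | c => exact ⟨_, post, by simp⟩
  | d => exact ⟨_, post, by simp⟩
  | e => exact absurd hl hw

open Finset in
-- A word mapping `X₀` onto `X ∪ {0}` and its complement onto `Y` realises the pair `(X, Y)`. The
-- word sending everything to 0 gives the empty quotient, encoded as `none`, which is the summand 1
-- in `atomValue`.
theorem le_kappa_atomOf_L {S : Set (Language Letter5)} (hS : S ⊆ quotients (L n hn))
    (ha : atomOf (L n hn) S ∈ atoms (L n hn)) (hLS : L n hn ∈ S)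
    (hne : S ≠ quotients (L n hn)) :
    (atomValue n S.ncard : ℕ∞) ≤ kappa (atomOf (L n hn) S) := by
  set X₀ := statesOf n hn S with hX₀
  have h0 : st n hn 0 ∈ X₀ := mem_statesOf.2 hLS
  obtain ⟨r, hr⟩ : ∃ r, r ∉ X₀ := by
    by_contra! hcon
    apply hne
    refine subset_antisymm hS ?_
    rw [quotients_L]
    rintro _ ⟨q, rfl⟩
    exact mem_statesOf.1 (hcon q)
  have hnon : ∃ x, x ∈ atomOf (L n hn) S := by
    obtain ⟨x, hx, e⟩ := ha
    exact ⟨x, by rw [e]; exact ⟨hx, fun u _ => Iff.rfl⟩⟩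
  have hA : #((univ : Finset (Fin n)).erase (st n hn 0)) = n - 1 := by
    rw [card_erase_of_mem (mem_univ _), card_univ, Fintype.card_fin]
  rw [← card_statesOf hS, ← hX₀, atomValue_eq hA]
  set G := disjointPairs ((univ : Finset (Fin n)).erase (st n hn 0)) (#X₀) (n - #X₀) with hG
  have card : ((insertNone G : Finset _) : Set (Option (Finset (Fin n) × Finset (Fin n)))).encard =
      ((#G + 1 : ℕ) : ℕ∞) := by
    rw [Set.encard_coe_eq_coe_finsetCard, card_insertNone]
  rw [← card]
  have hcompl : #X₀ᶜ = n - #X₀ := by rw [card_compl, Fintype.card_fin]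
  have key : ∀ i : Option (Finset (Fin n) × Finset (Fin n)), ∃ w : List Letter5, i ∈ insertNone G →
      .e ∉ w ∧ ∀ z, w ++ z ∈ atomOf (L n hn) S ↔
        ∃ p, i = some p ∧ (∀ q ∈ insert (st n hn 0) p.1, run n hn q z = st n hn 0) ∧
          ∀ q ∈ p.2, run n hn q z ≠ st n hn 0 := by
    rintro (_ | ⟨X, Y⟩)
    · obtain ⟨w, _, he, hw⟩ := gen_of_apply_zero (hn := hn) (fun _ => st n hn 0) rfl
      refine ⟨w, fun _ => ⟨he, fun z => ⟨fun h => ?_, by simp⟩⟩⟩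
      rw [mem_atomOf_L] at h
      have h1 := (h (st n hn 0)).2 h0
      rw [run_append, hw] at h1
      exact absurd ((h r).1 (by rw [run_append, hw, h1])) hr
    · by_cases hXY : (X, Y) ∈ G
      swap
      · exact ⟨[], fun h => absurd (some_mem_insertNone.1 h) hXY⟩
      have hXY' := mem_disjointPairs.1 hXY
      simp only at hXY'
      obtain ⟨hX, hY, hd, ⟨y, hy⟩, hXc, hYc⟩ := hXY'
      have h0X : st n hn 0 ∉ X := fun h => (mem_erase.1 (hX h)).1 rfl
      obtain ⟨g, hg0, hg⟩ := exists_image_eq h0 (mem_insert_self (st n hn 0) X)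
        (by rwa [card_insert_of_notMem h0X])
      obtain ⟨k, _, hk⟩ := exists_image_eq (mem_compl.2 hr) hy (by rwa [hcompl])
      obtain ⟨w, _, he, hw⟩ := gen_of_apply_zero (hn := hn) (fun q => if q ∈ X₀ then g q else k q)
        (by rw [if_pos h0, hg0])
      refine ⟨w, fun _ => ⟨he, fun z => ?_⟩⟩
      rw [mem_atomOf_L, ← hX₀]
      simp only [run_append, hw]
      constructor
      · intro h
        refine ⟨_, rfl, ?_, ?_⟩
        · intro q hq
          rw [← hg, mem_image] at hq
          obtain ⟨q, hq, rfl⟩ := hq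
          have := (h q).2 hq
          rwa [if_pos hq] at this
        · intro q hq
          simp only at hq
          rw [← hk, mem_image] at hq
          obtain ⟨q, hq, rfl⟩ := hq
          have hq := mem_compl.1 hq
          have := mt (h q).1 hq
          rwa [if_neg hq] at this
      · rintro ⟨_, h, h1, h2⟩ q
        obtain rfl := Option.some.inj h
        simp only at h1 h2
        rw [← hg] at h1
        rw [← hk] at h2
        by_cases hq : q ∈ X₀
        · simpa [hq] using h1 _ (mem_image_of_mem _ hq)
        · simpa [hq] using h2 _ (mem_image_of_mem _ (mem_compl.2 hq))
  choose f hf using key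
  refine encard_le_kappa _ f (fun i hi => isWord_atomOf_L hnon (hf i hi).1) ?_
  have sep : ∀ i ∈ insertNone G, ∀ p ∈ G, (∀ z, f i ++ z ∈ atomOf (L n hn) S ↔
      f (some p) ++ z ∈ atomOf (L n hn) S) → ∃ p', i = some p' ∧ p'.1 ⊆ p.1 ∧ p'.2 ⊆ p.2 := by
    rintro i hi ⟨X, Y⟩ hp h
    have hi' := (hf i hi).2
    have hp' := (hf _ (some_mem_insertNone.2 hp)).2
    obtain ⟨hX, hY, hd, -, -, -⟩ := mem_disjointPairs.1 hp
    have hY0 : st n hn 0 ∉ Y := fun h => (mem_erase.1 (hY h)).1 rfl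
    -- `v` sends exactly `X ∪ {0}` to 0, the largest first set compatible with acceptance; `u` below
    -- keeps exactly `Y` off 0. Acceptance of both after another code's word forces that code's sets
    -- into `X` and `Y`.
    obtain ⟨v, _, _, hv⟩ := gen_of_apply_zero (hn := hn)
      (fun q => if q ∈ insert (st n hn 0) X then st n hn 0 else st n hn 1) (by simp)
    obtain ⟨u, _, _, hu⟩ := gen_of_apply_zero (hn := hn)
      (fun q => if q ∈ Y then st n hn 1 else st n hn 0) (by simp [hY0])
    have h10 : st n hn 1 ≠ st n hn 0 := by simp
    have hv' : f (some (X, Y)) ++ v ∈ atomOf (L n hn) S := by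
      rw [hp']
      refine ⟨_, rfl, fun q hq => ?_, fun q hq => ?_⟩
      · rw [hv]; exact if_pos hq
      · rw [hv]
        dsimp only
        rw [if_neg]
        · exact h10
        · intro hq'
          rcases mem_insert.1 hq' with rfl | hq'
          · exact hY0 hq
          · exact disjoint_left.1 hd hq' hq
    have hu' : f (some (X, Y)) ++ u ∈ atomOf (L n hn) S := by
      rw [hp']
      refine ⟨_, rfl, fun q hq => ?_, fun q hq => ?_⟩
      · rw [hu]
        refine if_neg fun hq' => ?_
        rcases mem_insert.1 hq with rfl | hq
        · exact hY0 hq'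
        · exact disjoint_left.1 hd hq hq'
      · rw [hu]; dsimp only; rw [if_pos hq]; exact h10
    rw [← h, hi'] at hv' hu'
    obtain ⟨p', rfl, h1, _⟩ := hv'
    obtain ⟨p'', he, _, h2⟩ := hu'
    obtain rfl := Option.some.inj he
    refine ⟨p', rfl, fun q hq => ?_, fun q hq => ?_⟩
    · have := h1 q (mem_insert_of_mem hq)
      rw [hv] at this
      by_contra hqX
      have hq0 : q ≠ st n hn 0 := by
        intro hq0
        rw [hq0] at hq
        have := (mem_disjointPairs.1 (some_mem_insertNone.1 hi)).1 hq
        exact (mem_erase.1 this).1 rfl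
      dsimp only at this
      rw [if_neg fun hm => (mem_insert.1 hm).elim hq0 hqX] at this
      exact h10 this
    · have := h2 q hq
      rw [hu] at this
      by_contra hqY
      exact this (if_neg hqY)
  rintro (_ | p) hi (_ | p') hj h
  · rfl
  · obtain ⟨_, h, _⟩ := sep none hi p' (some_mem_insertNone.1 hj) h
    exact absurd h (by simp)
  · obtain ⟨_, h, _⟩ := sep none hj p (some_mem_insertNone.1 hi) fun z => (h z).symm
    exact absurd h (by simp)
  · obtain ⟨_, e, h1, h2⟩ := sep _ hi p' (some_mem_insertNone.1 hj) h
    obtain rfl := Option.some.inj e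
    obtain ⟨_, e, h3, h4⟩ := sep _ hj p (some_mem_insertNone.1 hi) fun z => (h z).symm
    obtain rfl := Option.some.inj e
    rw [Prod.ext (h1.antisymm h3) (h2.antisymm h4)]

end WitnessAtoms


/-! ### Dialects -/

/-- The DFA of a dialect of `L_n`, where `ρ` sends each letter of the dialect to the letter it
replaces; the state `none` is a sink for the other letters. -/
def dialDFA (n : ℕ) (hn : 4 ≤ n) (ρ : Letter6 → Option Letter5) : DFA Letter6 (Option (Fin n)) where
  step q x := q.bind fun q => (ρ x).map (step n hn q)
  start := some (st n hn 0)
  accept := {some (st n hn 0)}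

/-- The action of a word of the dialect on the states. -/
abbrev drun (n : ℕ) (hn : 4 ≤ n) (ρ : Letter6 → Option Letter5) (q : Option (Fin n))
    (w : List Letter6) : Option (Fin n) := (dialDFA n hn ρ).evalFrom q w

theorem isSuffixClosed_dialect {α : Type u} {β : Type v} (π : α → Option β) {K : Language α}
    (hK : IsSuffixClosed K) : IsSuffixClosed (dialect π K) := by
  rintro _ x ⟨w, hw, e⟩ ⟨u, rfl⟩
  rw [List.map_append, List.map_eq_append_iff] at e
  obtain ⟨w₁, w₂, rfl, _, e₂⟩ := e
  exact ⟨w₂, hK _ _ hw (List.suffix_append _ _), e₂⟩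

section Dialects

variable {n : ℕ} {hn : 4 ≤ n} {ρ : Letter6 → Option Letter5}

theorem drun_append (q : Option (Fin n)) (w z : List Letter6) :
    drun n hn ρ q (w ++ z) = drun n hn ρ (drun n hn ρ q w) z := DFA.evalFrom_of_append _ _ _ _

theorem drun_cons (q : Option (Fin n)) (x : Letter6) (z : List Letter6) :
    drun n hn ρ q (x :: z) = drun n hn ρ (drun n hn ρ q [x]) z := rfl

theorem drun_singleton (q : Fin n) {x : Letter6} {l : Letter5} (h : ρ x = some l) :
    drun n hn ρ (some q) [x] = some (step n hn q l) := by
  simp [drun, dialDFA, h]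

theorem drun_none (w : List Letter6) : drun n hn ρ none w = none := by
  induction w with
  | nil => rfl
  | cons x w ih => rw [drun_cons]; exact ih

theorem drun_eq_some_iff {π : Letter5 → Option Letter6}
    (h : ∀ l x, π l = some x ↔ ρ x = some l) (v : List Letter6) (q r : Fin n) :
    drun n hn ρ (some q) v = some r ↔
      ∃ w : List Letter5, w.map π = v.map some ∧ run n hn q w = r := by
  induction v generalizing q with
  | nil =>
    constructor
    · intro e
      exact ⟨[], rfl, Option.some.inj e⟩
    · rintro ⟨w, hw, e⟩
      obtain rfl : w = [] := by simpa using hw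
      exact congrArg some e
  | cons x v ih =>
    rw [drun_cons]
    constructor
    · intro e
      cases hx : ρ x with
      | none =>
        have : drun n hn ρ (some q) [x] = none := by simp [drun, dialDFA, hx]
        rw [this, drun_none] at e
        exact absurd e (by simp)
      | some l =>
        rw [drun_singleton q hx, ih] at e
        obtain ⟨w, hw, e⟩ := e
        exact ⟨l :: w, by simp [hw, (h l x).2 hx], e⟩
    · rintro ⟨w, hw, e⟩
      cases w with
      | nil => simp at hw
      | cons l w =>
        simp only [List.map_cons, List.cons.injEq] at hw
        rw [drun_singleton q ((h l x).1 hw.1), ih]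
        exact ⟨w, hw.2, e⟩

theorem dialect_eq_accepts {π : Letter5 → Option Letter6}
    (h : ∀ l x, π l = some x ↔ ρ x = some l) :
    dialect π (L n hn) = (dialDFA n hn ρ).accepts := by
  ext v
  refine Iff.symm ((drun_eq_some_iff h v (st n hn 0) (st n hn 0)).trans ?_)
  exact ⟨fun ⟨w, hw, e⟩ => ⟨w, e, hw⟩, fun ⟨w, e, hw⟩ => ⟨w, hw, e⟩⟩

/-- The letters `a`, `d` of the dialect act as in `L_n`, and `k` acts as the constant map. -/
structure HasADE (ρ : Letter6 → Option Letter5) (k : Letter6) : Prop where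
  a : ρ .a = some .a
  d : ρ .d = some .d
  k : ρ k = some .e
  eq_d : ∀ x, ρ x = some .d → x = .d

theorem HasADE.k_ne_d {k : Letter6} (h : HasADE ρ k) : Letter6.d ≠ k := by
  rintro rfl
  have := h.d.symm.trans h.k
  simp at this

theorem drun_a_pow (ha : ρ .a = some .a) {i j : ℕ} (hi : 1 ≤ i) (hij : i + j < n) :
    drun n hn ρ (some (st n hn i)) (List.replicate j .a) = some (st n hn (i + j)) := by
  induction j generalizing i with
  | zero => rfl
  | succ j ih =>
    rw [List.replicate_succ, drun_cons, drun_singleton _ ha, step_a_of_lt hn hi (by omega),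
      ih (by omega) (by omega)]
    congr 2
    omega

theorem drun_a_pow_last (ha : ρ .a = some .a) {i : ℕ} (hi : 1 ≤ i) (hin : i < n) :
    drun n hn ρ (some (st n hn i)) (List.replicate (n - 1 - i) .a) = some (st n hn (n - 1)) := by
  rw [drun_a_pow ha hi (by omega)]
  congr 2
  omega

theorem drun_d_last (hd : ρ .d = some .d) :
    drun n hn ρ (some (st n hn (n - 1))) [.d] = some (st n hn 0) := by
  rw [drun_singleton _ hd, step_d_last]

theorem drun_d_of_ne (hd : ρ .d = some .d) {q : Option (Fin n)}
    (hq : q ≠ some (st n hn (n - 1))) : drun n hn ρ q [.d] = q := by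
  cases q with
  | none => rfl
  | some q => rw [drun_singleton _ hd, step_d_of_ne hn (fun h => hq (by rw [h]))]

/-- Only `d` can bring a state into 0 from elsewhere, and the sink is never left. -/
theorem drun_singleton_ne_zero {x : Letter6} (hx : ρ x ≠ some .d) {q : Option (Fin n)}
    (hq : q ≠ some (st n hn 0)) : drun n hn ρ q [x] ≠ some (st n hn 0) := by
  cases q with
  | none => rw [drun_none]; simp
  | some q =>
    have hq : q ≠ st n hn 0 := fun h => hq (by rw [h])
    cases h : ρ x with
    | none => simp [drun, dialDFA, h]
    | some l =>
      rw [drun_singleton _ h]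
      intro e
      have e := Option.some.inj e
      cases l with
      | a => exact step_a_ne_zero hn hq e
      | b => exact step_b_ne_zero hn hq e
      | c => exact step_c_ne_zero hn hq e
      | d => exact hx h
      | e => rw [step_e] at e; simp at e

theorem drun_ne_zero (heq : ∀ x, ρ x = some .d → x = .d) {w : List Letter6} (hw : .d ∉ w)
    {q : Option (Fin n)} (hq : q ≠ some (st n hn 0)) : drun n hn ρ q w ≠ some (st n hn 0) := by
  induction w generalizing q with
  | nil => exact hq
  | cons x w ih =>
    rw [drun_cons]
    simp only [List.mem_cons, not_or] at hw
    exact ih hw.2 (drun_singleton_ne_zero (fun h => hw.1 (heq x h).symm) hq)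

theorem drun_injective {w : List Letter6}
    (h : ∀ x ∈ w, ρ x = some .a ∨ ρ x = some .b) : Function.Injective fun q => drun n hn ρ q w := by
  induction w with
  | nil => exact fun _ _ h => h
  | cons x w ih =>
    have hx : Function.Injective fun q => drun n hn ρ q [x] := by
      intro p q e
      simp only at e
      rcases h x (by simp) with hx | hx <;> rcases p with _ | p <;> rcases q with _ | q
      · rfl
      · rw [drun_singleton _ hx, drun_none] at e; simp at e
      · rw [drun_singleton _ hx, drun_none] at e; simp at e
      · rw [drun_singleton _ hx, drun_singleton _ hx] at e
        rw [step_a_injective hn (Option.some.inj e)]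
      · rfl
      · rw [drun_singleton _ hx, drun_none] at e; simp at e
      · rw [drun_singleton _ hx, drun_none] at e; simp at e
      · rw [drun_singleton _ hx, drun_singleton _ hx] at e
        rw [(Equiv.swap (⟨1, by omega⟩ : Fin n) ⟨2, by omega⟩).injective (Option.some.inj e)]
    exact fun p q e => hx (ih (fun y hy => h y (by simp [hy])) e)

theorem drun_zero {w : List Letter6} (h : ∀ x ∈ w, ∃ l, ρ x = some l ∧ l ≠ .e) :
    drun n hn ρ (some (st n hn 0)) w = some (st n hn 0) := by
  induction w with
  | nil => rfl
  | cons x w ih =>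
    obtain ⟨l, hl, hle⟩ := h x (by simp)
    rw [drun_cons, drun_singleton _ hl, step_zero hn hle]
    exact ih fun y hy => h y (by simp [hy])

theorem drun_a_pow_zero (ha : ρ .a = some .a) (j : ℕ) :
    drun n hn ρ (some (st n hn 0)) (List.replicate j .a) = some (st n hn 0) :=
  drun_zero fun x hx => ⟨.a, by rw [List.eq_of_mem_replicate hx, ha], by simp⟩

theorem drun_const {k : Letter6} (hk : ρ k = some .e) (q : Fin n) :
    drun n hn ρ (some q) [k] = some (st n hn 1) := drun_singleton q hk

theorem drun_const_a_pow {k : Letter6} (h : HasADE ρ k) (q : Fin n) {i : ℕ} (hi : 1 ≤ i)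
    (hin : i < n) :
    drun n hn ρ (some q) (k :: List.replicate (i - 1) .a) = some (st n hn i) := by
  rw [drun_cons, drun_const h.k, drun_a_pow h.a le_rfl (by omega)]
  congr 2
  omega

/-- A word that takes every state other than the sink to the state `0`. -/
theorem drun_reset {k : Letter6} (h : HasADE ρ k) (q : Fin n) :
    drun n hn ρ (some q) (k :: List.replicate (n - 2) .a ++ [.d]) = some (st n hn 0) := by
  rw [drun_append]
  have := drun_const_a_pow (hn := hn) h q (i := n - 1) (by omega) (by omega)
  rw [show n - 1 - 1 = n - 2 by omega] at this
  rw [this, drun_d_last h.d]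

theorem exists_drun_eq {k : Letter6} (h : HasADE ρ k) (q r : Fin n) :
    ∃ w : List Letter6, (∀ x ∈ w, ρ x ≠ none) ∧ drun n hn ρ (some q) w = some r := by
  by_cases hr : r.val = 0
  · refine ⟨_, ?_, (drun_reset h q).trans ?_⟩
    · intro x hx
      simp only [List.cons_append, List.mem_cons, List.mem_append, List.mem_replicate,
        List.not_mem_nil, or_false] at hx
      rcases hx with rfl | ⟨_, rfl⟩ | rfl
      · simp [h.k]
      · simp [h.a]
      · simp [h.d]
    · congr 1
      exact Fin.ext hr.symm
  · refine ⟨_, ?_, drun_const_a_pow h q (i := r.val) (by omega) r.2⟩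
    intro x hx
    simp only [List.mem_cons, List.mem_replicate] at hx
    rcases hx with rfl | ⟨_, rfl⟩
    · simp [h.k]
    · simp [h.a]

/-- Powers of `a` act injectively, so only `i` arrives at n - 1; `d` moves no other state. -/
theorem exists_separating_a_d (ha : ρ .a = some .a) (hd : ρ .d = some .d)
    (heq : ∀ x, ρ x = some .d → x = .d) {i : ℕ} (hi : 1 ≤ i) (hin : i < n) {q : Option (Fin n)}
    (hq : q ≠ some (st n hn i)) (hq0 : q ≠ some (st n hn 0)) :
    drun n hn ρ q (List.replicate (n - 1 - i) .a ++ [.d]) ≠ some (st n hn 0) := by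
  have hinj := drun_injective (hn := hn) (ρ := ρ) (w := List.replicate (n - 1 - i) .a)
    (fun x hx => Or.inl (by rw [List.eq_of_mem_replicate hx, ha]))
  rw [drun_append, drun_d_of_ne hd]
  · exact drun_ne_zero heq (fun h => by simp [List.mem_replicate] at h) hq0
  · intro h
    exact hq (hinj (h.trans (drun_a_pow_last ha hi hin).symm))

theorem drun_a_d (ha : ρ .a = some .a) (hd : ρ .d = some .d) {i : ℕ} (hi : 1 ≤ i) (hin : i < n) :
    drun n hn ρ (some (st n hn i)) (List.replicate (n - 1 - i) .a ++ [.d]) =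
      some (st n hn 0) := by
  rw [drun_append, drun_a_pow_last ha hi hin, drun_d_last hd]

theorem exists_drun_distinguishing {k : Letter6} (h : HasADE ρ k) {p q : Fin n} (hpq : p ≠ q) :
    ∃ z, ¬ (drun n hn ρ (some p) z = some (st n hn 0) ↔
      drun n hn ρ (some q) z = some (st n hn 0)) := by
  by_cases hp : p = st n hn 0
  · refine ⟨[], ?_⟩
    simp only [drun, DFA.evalFrom_nil, Option.some.injEq, hp, true_iff]
    exact fun hq => hpq (hp.trans hq.symm)
  by_cases hq : q = st n hn 0
  · refine ⟨[], ?_⟩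
    simp only [drun, DFA.evalFrom_nil, Option.some.injEq, hq, iff_true]
    exact hp
  have hp0 : p.val ≠ 0 := fun e => hp (Fin.ext e)
  have := drun_a_d (hn := hn) h.a h.d (i := p.val) (by omega) p.2
  refine ⟨List.replicate (n - 1 - p.val) .a ++ [.d], fun e => ?_⟩
  refine exists_separating_a_d (hn := hn) h.a h.d h.eq_d (i := p.val) (by omega) p.2
    (q := some q) ?_ ?_ (e.1 this)
  · exact fun e => hpq (Option.some.inj e).symm
  · exact fun e => hq (Option.some.inj e)

/-- The DFA of a dialect, with another initial state. -/
def dialDFAFrom (n : ℕ) (hn : 4 ≤ n) (ρ : Letter6 → Option Letter5) (q : Fin n) :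
    DFA Letter6 (Option (Fin n)) := { dialDFA n hn ρ with start := some q }

theorem alph_dialDFAFrom {k : Letter6} (h : HasADE ρ k) (q : Fin n) :
    alph (dialDFAFrom n hn ρ q).accepts = {x | ρ x ≠ none} := by
  ext x
  constructor
  · rintro ⟨w, hw, hx⟩ hρ
    obtain ⟨u, v, rfl⟩ := List.append_of_mem hx
    have hw : drun n hn ρ (some q) (u ++ x :: v) = some (st n hn 0) := hw
    rw [drun_append, drun_cons] at hw
    have : drun n hn ρ (drun n hn ρ (some q) u) [x] = none := by
      cases drun n hn ρ (some q) u <;> simp [drun, dialDFA, hρ]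
    rw [this, drun_none] at hw
    simp at hw
  · intro hx
    obtain ⟨l, hl⟩ := Option.ne_none_iff_exists'.1 hx
    refine ⟨x :: (k :: List.replicate (n - 2) .a ++ [.d]), ?_, by simp⟩
    change drun n hn ρ (some q) _ = some (st n hn 0)
    rw [drun_cons, drun_singleton _ hl, drun_reset h]

theorem le_kappa_dialDFAFrom {k : Letter6} (h : HasADE ρ k) (q : Fin n) :
    (n : ℕ∞) ≤ kappa (dialDFAFrom n hn ρ q).accepts := by
  have card : (Set.range (some : Fin n → Option (Fin n))).encard = n := by
    rw [← Set.image_univ, (Option.some_injective _).injOn.encard_image]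
    simp
  rw [← card]
  refine encard_le_kappa_of_dfa _ _ ?_ ?_
  · rintro _ ⟨r, rfl⟩
    obtain ⟨w, hw, e⟩ := exists_drun_eq (hn := hn) h q r
    refine ⟨w, ?_, e⟩
    rw [IsWord, alph_dialDFAFrom h]
    exact hw
  · rintro _ ⟨p, rfl⟩ _ ⟨r, rfl⟩ hne
    exact exists_drun_distinguishing h fun e => hne (by rw [e])

theorem alph_dialDFA {k : Letter6} (h : HasADE ρ k) :
    alph (dialDFA n hn ρ).accepts = {x | ρ x ≠ none} := alph_dialDFAFrom h (st n hn 0)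

theorem exists_drun_eq_some {w : List Letter6} (hw : ∀ x ∈ w, ρ x ≠ none) (q : Fin n) :
    ∃ r, drun n hn ρ (some q) w = some r := by
  induction w generalizing q with
  | nil => exact ⟨q, rfl⟩
  | cons x w ih =>
    obtain ⟨l, hl⟩ := Option.ne_none_iff_exists'.1 (hw x (by simp))
    rw [drun_cons, drun_singleton _ hl]
    exact ih (fun y hy => hw y (by simp [hy])) _

theorem kappa_dialDFA {k : Letter6} (h : HasADE ρ k) : kappa (dialDFA n hn ρ).accepts = n := by
  refine le_antisymm ?_ (le_kappa_dialDFAFrom h (st n hn 0))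
  have card : (Set.univ : Set (Fin n)).encard = n := by simp
  rw [← card]
  refine kappa_le_encard _ (fun q => (dialDFA n hn ρ).acceptsFrom (some q)) fun w hw => ?_
  rw [IsWord, alph_dialDFA h] at hw
  obtain ⟨r, hr⟩ := exists_drun_eq_some hw (st n hn 0)
  refine ⟨r, trivial, ?_⟩
  rw [Language.leftQuotient_accepts_apply, ← hr]
  rfl

theorem kappa_quotient_dialDFA {k : Letter6} (hk : HasADE ρ k) {Q : Language Letter6}
    (hQ : Q ∈ quotients (dialDFA n hn ρ).accepts) : kappa Q = n := by
  refine le_antisymm ((kappa_quotient_le hQ).trans (kappa_dialDFA hk).le) ?_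
  obtain ⟨w, hw, rfl⟩ := hQ
  rw [IsWord, alph_dialDFA hk] at hw
  obtain ⟨r, hr⟩ := exists_drun_eq_some hw (st n hn 0)
  rw [Language.leftQuotient_accepts_apply]
  have e : (dialDFA n hn ρ).eval w = some r := hr
  rw [e]
  exact le_kappa_dialDFAFrom hk r

/-! ### Reversal, number of atoms and star of the dialects -/

theorem drun_a_pow_period (ha : ρ .a = some .a) (q : Fin n) :
    drun n hn ρ (some q) (List.replicate (n - 1) .a) = some q := by
  by_cases hq : q = st n hn 0
  · rw [hq]; exact drun_a_pow_zero ha _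
  have h0 : q.val ≠ 0 := fun e => hq (Fin.ext e)
  have hq2 := q.2
  have e : List.replicate (n - 1) Letter6.a =
      List.replicate (n - 1 - q.val) .a ++ (.a :: List.replicate (q.val - 1) .a) := by
    rw [← List.replicate_succ, List.replicate_append_replicate]
    congr 1
    omega
  have h1 := drun_a_pow_last (hn := hn) ha (i := q.val) (by omega) q.2
  rw [e, drun_append]
  have hq' : (some q : Option (Fin n)) = some (st n hn q.val q.2) := rfl
  rw [hq', h1, drun_cons, drun_singleton _ ha, step_a_last, drun_a_pow ha le_rfl (by omega)]
  congr 2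
  omega

/-- Rotate `i` to n - 1, apply `d`, and rotate on by `i` steps. The rotations add up to the full
period n - 1, so the other states return to their places. -/
theorem exists_drun_kill (ha : ρ .a = some .a) (hd : ρ .d = some .d) {i : Fin n}
    (hi0 : i ≠ st n hn 0) :
    ∃ w : List Letter6, (∀ x ∈ w, x = .a ∨ x = .d) ∧
      ∀ q, drun n hn ρ (some q) w = if q = i then some (st n hn 0) else some q := by
  have h0 : i.val ≠ 0 := fun e => hi0 (Fin.ext e)
  have hi2 := i.2
  refine ⟨List.replicate (n - 1 - i.val) .a ++ ([.d] ++ List.replicate i.val .a), ?_, ?_⟩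
  · intro x hx
    simp only [List.mem_append, List.mem_replicate, List.mem_singleton] at hx
    tauto
  · intro q
    have hlast := drun_a_pow_last (hn := hn) ha (i := i.val) (by omega) i.2
    rw [drun_append, drun_append]
    split_ifs with hq
    · have hq' : (some q : Option (Fin n)) = some (st n hn i.val i.2) := by rw [hq]
      rw [hq', hlast, drun_d_last hd, drun_a_pow_zero ha]
    · have hinj := drun_injective (hn := hn) (ρ := ρ) (w := List.replicate (n - 1 - i.val) .a)
        (fun x hx => Or.inl (by rw [List.eq_of_mem_replicate hx, ha]))
      rw [drun_d_of_ne hd, ← drun_append, List.replicate_append_replicate,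
        show n - 1 - i.val + i.val = n - 1 by omega, drun_a_pow_period ha]
      intro h
      exact hq (Option.some.inj (hinj (h.trans hlast.symm)))

theorem exists_drun_zero_iff {k : Letter6} (hk : HasADE ρ k) (X : Finset (Fin n)) :
    ∃ w : List Letter6, (∀ x ∈ w, ρ x ≠ none) ∧
      ∀ q, drun n hn ρ (some q) w = some (st n hn 0) ↔ q = st n hn 0 ∨ q ∈ X := by
  induction X using Finset.induction_on with
  | empty => exact ⟨[], by simp, fun q => by simp [drun]⟩
  | insert i X _ ih =>
    obtain ⟨w, hw, h⟩ := ih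
    by_cases hi : i = st n hn 0
    · refine ⟨w, hw, fun q => ?_⟩
      rw [h, Finset.mem_insert, hi]
      tauto
    · obtain ⟨v, hv, hv'⟩ := exists_drun_kill (hn := hn) hk.a hk.d hi
      refine ⟨v ++ w, ?_, fun q => ?_⟩
      · intro x hx
        rcases List.mem_append.1 hx with hx | hx
        · rcases hv x hx with rfl | rfl
          · simp [hk.a]
          · simp [hk.d]
        · exact hw x hx
      · rw [drun_append, hv', Finset.mem_insert]
        split_ifs with hq
        · rw [h]; simp [hq]
        · rw [h]; simp [hq]

/-- Words that distinguish the `2 ^ (n - 1) + 1` sets of states which can be the set of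
states from which a word is accepted. -/
theorem exists_words_topSets {k : Letter6} (hk : HasADE ρ k) :
    ∃ (G : Finset (Option (Finset (Fin n)))) (f : Option (Finset (Fin n)) → List Letter6),
      G.card = 2 ^ (n - 1) + 1 ∧ (∀ i, IsWord (dialDFA n hn ρ).accepts (f i)) ∧
      ∀ i ∈ G, ∀ j ∈ G, (∀ u, IsWord (dialDFA n hn ρ).accepts u →
        (u ++ f i ∈ (dialDFA n hn ρ).accepts ↔ u ++ f j ∈ (dialDFA n hn ρ).accepts)) → i = j := by
  have key : ∀ i : Option (Finset (Fin n)), ∃ w : List Letter6, (∀ x ∈ w, ρ x ≠ none) ∧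
      ∀ q, drun n hn ρ (some q) w = some (st n hn 0) ↔
        ∃ X, i = some X ∧ (q = st n hn 0 ∨ q ∈ X) := by
    rintro (_ | X)
    · refine ⟨[k], by simp [hk.k], fun q => ?_⟩
      rw [drun_const hk.k]
      simp
    · obtain ⟨w, hw, h⟩ := exists_drun_zero_iff (hn := hn) hk X
      exact ⟨w, hw, fun q => by simp [h]⟩
  choose f hfw hf using key
  refine ⟨(Finset.univ.erase (st n hn 0)).powerset.insertNone, f, ?_, ?_, ?_⟩
  · rw [Finset.card_insertNone, Finset.card_powerset, Finset.card_erase_of_mem (Finset.mem_univ _),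
      Finset.card_univ, Fintype.card_fin]
  · intro i
    rw [IsWord, alph_dialDFA hk]
    exact hfw i
  · intro i hi j hj h
    have h' : ∀ q : Fin n, (∃ X, i = some X ∧ (q = st n hn 0 ∨ q ∈ X)) ↔
        ∃ X, j = some X ∧ (q = st n hn 0 ∨ q ∈ X) := by
      intro q
      rw [← hf, ← hf]
      obtain ⟨u, hu, e⟩ := exists_drun_eq (hn := hn) hk (st n hn 0) q
      have := h u (by rw [IsWord, alph_dialDFA hk]; exact hu)
      change drun n hn ρ (some (st n hn 0)) _ = some (st n hn 0) ↔
        drun n hn ρ (some (st n hn 0)) _ = some (st n hn 0) at this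
      rwa [drun_append, drun_append, e] at this
    rcases i with _ | X <;> rcases j with _ | Y
    · rfl
    · simpa using h' (st n hn 0)
    · simpa using h' (st n hn 0)
    · have hX := Finset.mem_powerset.1 (Finset.some_mem_insertNone.1 hi)
      have hY := Finset.mem_powerset.1 (Finset.some_mem_insertNone.1 hj)
      congr 1
      ext q
      have := h' q
      simp only [Option.some.injEq, exists_eq_left'] at this
      constructor
      · intro hq
        exact (this.1 (Or.inr hq)).resolve_left (Finset.mem_erase.1 (hX hq)).1
      · intro hq
        exact (this.2 (Or.inr hq)).resolve_left (Finset.mem_erase.1 (hY hq)).1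

theorem alph_reverse {α : Type u} (K : Language α) : alph K.reverse = alph K := by
  ext x
  constructor
  · rintro ⟨w, hw, hx⟩
    exact ⟨w.reverse, hw, by simpa using hx⟩
  · rintro ⟨w, hw, hx⟩
    exact ⟨w.reverse, by rwa [Language.mem_reverse, List.reverse_reverse], by simpa using hx⟩

theorem le_kappa_reverse_dialDFA {k : Letter6} (hk : HasADE ρ k) :
    ((2 ^ (n - 1) + 1 : ℕ) : ℕ∞) ≤ kappa (dialDFA n hn ρ).accepts.reverse := by
  obtain ⟨G, f, hG, hw, hf⟩ := exists_words_topSets (hn := hn) hk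
  rw [← hG, ← Set.encard_coe_eq_coe_finsetCard]
  refine encard_le_kappa _ (fun i => (f i).reverse) ?_ ?_
  · intro i _
    rw [IsWord, alph_reverse]
    exact fun x hx => hw i x (List.mem_reverse.1 hx)
  · intro i hi j hj h
    refine hf i hi j hj fun u _ => ?_
    have := h u.reverse
    simpa [Language.mem_reverse] using this

theorem le_encard_atoms_dialDFA {k : Letter6} (hk : HasADE ρ k) :
    ((2 ^ (n - 1) + 1 : ℕ) : ℕ∞) ≤ (atoms (dialDFA n hn ρ).accepts).encard := by
  obtain ⟨G, f, hG, hw, hf⟩ := exists_words_topSets (hn := hn) hk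
  rw [← hG, ← Set.encard_coe_eq_coe_finsetCard]
  set K := (dialDFA n hn ρ).accepts
  refine Set.encard_le_encard_of_injOn (f := fun i => ({y : List Letter6 | IsWord K y ∧
    ∀ u, IsWord K u → (u ++ f i ∈ K ↔ u ++ y ∈ K)} : Set (List Letter6))) ?_ ?_
  · intro i _
    exact ⟨f i, hw i, rfl⟩
  · intro i hi j hj h
    refine hf i hi j hj ?_
    have : f j ∈ ({y : List Letter6 | IsWord K y ∧
        ∀ u, IsWord K u → (u ++ f i ∈ K ↔ u ++ y ∈ K)} : Set (List Letter6)) := by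
      simp only at h
      rw [h]
      exact ⟨hw j, fun u _ => Iff.rfl⟩
    exact this.2

theorem exists_prefix_mem_of_mem_kstar {α : Type u} {K : Language α} {x : List α} (hx : x ∈ K∗)
    (h : x ≠ []) : ∃ y, y ≠ [] ∧ y <+: x ∧ y ∈ K := by
  obtain ⟨S, rfl, hS⟩ := Language.mem_kstar_iff_exists_nonempty.1 hx
  cases S with
  | nil => simp at h
  | cons y S => exact ⟨y, (hS y (by simp)).2, by simp, (hS y (by simp)).1⟩

/-- State `q ≠ 0` is reached by the constant letter `k` followed by powers of `a`. A nonempty first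
factor of such a word must contain `d`, since only `d` returns to 0. In the test words `d` is the
last letter, so that factor is the whole word, and membership in the star reduces to membership in
the language. -/
theorem le_kappa_kstar_dialDFA {k : Letter6} (hk : HasADE ρ k) :
    (n : ℕ∞) ≤ kappa (dialDFA n hn ρ).accepts∗ := by
  set K := (dialDFA n hn ρ).accepts
  have card : (Set.univ : Set (Fin n)).encard = n := by simp
  rw [← card]
  have mem : ∀ w, w ∈ K ↔ drun n hn ρ (some (st n hn 0)) w = some (st n hn 0) := fun _ => Iff.rfl
  have sub : ∀ w ∈ K, w ∈ K∗ := fun w hw => ⟨[w], by simp, by simpa using hw⟩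
  have notMem : ∀ y : List Letter6, .d ∉ y → k :: y ∉ K := by
    intro y hy h
    rw [mem, drun_cons, drun_const hk.k] at h
    exact drun_ne_zero hk.eq_d hy (by simp) h
  have notMem' : ∀ y : List Letter6, .d ∉ y → k :: (y ++ [.d]) ∉ K → k :: (y ++ [.d]) ∉ K∗ := by
    intro y hy h h'
    obtain ⟨x, hx, hxp, hxK⟩ := exists_prefix_mem_of_mem_kstar h' (by simp)
    rw [← List.cons_append, List.prefix_concat_iff] at hxp
    rcases hxp with rfl | hxp
    · exact h hxK
    · cases x with
      | nil => exact hx rfl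
      | cons x z =>
        obtain ⟨rfl, hz⟩ := List.cons_prefix_cons.1 hxp
        exact notMem z (fun hd => hy (hz.subset hd)) hxK
  have notMem'' : ∀ y : List Letter6, .d ∉ y → k :: y ∉ K∗ := by
    intro y hy h'
    obtain ⟨x, hx, hxp, hxK⟩ := exists_prefix_mem_of_mem_kstar h' (by simp)
    cases x with
    | nil => exact hx rfl
    | cons x z =>
      obtain ⟨rfl, hz⟩ := List.cons_prefix_cons.1 hxp
      exact notMem z (fun hd => hy (hz.subset hd)) hxK
  have hdrep : ∀ j, Letter6.d ∉ List.replicate j Letter6.a := fun j h => by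
    simp [List.mem_replicate] at h
  let f : Fin n → List Letter6 := fun q =>
    if q.val = 0 then [] else k :: List.replicate (q.val - 1) .a
  have hf0 : ∀ q : Fin n, q.val = 0 → f q = [] := fun q h => by simp [f, h]
  have hf1 : ∀ q : Fin n, q.val ≠ 0 → f q = k :: List.replicate (q.val - 1) .a :=
    fun q h => by simp [f, h]
  refine encard_le_kappa _ f ?_ ?_
  · intro q _
    rw [IsWord, alph_kstar, alph_dialDFA hk]
    intro x hx
    by_cases hq : q.val = 0
    · simp [hf0 q hq] at hx
    · rw [hf1 q hq] at hx
      simp only [List.mem_cons, List.mem_replicate] at hx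
      rcases hx with rfl | ⟨_, rfl⟩
      · simp [hk.k]
      · simp [hk.a]
  · intro p _ q _ h
    by_contra hpq
    have hval : p.val ≠ q.val := fun e => hpq (Fin.ext e)
    by_cases hp : p.val = 0
    · have := (h []).1 (by rw [hf0 p hp]; exact Language.nil_mem_kstar _)
      rw [hf1 q (by omega), List.append_nil] at this
      exact notMem'' _ (hdrep _) this
    by_cases hq : q.val = 0
    · have := (h []).2 (by rw [hf0 q hq]; exact Language.nil_mem_kstar _)
      rw [hf1 p hp, List.append_nil] at this
      exact notMem'' _ (hdrep _) this
    have h1 := (h (List.replicate (n - 1 - p.val) .a ++ [.d])).1 (by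
      refine sub _ ?_
      rw [hf1 p hp, mem, drun_append, drun_const_a_pow hk _ (by omega) p.2,
        drun_a_d hk.a hk.d (by omega) p.2])
    rw [hf1 q hq, ← List.append_assoc, List.cons_append, List.cons_append] at h1
    refine notMem' _ ?_ ?_ h1
    · rw [List.mem_append]
      exact fun h => h.elim (hdrep _) (hdrep _)
    · rw [← List.cons_append, ← List.cons_append, List.append_assoc, mem, drun_append,
        drun_const_a_pow hk _ (by omega) q.2]
      refine exists_separating_a_d hk.a hk.d hk.eq_d (by omega) p.2 ?_ ?_
      · simp only [ne_eq, Option.some.injEq, Fin.mk.injEq]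
        exact fun e => hval e.symm
      · simp only [ne_eq, Option.some.injEq, Fin.mk.injEq]
        exact hq

end Dialects


/-! ### A DFA for the product with a suffix-closed language -/

open Classical in
/-- A DFA for the product of two languages that contain the empty word, the second of which is
suffix-closed. -/
noncomputable def mulDFA {α : Type u} {σ : Type v} {τ : Type w} (A : DFA α σ) (B : DFA α τ) :
    DFA α (σ × τ) where
  step s x := (A.step s.1 x, if A.step s.1 x ∈ A.accept then B.start else B.step s.2 x)
  start := (A.start, B.start)
  accept := {s | s.2 ∈ B.accept}

open Classical in
-- The second component is the state of the remainder `R` in `exists_leftQuotient_mul`: it is reset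
-- to the start whenever the first component accepts. Suffix-closedness ensures that the reset loses
-- no words.
theorem accepts_mulDFA {α : Type u} {σ : Type v} {τ : Type w} (A : DFA α σ) (B : DFA α τ)
    (hA : A.start ∈ A.accept) (hB : B.start ∈ B.accept) (hsc : IsSuffixClosed B.accepts) :
    (mulDFA A B).accepts = A.accepts * B.accepts := by
  have key : ∀ w : List α, ((mulDFA A B).eval w).1 = A.eval w ∧
      (∃ v, ((mulDFA A B).eval w).2 = B.eval v) ∧
      (A.eval w ∈ A.accept → ((mulDFA A B).eval w).2 = B.start) ∧
      (A.accepts * B.accepts).leftQuotient w =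
        A.accepts.leftQuotient w * B.accepts + B.acceptsFrom ((mulDFA A B).eval w).2 := by
    intro w
    induction w using List.reverseRecOn with
    | nil =>
      refine ⟨rfl, ⟨[], rfl⟩, fun _ => rfl, ?_⟩
      ext z
      refine ⟨fun hz => Or.inl hz, ?_⟩
      rintro (hz | hz)
      · exact hz
      · exact ⟨[], hA, z, hz, rfl⟩
    | append_singleton w x ih =>
      obtain ⟨ih1, ⟨v, hv⟩, ih3, ih4⟩ := ih
      have e1 : (mulDFA A B).eval (w ++ [x]) = (A.eval (w ++ [x]),
          if A.eval (w ++ [x]) ∈ A.accept then B.start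
          else B.step ((mulDFA A B).eval w).2 x) := by
        rw [DFA.eval_append_singleton, DFA.eval_append_singleton, ← ih1]
        rfl
      have main : (A.accepts * B.accepts).leftQuotient (w ++ [x]) =
          A.accepts.leftQuotient (w ++ [x]) * B.accepts +
            B.acceptsFrom (B.step ((mulDFA A B).eval w).2 x) := by
        rw [Language.leftQuotient_append, ih4, Language.leftQuotient_append]
        ext z
        change (x :: z ∈ A.accepts.leftQuotient w * B.accepts ∨
          x :: z ∈ B.acceptsFrom ((mulDFA A B).eval w).2) ↔ _
        rw [cons_mem_mul, Language.mem_add]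
        constructor
        · rintro ((hz | hz) | hz)
          · exact Or.inl hz
          · rw [ih3 (by simpa [DFA.mem_accepts] using hz.1)]; exact Or.inr hz.2
          · exact Or.inr hz
        · rintro (hz | hz)
          · exact Or.inl (Or.inl hz)
          · exact Or.inr hz
      rw [e1]
      refine ⟨rfl, ?_, fun h => if_pos h, ?_⟩
      · by_cases h : A.eval (w ++ [x]) ∈ A.accept
        · exact ⟨[], if_pos h⟩
        · refine ⟨v ++ [x], ?_⟩
          rw [B.eval_append_singleton v x, ← hv]
          exact if_neg h
      · rw [main]
        by_cases h : A.eval (w ++ [x]) ∈ A.accept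
        · simp only [if_pos h]
          ext z
          rw [Language.mem_add, Language.mem_add]
          have h0 : [] ∈ A.accepts.leftQuotient (w ++ [x]) := by
            rw [Language.mem_leftQuotient, List.append_nil]; exact h
          refine or_congr_right' fun hz => ⟨fun hz' => ?_, fun hz' =>
            absurd ⟨[], h0, z, hz', rfl⟩ hz⟩
          rw [hv, ← DFA.eval_append_singleton, ← Language.leftQuotient_accepts_apply] at hz'
          exact hsc.leftQuotient_subset hz'
        · simp only [if_neg h]
  ext w
  obtain ⟨h1, -, h3, h4⟩ := key w
  have : w ∈ A.accepts * B.accepts ↔ [] ∈ (A.accepts * B.accepts).leftQuotient w := by simp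
  rw [this, h4, Language.mem_add]
  change ((mulDFA A B).eval w).2 ∈ B.accept ↔ _ ∨ ((mulDFA A B).eval w).2 ∈ B.accept
  refine ⟨Or.inr, ?_⟩
  rintro (⟨a, ha, b, hb, e⟩ | h)
  · obtain ⟨rfl, rfl⟩ := List.append_eq_nil_iff.1 e
    have ha : w ++ [] ∈ A.accepts := ha
    rw [List.append_nil] at ha
    rw [h3 ha]
    exact hB
  · exact h

/-! ### Pairs of dialects with the roles of two letters exchanged -/

/-- The letter `t` acts as a transposition in the first dialect and as a constant map in the second,
and conversely for `k`. -/
structure IsPair (ρ₁ ρ₂ : Letter6 → Option Letter5) (t k : Letter6) : Prop where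
  fst : HasADE ρ₁ k
  snd : HasADE ρ₂ t
  t_fst : ρ₁ t = some .b
  k_snd : ρ₂ k = some .b

theorem IsPair.symm {ρ₁ ρ₂ : Letter6 → Option Letter5} {t k : Letter6} (P : IsPair ρ₁ ρ₂ t k) :
    IsPair ρ₂ ρ₁ k t := ⟨P.snd, P.fst, P.k_snd, P.t_fst⟩

section Pairs

variable {n : ℕ} {hn : 4 ≤ n} {ρ₁ ρ₂ : Letter6 → Option Letter5} {t k : Letter6}

theorem drun_swap_swap {ρ : Letter6 → Option Letter5} (ht : ρ t = some .b) (q : Option (Fin n)) :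
    drun n hn ρ q [t, t] = q := by
  cases q with
  | none => exact drun_none _
  | some q =>
    rw [drun_cons, drun_singleton _ ht, drun_singleton _ ht]
    simp [step]

theorem drun_const_ne_zero {ρ : Letter6 → Option Letter5} (hk : ρ k = some .e)
    (q : Option (Fin n)) : drun n hn ρ q [k] ≠ some (st n hn 0) := by
  cases q with
  | none => rw [drun_none]; simp
  | some q => rw [drun_const hk]; simp

theorem drun_const_d_ne_zero {ρ : Letter6 → Option Letter5} (hk : HasADE ρ k)
    (q : Option (Fin n)) : drun n hn ρ q [k, .d] ≠ some (st n hn 0) := by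
  cases q with
  | none => rw [drun_none]; simp
  | some q =>
    rw [drun_cons, drun_const hk.k, drun_d_of_ne hk.d]
    · simp
    · simp only [ne_eq, Option.some.injEq, Fin.mk.injEq]
      omega

theorem step_a_ne_self {q : Fin n} (hq : q ≠ st n hn 0) : step n hn q .a ≠ q := by
  have hq0 : q.val ≠ 0 := fun e => hq (Fin.ext e)
  intro h
  have h := congrArg Fin.val h
  simp only [step, hq0, dite_false] at h
  split_ifs at h
  · simp at h
  · simp only at h; omega

theorem IsPair.drun_k_zero (P : IsPair ρ₁ ρ₂ t k) :
    drun n hn ρ₂ (some (st n hn 0)) [k] = some (st n hn 0) :=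
  drun_zero fun x hx => ⟨.b, by rw [List.mem_singleton.1 hx, P.k_snd], by simp⟩

theorem IsPair.drun_t_zero (P : IsPair ρ₁ ρ₂ t k) :
    drun n hn ρ₁ (some (st n hn 0)) [t] = some (st n hn 0) :=
  P.symm.drun_k_zero

variable {m : ℕ} {hm : 4 ≤ m}

/-- Two different states of the first DFA other than `0` can be separated while the second DFA stays
out of its state `0`. -/
theorem IsPair.exists_separating_of_ne_zero (P : IsPair ρ₁ ρ₂ t k) {p p' : Option (Fin m)}
    (hpp : p ≠ p') (hp : p ≠ some (st m hm 0)) (hp' : p' ≠ some (st m hm 0)) :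
    ∃ w : List Letter6, (∀ x ∈ w, x = .a ∨ x = t) ∧
      ((drun m hm ρ₁ p (w ++ [.d]) = some (st m hm 0) ∧
          drun m hm ρ₁ p' (w ++ [.d]) ≠ some (st m hm 0)) ∨
        (drun m hm ρ₁ p' (w ++ [.d]) = some (st m hm 0) ∧
          drun m hm ρ₁ p (w ++ [.d]) ≠ some (st m hm 0))) ∧
      ∀ q, drun n hn ρ₂ q (w ++ [.d]) ≠ some (st n hn 0) := by
  wlog hsome : ∃ i : Fin m, p = some i generalizing p p'
  · have hnone : p = none := by
      cases p with
      | none => rfl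
      | some i => exact absurd ⟨i, rfl⟩ hsome
    have hsome' : ∃ i : Fin m, p' = some i := by
      cases p' with
      | none => exact absurd hnone hpp
      | some i => exact ⟨i, rfl⟩
    obtain ⟨w, h1, h2, h3⟩ := this hpp.symm hp' hp hsome'
    exact ⟨w, h1, h2.symm, h3⟩
  obtain ⟨i, rfl⟩ := hsome
  have hi0 : i.val ≠ 0 := fun e => hp (by rw [Fin.ext (a := i) (b := st m hm 0) e])
  have tt : ∀ q : Option (Fin m), drun m hm ρ₁ q ([t, t] ++ [.d]) = drun m hm ρ₁ q [.d] := by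
    intro q
    rw [drun_append, drun_swap_swap P.t_fst]
  -- The inserted tt is the identity in the first automaton. In the second, `t` is constant with
  -- value 1, which the following `d` does not move, so 0 is avoided.
  refine ⟨List.replicate (m - 1 - i.val) .a ++ [t, t], ?_, Or.inl ⟨?_, ?_⟩, ?_⟩
  · intro x hx
    simp only [List.mem_append, List.mem_replicate, List.mem_cons, List.not_mem_nil, or_false] at hx
    tauto
  · rw [List.append_assoc, drun_append, tt, ← drun_append]
    exact drun_a_d P.fst.a P.fst.d (by omega) i.2
  · rw [List.append_assoc, drun_append, tt, ← drun_append]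
    exact exists_separating_a_d P.fst.a P.fst.d P.fst.eq_d (by omega) i.2 hpp.symm hp'
  · intro q
    have e : List.replicate (m - 1 - i.val) Letter6.a ++ [t, t] ++ [.d] =
        (List.replicate (m - 1 - i.val) Letter6.a ++ [t]) ++ [t, .d] := by simp
    rw [e, drun_append]
    exact drun_const_d_ne_zero P.snd _

theorem IsPair.exists_separating (P : IsPair ρ₁ ρ₂ t k) {p p' : Option (Fin m)} (hpp : p ≠ p') :
    ∃ w : List Letter6, (∀ x ∈ w, x = .a ∨ x = .d ∨ x = t) ∧
      ((drun m hm ρ₁ p w = some (st m hm 0) ∧ drun m hm ρ₁ p' w ≠ some (st m hm 0)) ∨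
        (drun m hm ρ₁ p' w = some (st m hm 0) ∧ drun m hm ρ₁ p w ≠ some (st m hm 0))) ∧
      ∀ q, drun n hn ρ₂ q w ≠ some (st n hn 0) := by
  have h0 : drun m hm ρ₁ (some (st m hm 0)) [t] = some (st m hm 0) :=
    drun_zero fun x hx => ⟨.b, by rw [List.mem_singleton.1 hx, P.t_fst], by simp⟩
  have hne : ρ₁ t ≠ some .d := by rw [P.t_fst]; simp
  by_cases hp : p = some (st m hm 0)
  · refine ⟨[t], by simp, Or.inl ⟨by rw [hp, h0], ?_⟩, drun_const_ne_zero P.snd.k⟩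
    exact drun_singleton_ne_zero hne fun e => hpp (hp.trans e.symm)
  by_cases hp' : p' = some (st m hm 0)
  · refine ⟨[t], by simp, Or.inr ⟨by rw [hp', h0], ?_⟩, drun_const_ne_zero P.snd.k⟩
    exact drun_singleton_ne_zero hne hp
  obtain ⟨w, h1, h2, h3⟩ := P.exists_separating_of_ne_zero (hn := hn) hpp hp hp'
  refine ⟨w ++ [.d], ?_, h2, h3⟩
  intro x hx
  rcases List.mem_append.1 hx with hx | hx
  · rcases h1 x hx with h | h <;> simp [h]
  · simp [List.mem_singleton.1 hx]

/-- The suffix t a^(n-2) d resets the second automaton to 0. In the first, the part before `d` is a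
permutation fixing 0, so `r` is in danger only if it stands at m - 1 just before `d`; varying `u`
prevents this. -/
theorem IsPair.exists_both_zero (P : IsPair ρ₁ ρ₂ t k) {r : Option (Fin m)}
    (hr : r ≠ some (st m hm 0)) :
    ∃ w : List Letter6, drun m hm ρ₁ (some (st m hm 0)) w = some (st m hm 0) ∧
      drun m hm ρ₁ r w ≠ some (st m hm 0) ∧
      ∀ q : Fin n, drun n hn ρ₂ (some q) w = some (st n hn 0) := by
  let V : List Letter6 → List Letter6 := fun u => [t] ++ u ++ ([t] ++ List.replicate (n - 2) .a)
  have good : ∀ u : List Letter6, (∀ x ∈ u, x = .a) → ∀ x ∈ V u, x = .a ∨ x = t := by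
    intro u hu x hx
    simp only [V, List.mem_append, List.mem_singleton, List.mem_replicate] at hx
    rcases hx with (h | h) | h | h
    exacts [Or.inr h, Or.inl (hu x h), Or.inr h, Or.inl h.2]
  have hinj : ∀ w : List Letter6, (∀ x ∈ w, x = .a ∨ x = t) →
      Function.Injective fun q => drun m hm ρ₁ q w := fun w hw => drun_injective fun x hx => by
    rcases hw x hx with rfl | rfl
    exacts [Or.inl P.fst.a, Or.inr P.t_fst]
  have hzero : ∀ w : List Letter6, (∀ x ∈ w, x = .a ∨ x = t) →
      drun m hm ρ₁ (some (st m hm 0)) w = some (st m hm 0) := fun w hw => drun_zero fun x hx => by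
    rcases hw x hx with rfl | rfl
    exacts [⟨.a, P.fst.a, by simp⟩, ⟨.b, P.t_fst, by simp⟩]
  -- One of `[]` and `[.a]` works: if both led `r` to m - 1, injectivity of the rest would make `a`
  -- fix a nonzero state.
  obtain ⟨u, hu, hlast⟩ : ∃ u : List Letter6, (∀ x ∈ u, x = .a) ∧
      drun m hm ρ₁ r (V u) ≠ some (st m hm (m - 1)) := by
    by_contra! hcon
    have h1 := hcon [] (by simp)
    have h2 := hcon [.a] (by simp)
    have tail : ∀ x ∈ [t] ++ List.replicate (n - 2) Letter6.a, x = .a ∨ x = t := by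
      intro x hx
      simp only [List.mem_append, List.mem_singleton, List.mem_replicate] at hx
      tauto
    have h3 := h1.trans h2.symm
    simp only [V] at h3
    rw [drun_append, drun_append (z := [t] ++ _) (w := [t] ++ [Letter6.a])] at h3
    have h4 := hinj _ tail h3
    rw [List.append_nil, drun_append] at h4
    have hs : drun m hm ρ₁ r [t] ≠ some (st m hm 0) :=
      drun_singleton_ne_zero (by rw [P.t_fst]; simp) hr
    cases h5 : drun m hm ρ₁ r [t] with
    | none =>
      simp only [V] at h1
      rw [List.append_nil, drun_append, h5, drun_none] at h1
      simp at h1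
    | some s =>
      rw [h5] at hs h4
      rw [drun_singleton _ P.fst.a] at h4
      exact step_a_ne_self (fun e => hs (by rw [e])) (Option.some.inj h4).symm
  refine ⟨V u ++ [.d], ?_, ?_, ?_⟩
  · rw [drun_append, hzero _ (good u hu), drun_d_of_ne P.fst.d]
    simp only [ne_eq, Option.some.injEq, Fin.mk.injEq]
    omega
  · rw [drun_append, drun_d_of_ne P.fst.d hlast]
    refine fun h => hr (hinj _ (good u hu) (h.trans (hzero _ (good u hu)).symm))
  · intro q
    obtain ⟨r, hr⟩ := exists_drun_eq_some (hn := hn) (ρ := ρ₂) (w := [t] ++ u) (fun x hx => by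
      rcases List.mem_append.1 hx with hx | hx
      · rw [List.mem_singleton.1 hx, P.snd.k]; simp
      · rw [hu x hx, P.snd.a]; simp) q
    have e : V u ++ [.d] = ([t] ++ u) ++ (t :: List.replicate (n - 2) .a ++ [.d]) := by
      simp [V]
    rw [e, drun_append, hr, drun_reset P.snd]

theorem IsPair.ne_d_of_mem (P : IsPair ρ₁ ρ₂ t k) {w : List Letter6}
    (hw : ∀ x ∈ w, x = .a ∨ x = t) : .d ∉ w := fun h => by
  rcases hw _ h with h | h
  · simp at h
  · exact P.snd.k_ne_d h

/-- Reachability in the direct product, starting from the states `1` and `0`. -/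
theorem IsPair.exists_reach (P : IsPair ρ₁ ρ₂ t k) {p : Fin m} (hp : p ≠ st m hm 0) (q : Fin n) :
    ∃ w : List Letter6, (∀ x ∈ w, x = .a ∨ x = t) ∧
      drun m hm ρ₁ (some (st m hm 1)) w = some p ∧
      drun n hn ρ₂ (some (st n hn 0)) w = some q := by
  have pow : ∀ p : Fin m, p ≠ st m hm 0 →
      drun m hm ρ₁ (some (st m hm 1)) (List.replicate (p.val - 1) .a) = some p := by
    intro p hp
    have hp0 : p.val ≠ 0 := fun e => hp (Fin.ext e)
    have hp2 := p.2
    rw [drun_a_pow P.fst.a le_rfl (by omega)]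
    congr 1
    apply Fin.ext
    simp only
    omega
  by_cases hq : q = st n hn 0
  · refine ⟨List.replicate (p.val - 1) .a, fun x hx => Or.inl (List.eq_of_mem_replicate hx),
      pow p hp, ?_⟩
    rw [hq, drun_a_pow_zero P.snd.a]
  · have hq0 : q.val ≠ 0 := fun e => hq (Fin.ext e)
    -- In the second automaton `u` leads to `q` from any state other than the sink. In the first it
    -- is a permutation, so one aims for the preimage `s` of `p`; the powers of `a` that reach `s`
    -- leave the second component at 0.
    set u := t :: List.replicate (q.val - 1) Letter6.a with hu
    have hul : ∀ x ∈ u, x = .a ∨ x = t := by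
      intro x hx
      simp only [hu, List.mem_cons, List.mem_replicate] at hx
      tauto
    have hinj : Function.Injective fun q => drun m hm ρ₁ q u := drun_injective fun x hx => by
      rcases hul x hx with rfl | rfl
      exacts [Or.inl P.fst.a, Or.inr P.t_fst]
    obtain ⟨s, hs⟩ := Finite.injective_iff_surjective.1 hinj (some p)
    simp only at hs
    have hs0 : s ≠ some (st m hm 0) := by
      rintro rfl
      rw [drun_zero fun x hx => by
        rcases hul x hx with rfl | rfl
        exacts [⟨.a, P.fst.a, by simp⟩, ⟨.b, P.t_fst, by simp⟩]] at hs
      exact hp (Option.some.inj hs).symm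
    cases s with
    | none => rw [drun_none] at hs; simp at hs
    | some s =>
      have hs0 : s ≠ st m hm 0 := fun e => hs0 (by rw [e])
      refine ⟨List.replicate (s.val - 1) .a ++ u, ?_, ?_, ?_⟩
      · intro x hx
        rcases List.mem_append.1 hx with hx | hx
        · exact Or.inl (List.eq_of_mem_replicate hx)
        · exact hul x hx
      · rw [drun_append, pow s hs0, hs]
      · rw [drun_append, drun_a_pow_zero P.snd.a]
        exact drun_const_a_pow P.snd _ (by omega) q.2

end Pairs


/-! ### Boolean operations on pairs of dialects: lower bounds -/

/-- The direct product of the DFAs of two dialects, for a boolean operation. -/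
def boolDFA (op : Prop → Prop → Prop) (m n : ℕ) (hm : 4 ≤ m) (hn : 4 ≤ n)
    (ρ₁ ρ₂ : Letter6 → Option Letter5) : DFA Letter6 (Option (Fin m) × Option (Fin n)) where
  step s x := ((dialDFA m hm ρ₁).step s.1 x, (dialDFA n hn ρ₂).step s.2 x)
  start := (some (st m hm 0), some (st n hn 0))
  accept := {s | op (s.1 = some (st m hm 0)) (s.2 = some (st n hn 0))}

theorem encard_range_some (n : ℕ) : (Set.range (some : Fin n → Option (Fin n))).encard = n := by
  rw [← Set.image_univ, (Option.some_injective _).injOn.encard_image]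
  simp

theorem encard_univ_option (n : ℕ) : (Set.univ : Set (Option (Fin n))).encard = n + 1 := by
  simp [Set.encard_univ]

theorem drun_d_zero {n : ℕ} {hn : 4 ≤ n} {ρ : Letter6 → Option Letter5} (hd : ρ .d = some .d) :
    drun n hn ρ (some (st n hn 0)) [.d] = some (st n hn 0) :=
  drun_zero fun x hx => ⟨.d, by rw [List.mem_singleton.1 hx, hd], by simp⟩

theorem drun_eq_none {n : ℕ} {hn : 4 ≤ n} {ρ : Letter6 → Option Letter5} {x : Letter6} (hx : ρ x = none)
    (q : Option (Fin n)) : drun n hn ρ q [x] = none := by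
  cases q <;> simp [drun, dialDFA, hx]

theorem drun_c_zero {n : ℕ} {hn : 4 ≤ n} {ρ : Letter6 → Option Letter5} {x : Letter6} (hx : ρ x = some .c) :
    drun n hn ρ (some (st n hn 0)) [x] = some (st n hn 0) :=
  drun_zero fun y hy => ⟨.c, by rw [List.mem_singleton.1 hy, hx], by simp⟩

/-- The states `(p, q)` and `(p', q')` of the direct product are distinguishable. -/
def BoolDist (op : Prop → Prop → Prop) (m n : ℕ) (hm : 4 ≤ m) (hn : 4 ≤ n)
    (ρ₁ ρ₂ : Letter6 → Option Letter5) (p p' : Option (Fin m)) (q q' : Option (Fin n)) : Prop :=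
  ∃ z, ¬ (op (drun m hm ρ₁ p z = some (st m hm 0)) (drun n hn ρ₂ q z = some (st n hn 0)) ↔
    op (drun m hm ρ₁ p' z = some (st m hm 0)) (drun n hn ρ₂ q' z = some (st n hn 0)))

section Booleans

variable {m n : ℕ} {hm : 4 ≤ m} {hn : 4 ≤ n} {ρ₁ ρ₂ : Letter6 → Option Letter5} {t k : Letter6}
  {op : Prop → Prop → Prop}

theorem evalFrom_boolDFA (s : Option (Fin m) × Option (Fin n)) (w : List Letter6) :
    (boolDFA op m n hm hn ρ₁ ρ₂).evalFrom s w = (drun m hm ρ₁ s.1 w, drun n hn ρ₂ s.2 w) := by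
  induction w generalizing s with
  | nil => rfl
  | cons x w ih => exact ih _

/-- The first components are separated while the second ones are kept off 0, so only `op _ False` is
tested. The variant below ends with both second components at 0 and tests `op _ True`; for that they
must not be the sink. -/
theorem IsPair.boolDist (P : IsPair ρ₁ ρ₂ t k) (hop : ¬ (op True False ↔ op False False))
    {p p' : Option (Fin m)} (hpp : p ≠ p') (q q' : Option (Fin n)) :
    BoolDist op m n hm hn ρ₁ ρ₂ p p' q q' := by
  obtain ⟨w, -, h, h3⟩ := P.exists_separating (hm := hm) (hn := hn) hpp
  refine ⟨w, ?_⟩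
  rw [eq_false (h3 q), eq_false (h3 q')]
  rcases h with ⟨h1, h2⟩ | ⟨h1, h2⟩
  · rwa [eq_true h1, eq_false h2]
  · rwa [eq_true h1, eq_false h2, Iff.comm]

theorem IsPair.boolDist_some (P : IsPair ρ₁ ρ₂ t k) (hop : ¬ (op True True ↔ op False True))
    {p p' : Option (Fin m)} (hpp : p ≠ p') (q q' : Fin n) :
    BoolDist op m n hm hn ρ₁ ρ₂ p p' (some q) (some q') := by
  obtain ⟨w, hw, h, -⟩ := P.exists_separating (hm := hm) (hn := hn) hpp
  have hw' : ∀ x ∈ w, ρ₂ x ≠ none := by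
    intro x hx
    rcases hw x hx with rfl | rfl | rfl
    · simp [P.snd.a]
    · simp [P.snd.d]
    · simp [P.snd.k]
  obtain ⟨r, hr⟩ := exists_drun_eq_some (hn := hn) hw' q
  obtain ⟨r', hr'⟩ := exists_drun_eq_some (hn := hn) hw' q'
  rcases h with ⟨h1, h2⟩ | ⟨h1, h2⟩
  · obtain ⟨v, h3, h4, h5⟩ := P.exists_both_zero (hn := hn) h2
    refine ⟨w ++ v, ?_⟩
    rw [drun_append, drun_append, drun_append, drun_append, h1, hr, hr', eq_true h3, eq_false h4,
      eq_true (h5 r), eq_true (h5 r')]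
    exact hop
  · obtain ⟨v, h3, h4, h5⟩ := P.exists_both_zero (hn := hn) h2
    refine ⟨w ++ v, ?_⟩
    rw [drun_append, drun_append, drun_append, drun_append, h1, hr, hr', eq_true h3, eq_false h4,
      eq_true (h5 r), eq_true (h5 r'), Iff.comm]
    exact hop

theorem IsPair.boolDist_snd (P : IsPair ρ₁ ρ₂ t k) (hop : ¬ (op False True ↔ op False False))
    (p p' : Option (Fin m)) {q q' : Option (Fin n)} (hqq : q ≠ q') :
    BoolDist op m n hm hn ρ₁ ρ₂ p p' q q' :=
  P.symm.boolDist (op := fun x y => op y x) hop hqq p p'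

theorem IsPair.boolDist_some_snd (P : IsPair ρ₁ ρ₂ t k) (hop : ¬ (op True True ↔ op True False))
    (p p' : Fin m) {q q' : Option (Fin n)} (hqq : q ≠ q') :
    BoolDist op m n hm hn ρ₁ ρ₂ (some p) (some p') q q' :=
  P.symm.boolDist_some (op := fun x y => op y x) hop hqq p p'

/-- After `x`, the word `R` resets the first automaton to 0. Continuing with `t` keeps it there and
takes the second off 0; continuing with t a^(n-2) d brings the second to 0 as well. -/
theorem IsPair.mem_alph_bool (P : IsPair ρ₁ ρ₂ t k) {J : Language Letter6}
    (hJ : ∀ z, z ∈ J ↔ op (z ∈ (dialDFA m hm ρ₁).accepts) (z ∈ (dialDFA n hn ρ₂).accepts))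
    (hop : op True False ∨ op True True) {x : Letter6} (h1 : ρ₁ x ≠ none) (h2 : ρ₂ x ≠ none) :
    x ∈ alph J := by
  obtain ⟨l₁, hl₁⟩ := Option.ne_none_iff_exists'.1 h1
  obtain ⟨l₂, hl₂⟩ := Option.ne_none_iff_exists'.1 h2
  set R := k :: List.replicate (m - 2) Letter6.a ++ [.d] with hR
  have hR1 : drun m hm ρ₁ (some (st m hm 0)) (x :: R) = some (st m hm 0) := by
    rw [drun_cons, drun_singleton _ hl₁, drun_reset P.fst]
  obtain ⟨r, hr⟩ := exists_drun_eq_some (hn := hn) (ρ := ρ₂) (w := x :: R) (by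
    intro y hy
    simp only [hR, List.mem_cons, List.mem_append, List.mem_replicate, List.not_mem_nil,
      or_false] at hy
    rcases hy with rfl | (rfl | ⟨-, rfl⟩) | rfl
    · exact h2
    · simp [P.k_snd]
    · simp [P.snd.a]
    · simp [P.snd.d]) (st n hn 0)
  have mem1 : ∀ w, w ∈ (dialDFA m hm ρ₁).accepts ↔
      drun m hm ρ₁ (some (st m hm 0)) w = some (st m hm 0) := fun _ => Iff.rfl
  have mem2 : ∀ w, w ∈ (dialDFA n hn ρ₂).accepts ↔
      drun n hn ρ₂ (some (st n hn 0)) w = some (st n hn 0) := fun _ => Iff.rfl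
  rcases hop with hop | hop
  · refine ⟨x :: R ++ [t], ?_, by simp⟩
    rw [hJ, mem1, mem2, drun_append, drun_append, hR1, hr, eq_true P.drun_t_zero,
      eq_false (drun_const_ne_zero P.snd.k _)]
    exact hop
  · refine ⟨x :: R ++ (t :: List.replicate (n - 2) .a ++ [.d]), ?_, by simp⟩
    have h : drun m hm ρ₁ (some (st m hm 0)) (t :: List.replicate (n - 2) .a ++ [.d]) =
        some (st m hm 0) := by
      rw [drun_append, drun_cons (z := List.replicate _ _), P.drun_t_zero,
        drun_a_pow_zero P.fst.a, drun_d_zero P.fst.d]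
    rw [hJ, mem1, mem2, drun_append _ (x :: R), drun_append _ (x :: R), hR1, hr, eq_true h, eq_true (drun_reset P.snd r)]
    exact hop

theorem IsPair.exists_reach_start (P : IsPair ρ₁ ρ₂ t k) (p : Fin m) (q : Fin n) :
    ∃ w : List Letter6, (∀ x ∈ w, ρ₁ x ≠ none ∧ ρ₂ x ≠ none) ∧
      drun m hm ρ₁ (some (st m hm 0)) w = some p ∧
      drun n hn ρ₂ (some (st n hn 0)) w = some q := by
  have hal : ∀ x, x = .a ∨ x = t → ρ₁ x ≠ none ∧ ρ₂ x ≠ none := by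
    rintro x (rfl | rfl)
    · simp [P.fst.a, P.snd.a]
    · simp [P.t_fst, P.snd.k]
  by_cases hp : p = st m hm 0
  · subst hp
    by_cases hq : q = st n hn 0
    · subst hq
      exact ⟨[], by simp, rfl, rfl⟩
    · have hq0 : q.val ≠ 0 := fun e => hq (Fin.ext e)
      refine ⟨t :: List.replicate (q.val - 1) .a, fun x hx => hal x ?_, ?_,
        drun_const_a_pow P.snd _ (by omega) q.2⟩
      · simp only [List.mem_cons, List.mem_replicate] at hx
        tauto
      · rw [drun_cons, P.drun_t_zero, drun_a_pow_zero P.fst.a]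
  · obtain ⟨w, hw, h1, h2⟩ := P.exists_reach (hn := hn) hp q
    refine ⟨k :: w, ?_, ?_, ?_⟩
    · intro x hx
      rcases List.mem_cons.1 hx with rfl | hx
      · simp [P.k_snd, P.fst.k]
      · exact hal x (hw x hx)
    · rw [drun_cons, drun_const P.fst.k, h1]
    · rw [drun_cons, P.drun_k_zero, h2]

theorem encard_le_kappa_bool {J : Language Letter6}
    (hJ : ∀ z, z ∈ J ↔ op (z ∈ (dialDFA m hm ρ₁).accepts) (z ∈ (dialDFA n hn ρ₂).accepts))
    (S : Set (Option (Fin m) × Option (Fin n)))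
    (reach : ∀ s ∈ S, ∃ w, IsWord J w ∧ drun m hm ρ₁ (some (st m hm 0)) w = s.1 ∧
      drun n hn ρ₂ (some (st n hn 0)) w = s.2)
    (dist : ∀ s ∈ S, ∀ s' ∈ S, s ≠ s' → BoolDist op m n hm hn ρ₁ ρ₂ s.1 s'.1 s.2 s'.2) :
    S.encard ≤ kappa J := by
  have e : J = (boolDFA op m n hm hn ρ₁ ρ₂).accepts := by
    ext z
    rw [hJ]
    change _ ↔ (boolDFA op m n hm hn ρ₁ ρ₂).evalFrom (some (st m hm 0), some (st n hn 0)) z ∈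
      (boolDFA op m n hm hn ρ₁ ρ₂).accept
    rw [evalFrom_boolDFA]
    rfl
  rw [e]
  refine encard_le_kappa_of_dfa _ S ?_ ?_
  · intro s hs
    obtain ⟨w, hw, h1, h2⟩ := reach s hs
    refine ⟨w, e ▸ hw, (evalFrom_boolDFA _ w).trans ?_⟩
    exact Prod.ext h1 h2
  · intro s hs s' hs' hne
    obtain ⟨z, hz⟩ := dist s hs s' hs' hne
    refine ⟨z, ?_⟩
    rw [evalFrom_boolDFA, evalFrom_boolDFA]
    exact hz

theorem IsPair.le_kappa_bool (P : IsPair ρ₁ ρ₂ t k) {J : Language Letter6}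
    (hJ : ∀ z, z ∈ J ↔ op (z ∈ (dialDFA m hm ρ₁).accepts) (z ∈ (dialDFA n hn ρ₂).accepts))
    (hop : op True False ∨ op True True)
    (hfst : ¬ (op True False ↔ op False False) ∨ ¬ (op True True ↔ op False True))
    (hsnd : ¬ (op False True ↔ op False False) ∨ ¬ (op True True ↔ op True False)) :
    ((m * n : ℕ) : ℕ∞) ≤ kappa J := by
  have card : (Set.range (some : Fin m → _) ×ˢ Set.range (some : Fin n → _)).encard =
      ((m * n : ℕ) : ℕ∞) := by
    rw [Set.encard_prod, encard_range_some, encard_range_some]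
    simp
  rw [← card]
  refine encard_le_kappa_bool hJ _ ?_ ?_
  · rintro ⟨_, _⟩ ⟨⟨p, rfl⟩, ⟨q, rfl⟩⟩
    obtain ⟨w, hw, h⟩ := P.exists_reach_start (hm := hm) (hn := hn) p q
    exact ⟨w, fun x hx => P.mem_alph_bool hJ hop (hw x hx).1 (hw x hx).2, h⟩
  · rintro ⟨_, _⟩ ⟨⟨p, rfl⟩, ⟨q, rfl⟩⟩ ⟨_, _⟩ ⟨⟨p', rfl⟩, ⟨q', rfl⟩⟩ hne
    by_cases hp : (some p : Option (Fin m)) = some p'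
    · have hq : (some q : Option (Fin n)) ≠ some q' := fun e => hne (by rw [hp, e])
      rcases hsnd with h | h
      exacts [P.boolDist_snd h _ _ hq, P.boolDist_some_snd h _ _ hq]
    · rcases hfst with h | h
      exacts [P.boolDist h hp _ _, P.boolDist_some h hp _ _]

/-- A state of the first DFA is reachable together with the sink of the second one. -/
theorem IsPair.exists_reach_none (P : IsPair ρ₁ ρ₂ t k) {x : Letter6} (h1 : ρ₁ x = some .c)
    (h2 : ρ₂ x = none) (p : Fin m) :
    ∃ w : List Letter6, (∀ y ∈ w, y = x ∨ ρ₁ y ≠ none ∧ ρ₂ y ≠ none) ∧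
      drun m hm ρ₁ (some (st m hm 0)) w = some p ∧
      drun n hn ρ₂ (some (st n hn 0)) w = none := by
  by_cases hp : p = st m hm 0
  · subst hp
    exact ⟨[x], by simp, drun_c_zero h1, drun_eq_none h2 _⟩
  · have hp0 : p.val ≠ 0 := fun e => hp (Fin.ext e)
    refine ⟨x :: k :: List.replicate (p.val - 1) .a, ?_, ?_, ?_⟩
    · intro y hy
      simp only [List.mem_cons, List.mem_replicate] at hy
      rcases hy with rfl | rfl | ⟨-, rfl⟩
      · exact Or.inl rfl
      · simp [P.k_snd, P.fst.k]
      · simp [P.fst.a, P.snd.a]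
    · rw [drun_cons, drun_c_zero h1]
      exact drun_const_a_pow P.fst _ (by omega) p.2
    · rw [drun_cons, drun_eq_none h2, drun_none]

theorem mem_alph_of_c {J : Language Letter6}
    (hJ : ∀ z, z ∈ J ↔ op (z ∈ (dialDFA m hm ρ₁).accepts) (z ∈ (dialDFA n hn ρ₂).accepts))
    (hop : op True False) {x : Letter6} (h1 : ρ₁ x = some .c) (h2 : ρ₂ x = none) : x ∈ alph J := by
  refine ⟨[x], ?_, by simp⟩
  rw [hJ]
  have e1 : [x] ∈ (dialDFA m hm ρ₁).accepts := drun_c_zero (hn := hm) h1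
  have e2 : [x] ∉ (dialDFA n hn ρ₂).accepts := fun h => by
    have h := (drun_eq_none (hn := hn) h2 (some (st n hn 0))).symm.trans h
    simp at h
  rwa [eq_true e1, eq_false e2]

/-- The case of the difference. The letter `x` acts as `c` in the first automaton and sends the
second to its sink. Equal first components are ordinary states and can be driven to 0 while the
second ones, possibly sinks, are compared. -/
theorem IsPair.le_kappa_bool_left (P : IsPair ρ₁ ρ₂ t k) {J : Language Letter6}
    (hJ : ∀ z, z ∈ J ↔ op (z ∈ (dialDFA m hm ρ₁).accepts) (z ∈ (dialDFA n hn ρ₂).accepts))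
    (hop : op True False) (hff : ¬ op False False) (hsnd : ¬ op True True)
    {x : Letter6} (h1 : ρ₁ x = some .c) (h2 : ρ₂ x = none) :
    ((m * n + m : ℕ) : ℕ∞) ≤ kappa J := by
  have card : (Set.range (some : Fin m → _) ×ˢ (Set.univ : Set (Option (Fin n)))).encard =
      ((m * n + m : ℕ) : ℕ∞) := by
    rw [Set.encard_prod, encard_range_some, encard_univ_option, ← Nat.cast_one, ← Nat.cast_add,
      ← Nat.cast_mul, Nat.mul_succ]
  rw [← card]
  refine encard_le_kappa_bool hJ _ ?_ ?_
  · rintro ⟨_, (_ | q)⟩ ⟨⟨p, rfl⟩, -⟩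
    · obtain ⟨w, hw, h⟩ := P.exists_reach_none (hm := hm) (hn := hn) h1 h2 p
      refine ⟨w, fun y hy => ?_, h⟩
      rcases hw y hy with rfl | hy
      exacts [mem_alph_of_c hJ hop h1 h2, P.mem_alph_bool hJ (Or.inl hop) hy.1 hy.2]
    · obtain ⟨w, hw, h⟩ := P.exists_reach_start (hm := hm) (hn := hn) p q
      exact ⟨w, fun x hx => P.mem_alph_bool hJ (Or.inl hop) (hw x hx).1 (hw x hx).2, h⟩
  · rintro ⟨_, q⟩ ⟨⟨p, rfl⟩, -⟩ ⟨_, q'⟩ ⟨⟨p', rfl⟩, -⟩ hne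
    by_cases hp : (some p : Option (Fin m)) = some p'
    · have hq : q ≠ q' := fun e => hne (by rw [hp, e])
      exact P.boolDist_some_snd (fun h => hsnd (h.2 hop)) _ _ hq
    · exact P.boolDist (fun h => hff (h.1 hop)) hp _ _

theorem IsPair.le_kappa_bool_both (P : IsPair ρ₁ ρ₂ t k) {J : Language Letter6}
    (hJ : ∀ z, z ∈ J ↔ op (z ∈ (dialDFA m hm ρ₁).accepts) (z ∈ (dialDFA n hn ρ₂).accepts))
    (htf : op True False) (hft : op False True) (hff : ¬ op False False)
    {x y : Letter6} (h1 : ρ₁ x = some .c) (h2 : ρ₂ x = none) (h3 : ρ₂ y = some .c)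
    (h4 : ρ₁ y = none) :
    (((m + 1) * (n + 1) : ℕ) : ℕ∞) ≤ kappa J := by
  have card : (Set.univ : Set (Option (Fin m) × Option (Fin n))).encard =
      (((m + 1) * (n + 1) : ℕ) : ℕ∞) := by
    rw [← Set.univ_prod_univ, Set.encard_prod, encard_univ_option, encard_univ_option]
    norm_cast
  have hx : x ∈ alph J := mem_alph_of_c hJ htf h1 h2
  have hy : y ∈ alph J :=
    mem_alph_of_c (op := fun p q => op q p) hJ hft h3 h4
  have hJw := fun z => P.mem_alph_bool hJ (Or.inl htf) (x := z)
  rw [← card]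
  refine encard_le_kappa_bool hJ _ ?_ ?_
  · rintro ⟨(_ | p), (_ | q)⟩ -
    · refine ⟨[x, y], ?_, ?_, ?_⟩
      · simp [IsWord, hx, hy]
      · rw [drun_cons, drun_eq_none h4]
      · rw [drun_cons, drun_eq_none h2, drun_none]
    · obtain ⟨w, hw, h⟩ := P.symm.exists_reach_none (hm := hn) (hn := hm) h3 h4 q
      refine ⟨w, fun z hz => ?_, h.symm⟩
      rcases hw z hz with rfl | hz
      exacts [hy, hJw z hz.2 hz.1]
    · obtain ⟨w, hw, h⟩ := P.exists_reach_none (hm := hm) (hn := hn) h1 h2 p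
      refine ⟨w, fun z hz => ?_, h⟩
      rcases hw z hz with rfl | hz
      exacts [hx, hJw z hz.1 hz.2]
    · obtain ⟨w, hw, h⟩ := P.exists_reach_start (hm := hm) (hn := hn) p q
      exact ⟨w, fun z hz => hJw z (hw z hz).1 (hw z hz).2, h⟩
  · rintro ⟨p, q⟩ - ⟨p', q'⟩ - hne
    by_cases hp : p = p'
    · have hq : q ≠ q' := fun e => hne (by rw [hp, e])
      exact P.boolDist_snd (fun h => hff (h.1 hft)) _ _ hq
    · exact P.boolDist (fun h => hff (h.1 htf)) hp _ _

end Booleans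


/-! ### Products of pairs of dialects: lower bounds -/

theorem step_c_one {n : ℕ} {hn : 4 ≤ n} : step n hn (st n hn 1) .c = st n hn 1 := by
  simp only [step]
  rw [if_neg (by omega)]

theorem encard_range_some_diff_zero {m : ℕ} {hm : 4 ≤ m} :
    (Set.range (some : Fin m → Option (Fin m)) \ {some (st m hm 0)}).encard = ((m - 1 : ℕ) : ℕ∞) := by
  have h := Set.encard_sdiff_singleton_add_one
    (s := Set.range (some : Fin m → Option (Fin m))) (a := some (st m hm 0)) ⟨_, rfl⟩
  rw [encard_range_some, show (m : ℕ∞) = ((m - 1 : ℕ) : ℕ∞) + 1 by norm_cast; omega] at h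
  exact ENat.add_left_injective_of_ne_top ENat.one_ne_top h

theorem encard_univ_option_diff_zero {m : ℕ} {hm : 4 ≤ m} :
    ((Set.univ : Set (Option (Fin m))) \ {some (st m hm 0)}).encard = (m : ℕ∞) := by
  have h := Set.encard_sdiff_singleton_add_one
    (s := (Set.univ : Set (Option (Fin m)))) (a := some (st m hm 0)) trivial
  rw [encard_univ_option] at h
  exact ENat.add_left_injective_of_ne_top ENat.one_ne_top h

section Products

variable {m n : ℕ} {hm : 4 ≤ m} {hn : 4 ≤ n} {ρ₁ ρ₂ : Letter6 → Option Letter5} {t k : Letter6}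

theorem mulDFA_singleton_of_ne (s : Option (Fin m) × Option (Fin n)) (x : Letter6)
    (h : drun m hm ρ₁ s.1 [x] ≠ some (st m hm 0)) :
    (mulDFA (dialDFA m hm ρ₁) (dialDFA n hn ρ₂)).evalFrom s [x] =
      (drun m hm ρ₁ s.1 [x], drun n hn ρ₂ s.2 [x]) :=
  Prod.ext rfl (if_neg h)

theorem mulDFA_singleton_of_eq (s : Option (Fin m) × Option (Fin n)) (x : Letter6)
    (h : drun m hm ρ₁ s.1 [x] = some (st m hm 0)) :
    (mulDFA (dialDFA m hm ρ₁) (dialDFA n hn ρ₂)).evalFrom s [x] =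
      (some (st m hm 0), some (st n hn 0)) :=
  Prod.ext h (if_pos h)

/-- Without `d` the first component cannot come to 0, so no reset occurs and the product automaton
behaves like a direct product. -/
theorem mulDFA_evalFrom (heq : ∀ x, ρ₁ x = some .d → x = .d)
    {s : Option (Fin m) × Option (Fin n)} (hs : s.1 ≠ some (st m hm 0)) {w : List Letter6}
    (hw : .d ∉ w) :
    (mulDFA (dialDFA m hm ρ₁) (dialDFA n hn ρ₂)).evalFrom s w =
      (drun m hm ρ₁ s.1 w, drun n hn ρ₂ s.2 w) := by
  induction w generalizing s with
  | nil => rfl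
  | cons x w ih =>
    simp only [List.mem_cons, not_or] at hw
    have hx : drun m hm ρ₁ s.1 [x] ≠ some (st m hm 0) :=
      drun_singleton_ne_zero (fun h => hw.1 (heq x h).symm) hs
    rw [← List.singleton_append, DFA.evalFrom_of_append, mulDFA_singleton_of_ne s x hx,
      ih hx hw.2, drun_append, drun_append]

/-- The letter `t` is accepted from the start state and from no other state considered. If the first
components differ, a word ending in its only `d` brings one of them to 0, which resets the second
component to its accepting start, while the other state ends rejecting. If only the second
components differ, they are separated while the first is kept off 0. -/
theorem IsPair.mulDFA_distinguishing (P : IsPair ρ₁ ρ₂ t k)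
    {s s' : Option (Fin m) × Option (Fin n)}
    (hs : s = (some (st m hm 0), some (st n hn 0)) ∨ s.1 ≠ some (st m hm 0))
    (hs' : s' = (some (st m hm 0), some (st n hn 0)) ∨ s'.1 ≠ some (st m hm 0)) (hne : s ≠ s') :
    ∃ z, ¬ (((mulDFA (dialDFA m hm ρ₁) (dialDFA n hn ρ₂)).evalFrom s z).2 = some (st n hn 0) ↔
      ((mulDFA (dialDFA m hm ρ₁) (dialDFA n hn ρ₂)).evalFrom s' z).2 = some (st n hn 0)) := by
  have ht : ρ₁ t ≠ some .d := by rw [P.t_fst]; simp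
  have start_t : ((mulDFA (dialDFA m hm ρ₁) (dialDFA n hn ρ₂)).evalFrom
      (some (st m hm 0), some (st n hn 0)) [t]).2 = some (st n hn 0) := by
    rw [mulDFA_singleton_of_eq _ _ P.drun_t_zero]
  have other_t : ∀ s : Option (Fin m) × Option (Fin n), s.1 ≠ some (st m hm 0) →
      ((mulDFA (dialDFA m hm ρ₁) (dialDFA n hn ρ₂)).evalFrom s [t]).2 ≠ some (st n hn 0) := by
    intro s hs
    rw [mulDFA_singleton_of_ne _ _ (drun_singleton_ne_zero ht hs)]
    exact drun_const_ne_zero P.snd.k _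
  rcases hs with rfl | hs
  · rcases hs' with rfl | hs'
    · exact absurd rfl hne
    · exact ⟨[t], fun h => other_t _ hs' (h.1 start_t)⟩
  rcases hs' with rfl | hs'
  · exact ⟨[t], fun h => other_t _ hs (h.2 start_t)⟩
  have snoc_ne : ∀ s : Option (Fin m) × Option (Fin n), s.1 ≠ some (st m hm 0) →
      ∀ w : List Letter6, .d ∉ w → drun m hm ρ₁ s.1 (w ++ [.d]) ≠ some (st m hm 0) →
      ((mulDFA (dialDFA m hm ρ₁) (dialDFA n hn ρ₂)).evalFrom s (w ++ [.d])).2 =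
        drun n hn ρ₂ s.2 (w ++ [.d]) := by
    intro s hs w hw h
    rw [drun_append] at h
    rw [DFA.evalFrom_of_append, mulDFA_evalFrom P.fst.eq_d hs hw, mulDFA_singleton_of_ne _ _ h,
      drun_append]
  have snoc_eq : ∀ s : Option (Fin m) × Option (Fin n), s.1 ≠ some (st m hm 0) →
      ∀ w : List Letter6, .d ∉ w → drun m hm ρ₁ s.1 (w ++ [.d]) = some (st m hm 0) →
      ((mulDFA (dialDFA m hm ρ₁) (dialDFA n hn ρ₂)).evalFrom s (w ++ [.d])).2 =
        some (st n hn 0) := by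
    intro s hs w hw h
    rw [drun_append] at h
    rw [DFA.evalFrom_of_append, mulDFA_evalFrom P.fst.eq_d hs hw, mulDFA_singleton_of_eq _ _ h]
  by_cases hp : s.1 = s'.1
  · have hq : s.2 ≠ s'.2 := fun e => hne (Prod.ext hp e)
    by_cases hq0 : s.2 = some (st n hn 0)
    · exact ⟨[], fun h => hq (hq0.trans (h.1 hq0).symm)⟩
    by_cases hq0' : s'.2 = some (st n hn 0)
    · exact ⟨[], fun h => hq0 (h.2 hq0')⟩
    obtain ⟨w, hw, h, h3⟩ := P.symm.exists_separating_of_ne_zero (hn := hm) hq hq0 hq0'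
    refine ⟨w ++ [.d], ?_⟩
    have hd := P.symm.ne_d_of_mem hw
    rw [snoc_ne s hs w hd (h3 _), snoc_ne s' hs' w hd (h3 _)]
    rcases h with ⟨h1, h2⟩ | ⟨h1, h2⟩
    exacts [fun h => h2 (h.1 h1), fun h => h2 (h.2 h1)]
  · obtain ⟨w, hw, h, h3⟩ := P.exists_separating_of_ne_zero (hn := hn) hp hs hs'
    refine ⟨w ++ [.d], ?_⟩
    have hd := P.ne_d_of_mem hw
    rcases h with ⟨h1, h2⟩ | ⟨h1, h2⟩
    · rw [snoc_eq s hs w hd h1, snoc_ne s' hs' w hd h2]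
      exact fun h => h3 _ (h.1 rfl)
    · rw [snoc_eq s' hs' w hd h1, snoc_ne s hs w hd h2]
      exact fun h => h3 _ (h.2 rfl)

theorem IsPair.encard_le_kappa_mul (P : IsPair ρ₁ ρ₂ t k)
    (hsc : IsSuffixClosed (dialDFA n hn ρ₂).accepts)
    (T : Set (Option (Fin m) × Option (Fin n))) (hT : ∀ s ∈ T, s.1 ≠ some (st m hm 0))
    (reach : ∀ s ∈ T, ∃ w : List Letter6, (∀ x ∈ w, ρ₁ x ≠ none ∨ ρ₂ x ≠ none) ∧
      (mulDFA (dialDFA m hm ρ₁) (dialDFA n hn ρ₂)).eval w = s) :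
    T.encard + 1 ≤ kappa ((dialDFA m hm ρ₁).accepts * (dialDFA n hn ρ₂).accepts) := by
  have hnil₁ : [] ∈ (dialDFA m hm ρ₁).accepts := rfl
  have hnil₂ : [] ∈ (dialDFA n hn ρ₂).accepts := rfl
  have hal : alph ((dialDFA m hm ρ₁).accepts * (dialDFA n hn ρ₂).accepts) =
      {x | ρ₁ x ≠ none} ∪ {x | ρ₂ x ≠ none} := by
    rw [alph_mul hnil₁ hnil₂, alph_dialDFA P.fst, alph_dialDFA P.snd]
  have e := accepts_mulDFA (dialDFA m hm ρ₁) (dialDFA n hn ρ₂) hnil₁ hnil₂ hsc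
  have h0 : (some (st m hm 0), some (st n hn 0)) ∉ T := fun h => hT _ h rfl
  rw [← Set.encard_insert_of_notMem h0, ← e]
  have hcase : ∀ s ∈ insert (some (st m hm 0), some (st n hn 0)) T,
      s = (some (st m hm 0), some (st n hn 0)) ∨ s.1 ≠ some (st m hm 0) :=
    fun s hs => hs.imp_right (hT s)
  refine encard_le_kappa_of_dfa _ _ ?_ fun s hs s' hs' hne =>
    P.mulDFA_distinguishing (hcase s hs) (hcase s' hs') hne
  rintro s (rfl | hs)
  · exact ⟨[], by simp [IsWord], rfl⟩
  · obtain ⟨w, hw, h⟩ := reach s hs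
    refine ⟨w, ?_, h⟩
    rw [IsWord, e, hal]
    exact hw

theorem IsPair.exists_mulDFA_eval (P : IsPair ρ₁ ρ₂ t k) {p : Fin m} (hp : p ≠ st m hm 0)
    (q : Fin n) :
    ∃ w : List Letter6, (∀ x ∈ w, ρ₁ x ≠ none ∨ ρ₂ x ≠ none) ∧
      (mulDFA (dialDFA m hm ρ₁) (dialDFA n hn ρ₂)).eval w = (some p, some q) := by
  obtain ⟨w, hw, h1, h2⟩ := P.exists_reach (hn := hn) hp q
  refine ⟨[k] ++ w, ?_, ?_⟩
  · intro x hx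
    rcases List.mem_append.1 hx with hx | hx
    · rw [List.mem_singleton.1 hx, P.fst.k]; simp
    · rcases hw x hx with rfl | rfl
      · simp [P.fst.a]
      · simp [P.t_fst]
  · have hk : drun m hm ρ₁ (some (st m hm 0)) [k] ≠ some (st m hm 0) :=
      drun_const_ne_zero P.fst.k _
    have e : (mulDFA (dialDFA m hm ρ₁) (dialDFA n hn ρ₂)).eval [k] =
        (some (st m hm 1), some (st n hn 0)) := by
      refine (mulDFA_singleton_of_ne (some (st m hm 0), some (st n hn 0)) k hk).trans ?_
      rw [drun_const P.fst.k, P.drun_k_zero]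
    rw [DFA.eval, DFA.evalFrom_of_append]
    change (mulDFA (dialDFA m hm ρ₁) (dialDFA n hn ρ₂)).evalFrom
      ((mulDFA (dialDFA m hm ρ₁) (dialDFA n hn ρ₂)).eval [k]) w = _
    rw [e, mulDFA_evalFrom P.fst.eq_d (by simp) (P.ne_d_of_mem hw), h1, h2]

theorem IsPair.le_kappa_mul (P : IsPair ρ₁ ρ₂ t k)
    (hsc : IsSuffixClosed (dialDFA n hn ρ₂).accepts) :
    ((m * n - n + 1 : ℕ) : ℕ∞) ≤
      kappa ((dialDFA m hm ρ₁).accepts * (dialDFA n hn ρ₂).accepts) := by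
  have card : ((Set.range (some : Fin m → Option (Fin m)) \ {some (st m hm 0)}) ×ˢ
      Set.range (some : Fin n → Option (Fin n))).encard + 1 = ((m * n - n + 1 : ℕ) : ℕ∞) := by
    rw [Set.encard_prod, encard_range_some_diff_zero, encard_range_some,
      show m * n - n = (m - 1) * n by rw [Nat.sub_mul, one_mul]]
    norm_cast
  rw [← card]
  refine P.encard_le_kappa_mul hsc _ (fun s hs => hs.1.2) ?_
  rintro ⟨_, _⟩ ⟨⟨⟨p, rfl⟩, hp⟩, ⟨q, rfl⟩⟩
  exact P.exists_mulDFA_eval (fun e => hp (by rw [e]; rfl)) q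

theorem IsPair.le_kappa_mul_unrestricted (P : IsPair ρ₁ ρ₂ t k)
    (hsc : IsSuffixClosed (dialDFA n hn ρ₂).accepts) {x y : Letter6} (h1 : ρ₁ x = some .c)
    (h2 : ρ₂ x = none) (h3 : ρ₂ y = some .c) (h4 : ρ₁ y = none) :
    ((m * n + m + 1 : ℕ) : ℕ∞) ≤
      kappa ((dialDFA m hm ρ₁).accepts * (dialDFA n hn ρ₂).accepts) := by
  have card : (((Set.univ : Set (Option (Fin m))) \ {some (st m hm 0)}) ×ˢ
      (Set.univ : Set (Option (Fin n)))).encard + 1 = ((m * n + m + 1 : ℕ) : ℕ∞) := by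
    rw [Set.encard_prod, encard_univ_option_diff_zero, encard_univ_option, ← Nat.mul_succ]
    norm_cast
  rw [← card]
  refine P.encard_le_kappa_mul hsc _ (fun s hs => hs.1.2) ?_
  have hxd : x ≠ .d := fun e => by rw [e, P.fst.d] at h1; simp at h1
  have ey : (mulDFA (dialDFA m hm ρ₁) (dialDFA n hn ρ₂)).eval [y] =
      (none, some (st n hn 0)) := by
    refine (mulDFA_singleton_of_ne (some (st m hm 0), some (st n hn 0)) y ?_).trans ?_
    · rw [drun_eq_none h4]; simp
    · rw [drun_eq_none h4, drun_c_zero h3]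
  have eval_append : ∀ u w, (mulDFA (dialDFA m hm ρ₁) (dialDFA n hn ρ₂)).eval (u ++ w) =
      (mulDFA (dialDFA m hm ρ₁) (dialDFA n hn ρ₂)).evalFrom
        ((mulDFA (dialDFA m hm ρ₁) (dialDFA n hn ρ₂)).eval u) w :=
    fun u w => DFA.evalFrom_of_append _ _ _ _
  rintro ⟨(_ | p), (_ | q)⟩ ⟨⟨-, hp⟩, -⟩
  · refine ⟨[y] ++ [x], ?_, ?_⟩
    · simp [h1, h3]
    · rw [eval_append, ey, mulDFA_evalFrom P.fst.eq_d (by simp) (by simpa using hxd.symm),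
        drun_none, drun_eq_none h2]
  · by_cases hq : q = st n hn 0
    · exact ⟨[y], by simp [h3], by rw [ey, hq]⟩
    · have hq0 : q.val ≠ 0 := fun e => hq (Fin.ext e)
      have hw : ∀ z ∈ t :: List.replicate (q.val - 1) Letter6.a, z = .a ∨ z = t := by
        intro z hz
        simp only [List.mem_cons, List.mem_replicate] at hz
        tauto
      refine ⟨[y] ++ (t :: List.replicate (q.val - 1) .a), ?_, ?_⟩
      · intro z hz
        rcases List.mem_append.1 hz with hz | hz
        · rw [List.mem_singleton.1 hz, h3]; simp
        · rcases hw z hz with rfl | rfl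
          · simp [P.fst.a]
          · simp [P.t_fst]
      · rw [eval_append, ey, mulDFA_evalFrom P.fst.eq_d (by simp) (P.ne_d_of_mem hw), drun_none,
          drun_const_a_pow P.snd _ (by omega) q.2]
  · have hp : p ≠ st m hm 0 := fun e => hp (by rw [e]; rfl)
    have hp0 : p.val ≠ 0 := fun e => hp (Fin.ext e)
    have hp2 := p.2
    -- From (1, 0) the letter `x` sends the second component to the sink and, acting as `c`, fixes 1
    -- in the first; powers of `a` then reach `p`.
    obtain ⟨w, hw, e⟩ := P.exists_mulDFA_eval (hn := hn) (p := st m hm 1) (hm := hm)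
      (by simp) (st n hn 0)
    refine ⟨w ++ (x :: List.replicate (p.val - 1) .a), ?_, ?_⟩
    · intro z hz
      rcases List.mem_append.1 hz with hz | hz
      · exact hw z hz
      · simp only [List.mem_cons, List.mem_replicate] at hz
        rcases hz with rfl | ⟨-, rfl⟩
        · simp [h1]
        · simp [P.fst.a]
    · rw [eval_append, e, mulDFA_evalFrom P.fst.eq_d (by simp)
        (by simp [List.mem_replicate, hxd.symm])]
      rw [drun_cons, drun_singleton _ h1, step_c_one, drun_a_pow P.fst.a le_rfl (by omega),
        drun_cons, drun_eq_none h2, drun_none]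
      congr 2
      apply Fin.ext
      simp only
      omega
  · exact P.exists_mulDFA_eval (fun e => hp (by rw [e]; rfl)) q

end Products


/-! ### The dialects of the witness stream -/

/-- The letters replaced in `L_n(a,b,-,d,e)` (`β = false`) and `L_n(a,b,c,d,e)` (`β = true`). -/
def rhoFst (β : Bool) : Letter6 → Option Letter5
  | .a => some .a
  | .b => some .b
  | .c => if β then some .c else none
  | .d => some .d
  | .e => some .e
  | .f => none

/-- The letters replaced in `L_n(a,e,-,d,b)` (`β = false`) and `L_n(a,e,f,d,b)` (`β = true`). -/
def rhoSnd (β : Bool) : Letter6 → Option Letter5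
  | .a => some .a
  | .b => some .e
  | .c => none
  | .d => some .d
  | .e => some .b
  | .f => if β then some .c else none

/-- The letters replaced in `L_n(a,-,-,d,e)`. -/
def rhoADE : Letter6 → Option Letter5
  | .a => some .a
  | .d => some .d
  | .e => some .e
  | _ => none

theorem isPair_rho (β : Bool) : IsPair (rhoFst β) (rhoSnd β) .b .e := by
  cases β <;>
    exact ⟨⟨rfl, rfl, rfl, fun x => by cases x <;> simp [rhoFst]⟩,
      ⟨rfl, rfl, rfl, fun x => by cases x <;> simp [rhoSnd]⟩, rfl, rfl⟩

theorem hasADE_rhoADE : HasADE rhoADE .e :=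
  ⟨rfl, rfl, rfl, fun x => by cases x <;> simp [rhoADE]⟩

section Stream

variable (n : ℕ) (hn : 4 ≤ n)

theorem Lade_eq : Lade n hn = (dialDFA n hn rhoADE).accepts :=
  dialect_eq_accepts fun l x => by cases l <;> cases x <;> simp [rhoADE]

theorem Labde_eq : Labde n hn = (dialDFA n hn (rhoFst false)).accepts :=
  dialect_eq_accepts fun l x => by cases l <;> cases x <;> simp [rhoFst]

theorem Labcde_eq : Labcde n hn = (dialDFA n hn (rhoFst true)).accepts :=
  dialect_eq_accepts fun l x => by cases l <;> cases x <;> simp [rhoFst]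

theorem Laedb_eq : Laedb n hn = (dialDFA n hn (rhoSnd false)).accepts :=
  dialect_eq_accepts fun l x => by cases l <;> cases x <;> simp [rhoSnd]

theorem Laefdb_eq : Laefdb n hn = (dialDFA n hn (rhoSnd true)).accepts :=
  dialect_eq_accepts fun l x => by cases l <;> cases x <;> simp [rhoSnd]

theorem isSuffixClosed_Ldial (x₁ x₂ x₃ x₄ x₅ : Option Letter6) :
    IsSuffixClosed (Ldial n hn x₁ x₂ x₃ x₄ x₅) := isSuffixClosed_dialect _ (isSuffixClosed_L n hn)

theorem inClass_Lade : InClass (Lade n hn) n :=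
  ⟨isSuffixClosed_Ldial n hn _ _ _ _ _, Lade_eq n hn ▸ kappa_dialDFA hasADE_rhoADE⟩

theorem inClass_Labde : InClass (Labde n hn) n :=
  ⟨isSuffixClosed_Ldial n hn _ _ _ _ _, Labde_eq n hn ▸ kappa_dialDFA (isPair_rho false).fst⟩

theorem inClass_Labcde : InClass (Labcde n hn) n :=
  ⟨isSuffixClosed_Ldial n hn _ _ _ _ _, Labcde_eq n hn ▸ kappa_dialDFA (isPair_rho true).fst⟩

theorem inClass_Laedb : InClass (Laedb n hn) n :=
  ⟨isSuffixClosed_Ldial n hn _ _ _ _ _, Laedb_eq n hn ▸ kappa_dialDFA (isPair_rho false).snd⟩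

theorem inClass_Laefdb : InClass (Laefdb n hn) n :=
  ⟨isSuffixClosed_Ldial n hn _ _ _ _ _, Laefdb_eq n hn ▸ kappa_dialDFA (isPair_rho true).snd⟩

theorem alph_Labde_eq_alph_Laedb (m : ℕ) (hm : 4 ≤ m) :
    alph (Labde m hm) = alph (Laedb n hn) := by
  rw [Labde_eq, Laedb_eq, alph_dialDFA (isPair_rho false).fst, alph_dialDFA (isPair_rho false).snd]
  ext x
  cases x <;> simp [rhoFst, rhoSnd]

end Stream

/-! ### Exact values for the witness stream: upper and lower bounds combined -/

/-- Symmetric difference as an operation on truth values. -/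
def xorOp (p q : Prop) : Prop := p ∧ ¬ q ∨ q ∧ ¬ p

theorem kappa_bool_restricted_le {α : Type u} {K' K : Language α} {m n : ℕ} (hK' : InClass K' m)
    (hK : InClass K n) (hal : alph K' = alph K) :
    kappa (K' ⊔ K) ≤ ((m * n : ℕ) : ℕ∞) ∧ kappa (K' ∆ K) ≤ ((m * n : ℕ) : ℕ∞) ∧
      kappa (K' ⊓ K) ≤ ((m * n : ℕ) : ℕ∞) ∧ kappa (K' \ K) ≤ ((m * n : ℕ) : ℕ∞) :=
  ⟨kappa_bool_le_of_alph_eq Or (by simp) (fun _ => Iff.rfl) hK' hK hal,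
    kappa_bool_le_of_alph_eq xorOp (by simp [xorOp]) (fun _ => Iff.rfl) hK' hK hal,
    kappa_inf_le hK' hK,
    kappa_bool_le_of_alph_eq (fun p q => p ∧ ¬ q) (by simp) (fun _ => Iff.rfl) hK' hK hal⟩

theorem kappa_bool_unrestricted_le {α : Type u} {K' K : Language α} {m n : ℕ} (hK' : InClass K' m)
    (hK : InClass K n) :
    kappa (K' ⊔ K) ≤ (((m + 1) * (n + 1) : ℕ) : ℕ∞) ∧
      kappa (K' ∆ K) ≤ (((m + 1) * (n + 1) : ℕ) : ℕ∞) ∧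
      kappa (K' \ K) ≤ ((m * n + m : ℕ) : ℕ∞) ∧ kappa (K' ⊓ K) ≤ ((m * n : ℕ) : ℕ∞) :=
  ⟨kappa_bool_le_unrestricted Or (fun _ => Iff.rfl) hK' hK,
    kappa_bool_le_unrestricted xorOp (fun _ => Iff.rfl) hK' hK,
    kappa_sdiff_le hK' hK, kappa_inf_le hK' hK⟩

theorem kappa_bool_restricted (m n : ℕ) (hm : 4 ≤ m) (hn : 4 ≤ n) :
    kappa (Labde m hm ⊔ Laedb n hn) = ((m * n : ℕ) : ℕ∞) ∧
      kappa (Labde m hm ∆ Laedb n hn) = ((m * n : ℕ) : ℕ∞) ∧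
      kappa (Labde m hm ⊓ Laedb n hn) = ((m * n : ℕ) : ℕ∞) ∧
      kappa (Labde m hm \ Laedb n hn) = ((m * n : ℕ) : ℕ∞) := by
  obtain ⟨h1, h2, h3, h4⟩ := kappa_bool_restricted_le (inClass_Labde m hm) (inClass_Laedb n hn)
    (alph_Labde_eq_alph_Laedb n hn m hm)
  refine ⟨h1.antisymm ?_, h2.antisymm ?_, h3.antisymm ?_, h4.antisymm ?_⟩ <;>
    rw [Labde_eq, Laedb_eq]
  · exact (isPair_rho false).le_kappa_bool (op := Or) (fun _ => Iff.rfl) (by simp) (by simp)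
      (by simp)
  · exact (isPair_rho false).le_kappa_bool (op := xorOp) (fun _ => Iff.rfl) (by simp [xorOp])
      (by simp [xorOp]) (by simp [xorOp])
  · exact (isPair_rho false).le_kappa_bool (op := And) (fun _ => Iff.rfl) (by simp) (by simp)
      (by simp)
  · exact (isPair_rho false).le_kappa_bool (op := fun p q => p ∧ ¬ q) (fun _ => Iff.rfl) (by simp)
      (by simp) (by simp)

theorem kappa_bool_unrestricted (m n : ℕ) (hm : 4 ≤ m) (hn : 4 ≤ n) :
    kappa (Labcde m hm ⊔ Laefdb n hn) = (((m + 1) * (n + 1) : ℕ) : ℕ∞) ∧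
      kappa (Labcde m hm ∆ Laefdb n hn) = (((m + 1) * (n + 1) : ℕ) : ℕ∞) ∧
      kappa (Labcde m hm \ Laefdb n hn) = ((m * n + m : ℕ) : ℕ∞) ∧
      kappa (Labcde m hm ⊓ Laefdb n hn) = ((m * n : ℕ) : ℕ∞) := by
  obtain ⟨h1, h2, h3, h4⟩ := kappa_bool_unrestricted_le (inClass_Labcde m hm) (inClass_Laefdb n hn)
  refine ⟨h1.antisymm ?_, h2.antisymm ?_, h3.antisymm ?_, h4.antisymm ?_⟩ <;>
    rw [Labcde_eq, Laefdb_eq]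
  · exact (isPair_rho true).le_kappa_bool_both (op := Or) (x := .c) (y := .f) (fun _ => Iff.rfl)
      (by simp) (by simp) (by simp) rfl rfl rfl rfl
  · exact (isPair_rho true).le_kappa_bool_both (op := xorOp) (x := .c) (y := .f)
      (fun _ => Iff.rfl) (by simp [xorOp]) (by simp [xorOp]) (by simp [xorOp]) rfl rfl rfl rfl
  · exact (isPair_rho true).le_kappa_bool_left (op := fun p q => p ∧ ¬ q) (x := .c)
      (fun _ => Iff.rfl) (by simp) (by simp) (by simp) rfl rfl
  · exact (isPair_rho true).le_kappa_bool (op := And) (fun _ => Iff.rfl) (by simp) (by simp)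
      (by simp)

theorem kappa_mul_restricted (m n : ℕ) (hm : 4 ≤ m) (hn : 4 ≤ n) :
    kappa (Labde m hm * Laedb n hn) = ((m * n - n + 1 : ℕ) : ℕ∞) := by
  refine (kappa_mul_le_of_alph_eq hm hn (inClass_Labde m hm) (inClass_Laedb n hn)
    (alph_Labde_eq_alph_Laedb n hn m hm)).antisymm ?_
  have hsc := (inClass_Laedb n hn).1
  rw [Laedb_eq] at hsc
  rw [Labde_eq, Laedb_eq]
  exact (isPair_rho false).le_kappa_mul hsc

theorem kappa_mul_unrestricted (m n : ℕ) (hm : 4 ≤ m) (hn : 4 ≤ n) :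
    kappa (Labcde m hm * Laefdb n hn) = ((m * n + m + 1 : ℕ) : ℕ∞) := by
  refine (kappa_mul_le hm (inClass_Labcde m hm) (inClass_Laefdb n hn)).antisymm ?_
  have hsc := (inClass_Laefdb n hn).1
  rw [Laefdb_eq] at hsc
  rw [Labcde_eq, Laefdb_eq]
  exact (isPair_rho true).le_kappa_mul_unrestricted hsc (x := .c) (y := .f) rfl rfl rfl rfl

theorem InClass.kappa_atomOf_le {α : Type u} {K : Language α} {n : ℕ} (hn : 4 ≤ n)
    (hK : InClass K n) {S : Set (Language α)} (hS : S ⊆ quotients K) (ha : atomOf K S ∈ atoms K) :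
    (S = ∅ → kappa (atomOf K S) ≤ n) ∧
      (S = quotients K → kappa (atomOf K S) ≤ ((2 ^ (n - 1) : ℕ) : ℕ∞)) ∧
      (S ≠ ∅ → S ≠ quotients K →
        K ∈ S ∧ kappa (atomOf K S) ≤ (atomValue n S.ncard : ℕ∞)) := by
  refine ⟨?_, ?_, fun h0 h1 => ?_⟩
  · rintro rfl
    exact (kappa_atomOf_empty_le hK.1).trans hK.2.le
  · rintro rfl
    exact kappa_atomOf_quotients_le hK
  · have hKS := self_mem_of_atomOf_mem hK.1 hS h0 ha
    exact ⟨hKS, SuffixClosed.kappa_atomOf_le hn hK hS hKS h1⟩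

theorem kappa_atomOf_L (n : ℕ) (hn : 4 ≤ n) {S : Set (Language Letter5)}
    (hS : S ⊆ quotients (L n hn)) (ha : atomOf (L n hn) S ∈ atoms (L n hn)) :
    (S = ∅ → kappa (atomOf (L n hn) S) = n) ∧
      (S = quotients (L n hn) → kappa (atomOf (L n hn) S) = ((2 ^ (n - 1) : ℕ) : ℕ∞)) ∧
      (S ≠ ∅ → S ≠ quotients (L n hn) →
        L n hn ∈ S ∧ kappa (atomOf (L n hn) S) = (atomValue n S.ncard : ℕ∞)) := by
  obtain ⟨h1, h2, h3⟩ := (inClass_L n hn).kappa_atomOf_le hn hS ha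
  refine ⟨fun h => (h1 h).antisymm ?_, fun h => (h2 h).antisymm ?_, fun h h' => ?_⟩
  · subst h
    exact le_kappa_atomOf_empty
  · subst h
    exact le_kappa_atomOf_quotients
  · obtain ⟨hLS, hle⟩ := h3 h h'
    exact ⟨hLS, hle.antisymm (le_kappa_atomOf_L hS ha hLS h')⟩

end SuffixClosed


theorem theorem3 (m n : ℕ) (hm : 4 ≤ m) (hn : 4 ≤ n) :
    -- the DFA is minimal; its language is the complement of `M_n`, suffix-closed, of complexity `n`
    (IsMinimalDFA (D n hn) ∧
      L n hn = (M n hn)ᶜ ∧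
      IsSuffixClosed (L n hn) ∧
      kappa (L n hn) = n) ∧
    -- the dialects used below are in the class; the pair for the restricted case shares its alphabet
    (InClass (Lade n hn) n ∧
      InClass (Labde m hm) m ∧
      InClass (Laedb n hn) n ∧
      InClass (Labcde m hm) m ∧
      InClass (Laefdb n hn) n ∧
      alph (Labde m hm) = alph (Laedb n hn)) ∧
    -- syntactic semigroup: witness, bound, and five letters are needed
    (ENat.card (SyntacticSemigroup (L n hn)) =
        ((n ^ (n - 1) + n - 1 : ℕ) : ℕ∞) ∧
      ∀ (α : Type u) [Finite α] (K : Language α), InClass K n →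
        ENat.card (SyntacticSemigroup K) ≤ ((n ^ (n - 1) + n - 1 : ℕ) : ℕ∞) ∧
        ((alph K).encard < 5 →
          ENat.card (SyntacticSemigroup K) ≠ ((n ^ (n - 1) + n - 1 : ℕ) : ℕ∞))) ∧
    -- complexity of the quotients
    ((∀ Q ∈ quotients (Lade n hn), kappa Q = n) ∧
      ∀ (α : Type u) [Finite α] (K : Language α), InClass K n →
        ∀ Q ∈ quotients K, kappa Q ≤ n) ∧
    -- reversal and number of atoms
    (kappa (Lade n hn).reverse = ((2 ^ (n - 1) + 1 : ℕ) : ℕ∞) ∧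
      (atoms (Lade n hn)).encard = ((2 ^ (n - 1) + 1 : ℕ) : ℕ∞) ∧
      ∀ (α : Type u) [Finite α] (K : Language α), InClass K n →
        kappa K.reverse ≤ ((2 ^ (n - 1) + 1 : ℕ) : ℕ∞) ∧
        (atoms K).encard ≤ ((2 ^ (n - 1) + 1 : ℕ) : ℕ∞)) ∧
    -- complexity of the atoms
    ((∀ S ⊆ quotients (L n hn),
        atomOf (L n hn) S ∈
          atoms (L n hn) →
        (S = ∅ →
          kappa (atomOf (L n hn) S) = n) ∧
        (S = quotients (L n hn) →
          kappa (atomOf (L n hn) S) =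
            ((2 ^ (n - 1) : ℕ) : ℕ∞)) ∧
        (S ≠ ∅ → S ≠ quotients (L n hn) →
          L n hn ∈ S ∧
          kappa (atomOf (L n hn) S) =
            (atomValue n S.ncard : ℕ∞))) ∧
      ∀ (α : Type u) [Finite α] (K : Language α), InClass K n →
        ∀ S ⊆ quotients K,
          atomOf K S ∈ atoms K →
          (S = ∅ → kappa (atomOf K S) ≤ n) ∧
          (S = quotients K →
            kappa (atomOf K S) ≤ ((2 ^ (n - 1) : ℕ) : ℕ∞)) ∧
          (S ≠ ∅ → S ≠ quotients K →
            K ∈ S ∧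
            kappa (atomOf K S) ≤
              (atomValue n S.ncard : ℕ∞))) ∧
    -- star
    (kappa (Lade n hn)∗ = n ∧
      ∀ (α : Type u) [Finite α] (K : Language α), InClass K n →
        kappa K∗ ≤ n) ∧
    -- restricted product
    (kappa (Labde m hm * Laedb n hn) =
        ((m * n - n + 1 : ℕ) : ℕ∞) ∧
      ∀ (α : Type u) [Finite α] (K' K : Language α), InClass K' m →
        InClass K n → alph K' = alph K →
        kappa (K' * K) ≤ ((m * n - n + 1 : ℕ) : ℕ∞)) ∧
    -- unrestricted product
    (kappa (Labcde m hm * Laefdb n hn) =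
        ((m * n + m + 1 : ℕ) : ℕ∞) ∧
      ∀ (α : Type u) [Finite α] (K' K : Language α), InClass K' m →
        InClass K n →
        kappa (K' * K) ≤ ((m * n + m + 1 : ℕ) : ℕ∞)) ∧
    -- restricted boolean operations
    ((kappa (Labde m hm ⊔ Laedb n hn) =
        ((m * n : ℕ) : ℕ∞) ∧
      kappa (Labde m hm ∆ Laedb n hn) =
        ((m * n : ℕ) : ℕ∞) ∧
      kappa (Labde m hm ⊓ Laedb n hn) =
        ((m * n : ℕ) : ℕ∞) ∧
      kappa (Labde m hm \ Laedb n hn) =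
        ((m * n : ℕ) : ℕ∞)) ∧
      ∀ (α : Type u) [Finite α] (K' K : Language α), InClass K' m →
        InClass K n → alph K' = alph K →
        kappa (K' ⊔ K) ≤ ((m * n : ℕ) : ℕ∞) ∧
        kappa (K' ∆ K) ≤ ((m * n : ℕ) : ℕ∞) ∧
        kappa (K' ⊓ K) ≤ ((m * n : ℕ) : ℕ∞) ∧
        kappa (K' \ K) ≤ ((m * n : ℕ) : ℕ∞)) ∧
    -- unrestricted boolean operations
    ((kappa (Labcde m hm ⊔ Laefdb n hn) =
        (((m + 1) * (n + 1) : ℕ) : ℕ∞) ∧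
      kappa (Labcde m hm ∆ Laefdb n hn) =
        (((m + 1) * (n + 1) : ℕ) : ℕ∞) ∧
      kappa (Labcde m hm \ Laefdb n hn) =
        ((m * n + m : ℕ) : ℕ∞) ∧
      kappa (Labcde m hm ⊓ Laefdb n hn) =
        ((m * n : ℕ) : ℕ∞)) ∧
      ∀ (α : Type u) [Finite α] (K' K : Language α), InClass K' m →
        InClass K n →
        kappa (K' ⊔ K) ≤ (((m + 1) * (n + 1) : ℕ) : ℕ∞) ∧
        kappa (K' ∆ K) ≤ (((m + 1) * (n + 1) : ℕ) : ℕ∞) ∧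
        kappa (K' \ K) ≤ ((m * n + m : ℕ) : ℕ∞) ∧
        kappa (K' ⊓ K) ≤ ((m * n : ℕ) : ℕ∞)) := by
  refine ⟨⟨isMinimalDFA_D n hn, L_eq_compl n hn, isSuffixClosed_L n hn, kappa_L n hn⟩,
    ⟨inClass_Lade n hn, inClass_Labde m hm, inClass_Laedb n hn, inClass_Labcde m hm,
      inClass_Laefdb n hn, alph_Labde_eq_alph_Laedb n hn m hm⟩,
    ⟨card_syntacticSemigroup_L n hn, fun α _ K hK => syntacticSemigroup_bound hn hK⟩,
    ⟨fun Q hQ => kappa_quotient_dialDFA hasADE_rhoADE (Lade_eq n hn ▸ hQ),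
      fun α _ K hK Q hQ => (kappa_quotient_le hQ).trans hK.2.le⟩,
    ⟨(kappa_reverse_le (inClass_Lade n hn)).antisymm ?_,
      (encard_atoms_le (inClass_Lade n hn)).antisymm ?_,
      fun α _ K hK => ⟨kappa_reverse_le hK, encard_atoms_le hK⟩⟩,
    ⟨fun S hS ha => kappa_atomOf_L n hn hS ha, fun α _ K hK S hS ha => hK.kappa_atomOf_le hn hS ha⟩,
    ⟨?_, fun α _ K hK => (kappa_kstar_le hK.1 (hK.nil_mem hn)).trans hK.2.le⟩,
    ⟨kappa_mul_restricted m n hm hn,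
      fun α _ K' K hK' hK hal => kappa_mul_le_of_alph_eq hm hn hK' hK hal⟩,
    ⟨kappa_mul_unrestricted m n hm hn, fun α _ K' K hK' hK => kappa_mul_le hm hK' hK⟩,
    ⟨kappa_bool_restricted m n hm hn,
      fun α _ K' K hK' hK hal => kappa_bool_restricted_le hK' hK hal⟩,
    ⟨kappa_bool_unrestricted m n hm hn,
      fun α _ K' K hK' hK => kappa_bool_unrestricted_le hK' hK⟩⟩
  · rw [Lade_eq]
    exact le_kappa_reverse_dialDFA hasADE_rhoADE
  · rw [Lade_eq]
    exact le_encard_atoms_dialDFA hasADE_rhoADE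
  · have h := inClass_Lade n hn
    refine ((kappa_kstar_le h.1 (h.nil_mem hn)).trans h.2.le).antisymm ?_
    rw [Lade_eq]
    exact le_kappa_kstar_dialDFA hasADE_rhoADE
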